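/- **Setting.** Let $d\in\{2,3\}$, let $\Omega\subset\mathbb R^d$ be a bounded domain with $\operatorname{int}\overline\Omega=\Omega$, let $\mathcal B^\epsilon$ be a finite union of closed balls, and let $\Omega^\epsilon=\Omega\setminus\mathcal B^\epsilon$. Let $V$ be the space of $v\in H^1(\Omega^\epsilon)$ that vanish on $\partial\Omega\cap\partial\Omega^\epsilon$ (i.e. whose extension by zero is in $H^1(\mathbb R^d\setminus\mathcal B^\epsilon)$). Put $a(u,v)=\int_{\Omega^\epsilon}\nabla u\cdot\nabla v$, $\|v\|_a^2=a(v,v)$, $\|v\|^2=\int_{\Omega^\epsilon}v^2$. For $f\in L^2(\Omega^\epsilon)$ let $u\in V$ satisfy $a(u,v)=(f,v)$ for all $v\in V$. *Coarse mesh.* Let $T_1,\dots,T_{N_c}\subset\overline\Omega$ be closed coarse cells with null boundaries and disjoint interiors which cover $\Omega^\epsilon$, have diameter at most $H$, contain a ball of radius $H/\sigma$, and have at most $2^d$ vertices each. Let $K_i=\operatorname{int}T_i\setminus\mathcal B^\epsilon$. Let $\{\chi_j\}_{j=1}^{N_v}$ be Lipschitz functions indexed by the coarse vertices (each vertex lying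 in a cell is a vertex of that cell), such that on the cells $0\le\chi_j\le1$, $\sum_j\chi_j=1$, and $\chi_j$ vanishes on every cell that does not contain the vertex $j$; such that the bubble $B=\prod_j\chi_j$ (product over the vertices of the cell) vanishes on the boundary of each cell; and such that $|\nabla\chi_j|\le c_1/H$ and $\tilde\kappa:=\sum_j|\nabla\chi_j|^2>0$ a.e. on $\Omega^\epsilon$. Put $s_i(u,v)=\int_{K_i}\tilde\kappa uv$, $a_i(u,v)=\int_{K_i}\nabla u\cdot\nabla v$, $s=\sum_is_i$, $\|v\|_s^2=s(v,v)$. Write $K_{i,m}$ for $K_i$ enlarged by $m$ layers of coarse elements (a layer adds all elements whose cells touch the region), and let $V_0(K_{i,m})$ be the set of $v\in V$ vanishing outside $K_{i,m}$. *Auxiliary space.* For each $i$ let $\lambda^i_1\le\lambda^i_2\le\cdots$ be the eigenvalues of $a_i(\phi,v)=\lambda s_i(\phi,v)$ for all $v\in H^1(K_i)$, with an orthonormal basis $\phi^i_1,\phi_2^i,\dots$ of $L^2(K_i;\tilde\kappa)$ of eigenfunctions in $H^1(K_i)$. Let $l_i\ge1$ with $\lambda^i_{l_i+1}>0$, $V_{\rm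 aux}^i=\operatorname{span}\{\phi^i_1,\dots,\phi^i_{l_i}\}$, $V_{\rm aux}=\bigoplus_iV_{\rm aux}^i$ (extension by zero), and let $\pi(v)=\sum_i\sum_{j\le l_i}\frac{s_i(v,\phi^i_j)}{s_i(\phi_j^i,\phi_j^i)}\phi^i_j$. Put $$\Lambda_\omega=\min_{K_i\cap\omega\ne\emptyset}\lambda^i_{l_i+1}\ (\min\emptyset=\infty),\quad \Gamma_\omega=\max_{K_i\cap\omega\neq\emptyset}\lambda^i_{l_i},\quad D_\omega=C_{\mathcal T}(1+\Gamma_\omega),\quad C_\pi=\sup_{K_i,\ \mu\in V_{\rm aux}}\frac{\int_{K_i}\tilde\kappa\mu^2}{\int_{K_i}B\tilde\kappa\mu^2},$$ where $C_{\mathcal T}$ is the square of the maximal number of vertices of a cell. *Relaxed multiscale spaces.* Let $k_i\ge2$ be integers and $k=\max_ik_i$. For $j\le l_i$ let $\psi^i_j$ and $\psi^i_{j,\rm ms}$ minimize $a(\psi,\psi)+s(\pi\psi-\phi^i_j,\pi\psi-\phi^i_j)$ over $V$ and over $V_0(K_{i,k_i})$ respectively, let $V_{\rm glo}$ and $V_{\rm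 ms}$ be the spans of these functions, and let $u_{\rm glo}\in V_{\rm glo}$, $u_{\rm ms}\in V_{\rm ms}$ satisfy $a(u_{\rm glo},v)=(f,v)$ for all $v\in V_{\rm glo}$ and $a(u_{\rm ms},v)=(f,v)$ for all $v\in V_{\rm ms}$. Let $E=\max_iE_i$ with $$E_i=3\bigl(1+\Lambda^{-1}_{\Omega^\epsilon\setminus K_{i,k_i-1}}\bigr)\Bigl(1+\bigl(2(1+\Lambda_{K_{i,k_i-1}}^{-1/2})\bigr)^{-1}\Bigr)^{1-k_i}.$$ **Theorem.** There is a constant $C>0$, depending only on $d$, $\sigma$, $c_1$, upper bounds for $C_\pi$ and for $\operatorname{diam}\Omega$, and a constant $c_P$ in the Poincaré inequality $\|v\|\le c_P\|v\|_a$ ($v\in V$), such that the following holds. 1. If $\tilde\kappa^{-1/2}f\in L^2(\Omega^\epsilon)$, then both $\|u-u_{\rm ms}\|$ and $\|u-u_{\rm ms}\|_a$ are at most $$C\Lambda_{\Omega^\epsilon}^{-1/2}\|\tilde\kappa^{-1/2}f\|+C(k+1)^{d/2}(1+\Lambda_{\Omega^\epsilon}^{-1})^{1/2}(1+D_{\Omega^\epsilon})^{1/2}E^{1/2}\|u_{\rm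 glo}\|_s .$$ 2. If $\{\chi_j\}$ is a bilinear partition of unity (each cell is a one-to-one multilinear image of the unit cube taking the cube's vertices to distinct coarse vertices, and the $\chi_j$ are the multilinear shape functions in reference coordinates; trilinear for $d=3$) and all $k_i$ are sufficiently large, namely $k_i\ge k_0$ with $k_0$ depending only on the quantities that $C$ depends on and on $H,\Lambda_{\Omega^\epsilon},\Gamma_{\Omega^\epsilon}$, then $$\|u-u_{\rm ms}\|_a\le CH\Lambda_{\Omega^\epsilon}^{-1/2}\|f\|.$$ -/

import Mathlib

open MeasureTheory Set
open scoped ENNReal NNReal ContDiff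

noncomputable section

namespace CEM

/-- The Euclidean space in which the domain lives. -/
abbrev Sp (d : ℕ) : Type := EuclideanSpace ℝ (Fin d)

section Sobolev

variable {d : ℕ}

/-- `g` is a weak gradient of `u` on the open set `U`. -/
def HasWeakGrad (U : Set (Sp d)) (u : Sp d → ℝ) (g : Sp d → Sp d) : Prop :=
  ∀ θ : Sp d → ℝ, ContDiff ℝ ∞ θ → HasCompactSupport θ → tsupport θ ⊆ U →
    ∀ e : Sp d, ∫ x in U, u x * fderiv ℝ θ x e = - ∫ x in U, inner ℝ (g x) e * θ x

/-- `u` belongs to the Sobolev space `H¹(U)`. -/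
def MemH1 (U : Set (Sp d)) (u : Sp d → ℝ) : Prop :=
  MemLp u 2 (volume.restrict U) ∧
    ∃ g : Sp d → Sp d, MemLp g 2 (volume.restrict U) ∧ HasWeakGrad U u g

open Classical in
/-- The weak gradient on `U` of a function in `H¹(U)` (a representative; it is unique a.e.). -/
def weakGrad (U : Set (Sp d)) (u : Sp d → ℝ) : Sp d → Sp d :=
  if h : ∃ g : Sp d → Sp d, MemLp g 2 (volume.restrict U) ∧ HasWeakGrad U u g
  then Classical.choose h else 0

/-- The energy form `∫_U ∇u · ∇v`. -/
def aForm (U : Set (Sp d)) (u v : Sp d → ℝ) : ℝ :=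
  ∫ x in U, inner ℝ (weakGrad U u x) (weakGrad U v x)

/-- The energy norm on `U`. -/
def aNorm (U : Set (Sp d)) (u : Sp d → ℝ) : ℝ := Real.sqrt (aForm U u u)

/-- The `L²` norm on `U`. -/
def l2Norm (U : Set (Sp d)) (u : Sp d → ℝ) : ℝ := Real.sqrt (∫ x in U, u x ^ 2)

/-- The weighted form `∫_U w u v`. -/
def wForm (w : Sp d → ℝ) (U : Set (Sp d)) (u v : Sp d → ℝ) : ℝ :=
  ∫ x in U, w x * u x * v x

end Sobolev

/-- A domain perforated by finitely many closed balls, a coarse mesh of the perforated domain,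
and a partition of unity on the coarse mesh. The perforated domain is `Ω` minus the balls. -/
structure Discretization (d : ℕ) where
  /-- the unperforated domain -/
  Ω : Set (Sp d)
  isOpen_Ω : IsOpen Ω
  isConnected_Ω : IsConnected Ω
  isBounded_Ω : Bornology.IsBounded Ω
  /-- `Ω` has no slits, so that extendability by zero encodes a zero trace on its boundary -/
  regular_Ω : interior (closure Ω) = Ω
  /-- number of perforating balls, their centres and radii -/
  Np : ℕ
  center : Fin Np → Sp d
  radius : Fin Np → ℝ
  radius_pos : ∀ p, 0 < radius p
  /-- number of coarse cells and of coarse vertices -/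
  Nc : ℕ
  Nv : ℕ
  /-- coarse mesh size -/
  H : ℝ
  H_pos : 0 < H
  /-- the closed coarse cells (before the perforations are removed) -/
  T : Fin Nc → Set (Sp d)
  isClosed_T : ∀ i, IsClosed (T i)
  T_subset : ∀ i, T i ⊆ closure Ω
  T_frontier : ∀ i, volume (frontier (T i)) = 0
  T_disjoint : ∀ i i', i ≠ i' → Disjoint (interior (T i)) (interior (T i'))
  T_cover : Ω \ (⋃ p, Metric.closedBall (center p) (radius p)) ⊆ ⋃ i, T i
  T_diam : ∀ i, Metric.diam (T i) ≤ H
  /-- the coarse vertices; the vertices of a cell are those that lie in it -/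
  node : Fin Nv → Sp d
  node_injective : Function.Injective node
  node_card : ∀ i, {j | node j ∈ T i}.ncard ≤ 2 ^ d
  /-- the partition of unity; values away from the cells play no role -/
  χ : Fin Nv → Sp d → ℝ
  χ_lipschitz : ∀ j, ∃ L : ℝ≥0, LipschitzWith L (χ j)
  χ_mem : ∀ j i, ∀ x ∈ T i, χ j x ∈ Icc (0 : ℝ) 1
  χ_sum : ∀ i, ∀ x ∈ T i, ∑ j, χ j x = 1
  /-- the function attached to a vertex lives on the cells that contain the vertex -/
  χ_support : ∀ j i, node j ∉ T i → ∀ x ∈ T i, χ j x = 0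
  /-- the bubble, the product of the functions of the vertices of a cell, vanishes on the
  boundary of the cell -/
  χ_bubble : ∀ i, ∀ x ∈ frontier (T i), ∃ j, node j ∈ T i ∧ χ j x = 0
  /-- the weight `∑ |∇χ_j|²` does not degenerate -/
  χ_weight : ∀ᵐ x ∂(volume.restrict (Ω \ (⋃ p, Metric.closedBall (center p) (radius p)))),
    0 < ∑ j, ‖fderiv ℝ (χ j) x‖ ^ 2

namespace Discretization

variable {d : ℕ} (P : Discretization d)

/-- The union of the perforations. -/
def holes : Set (Sp d) := ⋃ p, Metric.closedBall (P.center p) (P.radius p)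

/-- The perforated domain. -/
def Ωε : Set (Sp d) := P.Ω \ P.holes

/-- The coarse element: the (open) coarse cell without the perforations. -/
def K (i : Fin P.Nc) : Set (Sp d) := interior (P.T i) \ P.holes

/-- The weight `κ̃ = ∑ |∇χ_j|²`. -/
def kt (x : Sp d) : ℝ := ∑ j, ‖fderiv ℝ (P.χ j) x‖ ^ 2

/-- Quantitative mesh regularity: every cell contains a ball of radius `H / σ`, and
`|∇χ_j| ≤ c / H`. -/
def IsRegular (σ c : ℝ) : Prop :=
  (∀ i, ∃ z, Metric.closedBall z (P.H / σ) ⊆ P.T i) ∧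
    ∀ j, ∀ᵐ x ∂(volume.restrict P.Ωε), ‖fderiv ℝ (P.χ j) x‖ ≤ c / P.H

/-- The space `V` of `H¹` functions on the perforated domain with zero trace on the part of the
boundary of `Ω` outside the perforations: the extension by zero is an `H¹` function on the
complement of the perforations. Nothing is imposed on the boundary of the perforations. -/
def MemV (v : Sp d → ℝ) : Prop := MemH1 P.holesᶜ (indicator P.Ωε v)

/-- `c` is a constant in the Poincaré inequality on `V`. -/
def IsPoincareConst (c : ℝ) : Prop := ∀ v, P.MemV v → l2Norm P.Ωε v ≤ c * aNorm P.Ωε v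

/-- The form `s(u, v) = ∫ κ̃ u v` on the perforated domain. -/
def s (u v : Sp d → ℝ) : ℝ := wForm P.kt P.Ωε u v

/-- The `s`-norm. -/
def sNorm (u : Sp d → ℝ) : ℝ := Real.sqrt (P.s u u)

/-- The form `s_i`. -/
def si (i : Fin P.Nc) (u v : Sp d → ℝ) : ℝ := wForm P.kt (P.K i) u v

/-- Indices of the cells in the region obtained from cell `i` by adding `m` layers of cells. -/
def layer (i : Fin P.Nc) : ℕ → Set (Fin P.Nc)
  | 0 => {i}
  | m + 1 => {q | ∃ r ∈ layer i m, (P.T q ∩ P.T r).Nonempty}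

/-- The oversampled region `K_{i,m}` (up to the null set of cell boundaries). -/
def patch (i : Fin P.Nc) (m : ℕ) : Set (Sp d) := ⋃ q ∈ P.layer i m, P.K q

/-- The space `V_0(K_{i,m})`, its functions being extended by zero. -/
def MemV0 (i : Fin P.Nc) (m : ℕ) (v : Sp d → ℝ) : Prop :=
  P.MemV v ∧ ∀ᵐ x ∂(volume.restrict (P.Ωε \ P.patch i m)), v x = 0

/-- For every coarse element `K_i`, the sequence `lam i 0 ≤ lam i 1 ≤ …` lists the eigenvalues of
the local spectral problem `a_i(φ, v) = λ s_i(φ, v)` for all `v ∈ H¹(K_i)`, and the `phi i j` are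
corresponding eigenfunctions forming an orthonormal basis of `L²(K_i; κ̃)`. Counting of the
eigenvalues starts from `0`. -/
structure IsEigensystem (lam : Fin P.Nc → ℕ → ℝ) (phi : Fin P.Nc → ℕ → Sp d → ℝ) : Prop where
  memH1 : ∀ i j, MemH1 (P.K i) (phi i j)
  eigen : ∀ i j v, MemH1 (P.K i) v →
    aForm (P.K i) (phi i j) v = lam i j * P.si i (phi i j) v
  orthonormal : ∀ i j j', P.si i (phi i j) (phi i j') = if j = j' then 1 else 0
  mono : ∀ i, Monotone (lam i)
  complete : ∀ i (v : Sp d → ℝ),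
    MemLp (fun x => Real.sqrt (P.kt x) * v x) 2 (volume.restrict (P.K i)) →
    (∀ j, P.si i v (phi i j) = 0) → ∀ᵐ x ∂(volume.restrict (P.K i)), v x = 0

/-- `Λ_S`, the minimum of `λ^i_{l_i+1}` over the elements meeting `S`. If there are none, the real
infimum is `0`, whose inverse is `0`, in accordance with `min ∅ = ∞`. -/
def Lam (lam : Fin P.Nc → ℕ → ℝ) (l : Fin P.Nc → ℕ) (S : Set (Sp d)) : ℝ :=
  sInf {t | ∃ i, (P.K i ∩ S).Nonempty ∧ t = lam i (l i)}

/-- `Γ_S`, the maximum of `λ^i_{l_i}` over the elements meeting `S`. -/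
def Gam (lam : Fin P.Nc → ℕ → ℝ) (l : Fin P.Nc → ℕ) (S : Set (Sp d)) : ℝ :=
  sSup {t | ∃ i, (P.K i ∩ S).Nonempty ∧ t = lam i (l i - 1)}

/-- The square of the maximal number of vertices of a coarse cell. -/
def CT : ℝ := ((Finset.univ.sup fun i => {j | P.node j ∈ P.T i}.ncard : ℕ) : ℝ) ^ 2

/-- `D_S = C_T (1 + Γ_S)`. -/
def D (lam : Fin P.Nc → ℕ → ℝ) (l : Fin P.Nc → ℕ) (S : Set (Sp d)) : ℝ :=
  P.CT * (1 + P.Gam lam l S)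

/-- The decay factor `E_i`. -/
def Ei (lam : Fin P.Nc → ℕ → ℝ) (l k : Fin P.Nc → ℕ) (i : Fin P.Nc) : ℝ :=
  3 * (1 + (P.Lam lam l (P.Ωε \ P.patch i (k i - 1)))⁻¹) *
    (1 + (2 * (1 + P.Lam lam l (P.patch i (k i - 1)) ^ (-(1 / 2) : ℝ)))⁻¹) ^ (1 - (k i : ℤ))

/-- `E = max_i E_i`. -/
def Emax (lam : Fin P.Nc → ℕ → ℝ) (l k : Fin P.Nc → ℕ) : ℝ := ⨆ i, P.Ei lam l k i

/-- `k = max_i k_i`. -/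
def kmax (k : Fin P.Nc → ℕ) : ℕ := Finset.univ.sup k

open Classical in
/-- The bubble function of a cell, the product of the `χ_j` over the vertices of the cell. -/
def bubble (i : Fin P.Nc) (x : Sp d) : ℝ :=
  ∏ j ∈ Finset.univ.filter (fun j => P.node j ∈ P.T i), P.χ j x

/-- The local auxiliary space, spanned by the first `l_i` eigenfunctions. -/
def Vaux (phi : Fin P.Nc → ℕ → Sp d → ℝ) (l : Fin P.Nc → ℕ) (i : Fin P.Nc) :
    Submodule ℝ (Sp d → ℝ) :=
  Submodule.span ℝ {g | ∃ j < l i, g = phi i j}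

/-- The constant `C_π`, the supremum of `∫_K κ̃ μ² / ∫_K B κ̃ μ²` over the coarse elements `K`
and over the auxiliary functions `μ`. -/
def Cpi (phi : Fin P.Nc → ℕ → Sp d → ℝ) (l : Fin P.Nc → ℕ) : ℝ≥0∞ :=
  ⨆ i, ⨆ μ ∈ P.Vaux phi l i, ENNReal.ofReal (P.si i μ μ) /
    ENNReal.ofReal (∫ x in P.K i, P.bubble i x * P.kt x * μ x ^ 2)

/-- The projection `π` onto the auxiliary space; the eigenfunctions are extended by zero. -/
def proj (phi : Fin P.Nc → ℕ → Sp d → ℝ) (l : Fin P.Nc → ℕ) (v : Sp d → ℝ) : Sp d → ℝ :=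
  ∑ i, ∑ j ∈ Finset.range (l i),
    (P.si i v (phi i j) / P.si i (phi i j) (phi i j)) • indicator (P.K i) (phi i j)

/-- The functional `a(ψ, ψ) + s(π ψ - φ_j^i, π ψ - φ_j^i)` of the relaxed construction. -/
def cost (phi : Fin P.Nc → ℕ → Sp d → ℝ) (l : Fin P.Nc → ℕ) (i : Fin P.Nc) (j : ℕ)
    (ψ : Sp d → ℝ) : ℝ :=
  aForm P.Ωε ψ ψ + P.s (P.proj phi l ψ - indicator (P.K i) (phi i j))
    (P.proj phi l ψ - indicator (P.K i) (phi i j))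

/-- `ψ` is the relaxed global multiscale basis function attached to `phi i j`. -/
def IsGlobalBasis (phi : Fin P.Nc → ℕ → Sp d → ℝ) (l : Fin P.Nc → ℕ) (i : Fin P.Nc) (j : ℕ)
    (ψ : Sp d → ℝ) : Prop :=
  P.MemV ψ ∧ ∀ w, P.MemV w → P.cost phi l i j ψ ≤ P.cost phi l i j w

/-- `ψ` is the relaxed multiscale basis function attached to `phi i j` on `K_{i,m}`. -/
def IsLocalBasis (phi : Fin P.Nc → ℕ → Sp d → ℝ) (l : Fin P.Nc → ℕ) (i : Fin P.Nc) (m j : ℕ)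
    (ψ : Sp d → ℝ) : Prop :=
  P.MemV0 i m ψ ∧ ∀ w, P.MemV0 i m w → P.cost phi l i j ψ ≤ P.cost phi l i j w

/-- The span of a family of basis functions indexed by `1 ≤ i ≤ N_c` and `1 ≤ j ≤ l_i`. -/
def basisSpan (l : Fin P.Nc → ℕ) (ψ : (i : Fin P.Nc) → Fin (l i) → Sp d → ℝ) :
    Submodule ℝ (Sp d → ℝ) :=
  Submodule.span ℝ {g | ∃ i j, g = ψ i j}

/-- `u` is the weak solution: `u ∈ V` and `a(u, v) = (f, v)` for all `v ∈ V`. -/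
def IsWeakSolution (f u : Sp d → ℝ) : Prop :=
  P.MemV u ∧ ∀ v, P.MemV v → aForm P.Ωε u v = ∫ x in P.Ωε, f x * v x

/-- `u` is the Galerkin solution in the space `W`. -/
def IsGalerkin (W : Submodule ℝ (Sp d → ℝ)) (f u : Sp d → ℝ) : Prop :=
  u ∈ W ∧ ∀ v ∈ W, aForm P.Ωε u v = ∫ x in P.Ωε, f x * v x

/-- Multilinear shape function on the unit cube attached to the cube vertex `b`. -/
def shape (b : Fin d → Bool) (t : Sp d) : ℝ := ∏ m, if b m then t m else 1 - t m

/-- The `χ_j` form a bilinear (for `d = 3`, trilinear) partition of unity: every cell is a one-to-one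
multilinear image of the unit cube that takes the vertices of the cube to coarse vertices, and in
the reference coordinates the `χ_j` are the multilinear shape functions. -/
def IsBilinear : Prop :=
  ∀ i, ∃ e : (Fin d → Bool) → Fin P.Nv, Function.Injective e ∧
    InjOn (fun t : Sp d => ∑ b, shape b t • P.node (e b)) {t | ∀ m, t m ∈ Icc (0 : ℝ) 1} ∧
    P.T i = (fun t : Sp d => ∑ b, shape b t • P.node (e b)) '' {t | ∀ m, t m ∈ Icc (0 : ℝ) 1} ∧
    ∀ j, ∀ t : Sp d, (∀ m, t m ∈ Icc (0 : ℝ) 1) →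
      P.χ j (∑ b, shape b t • P.node (e b)) = ∑ b, if e b = j then shape b t else 0

end Discretization

end CEM

end

/-! Expanding the cost functional shows that the global basis function of `phi i j` is the Riesz
representative of the coefficient functional v ↦ s_i(v, φ_j^i) for the inner product `ip`(u, v) =
a(u, v) + s(πu, πv). The local one represents the same functional on V_0(K_{i,k_i}).

Global error. A finite-dimensional argument (`c_eq_zero_of_orthogonal`) shows that whatever is
a-orthogonal to V_glo has zero auxiliary projection. Hence w = u - u_glo satisfies ‖w‖_s² ≤
Λ⁻¹‖w‖_a² by the spectral gap. Together with a(w, w) = (f, w) this is the first term of the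
estimate.

Localization. Write u_glo as a sum of contributions u_i of the cells, and use the same coefficients
in the localized basis. By quasi-optimality this competitor bounds the Galerkin error. Each u_i is
`ip`-orthogonal to all functions without coefficients on cell i. Testing with u_i times a cutoff
built from the partition of unity compares the energy outside m + 1 layers with that in one annulus,
so it decays geometrically (`out_succ_le`, `out_le_pow`), and the error of each localized
contribution is bounded by this tail (`ip_sub_le`). The errors of different cells are almost
orthogonal (`ip_sum_le`), with an overlap that is bounded by a volume count.

Stability. Summing the cell errors requires ∑ ip(u_i, u_i) ≲ ip(u_glo, u_glo) (`ip_component_le`).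
The test function is supported in one cell, has prescribed auxiliary coefficients x_j, and has
energy at most a constant times ∑ (1 + λ_j) x_j² (`exists_lift`). It is sought as bubble times
auxiliary function, which leads to a linear system with matrix T_ab = s_i(Bφ_a, φ_b). Finiteness of
C_π makes T coercive, but this controls only the unweighted norm of the solution. The weighted bound
holds because (λ_a - λ_b)T_ab contains only first derivatives: the second-order part of the
commutator of B with the eigenproblem cancels (`exists_solution_energy_le`,
`abs_cauchy_multiplier_le`). Weighting by the individual λ_j instead of Γ is what keeps a second
factor 1 + Γ out of the squared error. The only such factor comes from `a_le_of_orthogonal`, which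
bounds ‖u_glo‖_a by ‖u_glo‖_s.

Bilinear case. The shape functions reproduce the identity map, so their gradients cannot all be
small and κ̃ ≥ 1/(8H²). The first term is then O(H), and enough layers make the exponentially small
second term no larger. -/

noncomputable section

/-! ### Test functions of Lipschitz regularity -/

namespace CEM
open Filter Topology

section Mollification

variable {d : ℕ}

/-- The bounded ratio of outer to inner radius is what makes mollifications converge at Lebesgue
points, hence almost everywhere, for functions that are merely locally integrable. -/
theorem exists_contDiffBump_seq (δ : ℝ) (hδ : 0 < δ) :
    ∃ φ : ℕ → ContDiffBump (0 : Sp d), (∀ n, (φ n).rOut ≤ δ) ∧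
      Tendsto (fun n => (φ n).rOut) atTop (𝓝 0) ∧ ∀ n, (φ n).rOut ≤ 2 * (φ n).rIn := by
  refine ⟨fun n => ⟨δ / (2 * ((n : ℝ) + 1)), δ / ((n : ℝ) + 1), by positivity, ?_⟩, ?_, ?_, ?_⟩
  · apply div_lt_div_of_pos_left hδ (by positivity); linarith [n.cast_nonneg (α := ℝ)]
  · intro n; exact div_le_self hδ.le (by linarith [n.cast_nonneg (α := ℝ)])
  · have := (tendsto_one_div_add_atTop_nhds_zero_nat (𝕜 := ℝ)).const_mul δ
    simpa [div_eq_mul_inv] using this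
  · intro n
    show δ / ((n : ℝ) + 1) ≤ 2 * (δ / (2 * ((n : ℝ) + 1)))
    apply le_of_eq; field_simp

open scoped Convolution

/-- The derivative may fall on the Lipschitz factor: by Rademacher the difference quotients of η(· -
t) converge for almost every t, and they are dominated by K times the bump. -/
theorem hasFDerivAt_bump_convolution (φ : ContDiffBump (0 : Sp d)) {η : Sp d → ℝ} {K : ℝ≥0}
    (hη : LipschitzWith K η) (x : Sp d) :
    HasFDerivAt (φ.normed volume ⋆[ContinuousLinearMap.lsmul ℝ ℝ, volume] η)
      ((φ.normed volume ⋆[ContinuousLinearMap.lsmul ℝ ℝ, volume] (fderiv ℝ η)) x) x := by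
  have hρ : Integrable (φ.normed volume) := φ.integrable_normed
  have key := hasFDerivAt_integral_of_dominated_loc_of_lip (μ := (volume : Measure (Sp d)))
    (F := fun y t => φ.normed volume t • η (y - t))
    (F' := fun t => φ.normed volume t • fderiv ℝ η (x - t)) (x₀ := x) (s := univ)
    (bound := fun t => φ.normed volume t * K) univ_mem ?_ ?_ ?_ ?_ (hρ.mul_const _) ?_
  · exact key.2
  · refine Eventually.of_forall fun y => ?_
    have h1 : Continuous (φ.normed (volume : Measure (Sp d))) := φ.continuous_normed
    have h2 : Continuous fun t => η (y - t) := hη.continuous.comp (by fun_prop)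
    exact (h1.smul h2).aestronglyMeasurable
  · have h1 : Continuous (φ.normed (volume : Measure (Sp d))) := φ.continuous_normed
    have h2 : Continuous fun t => η (x - t) := hη.continuous.comp (by fun_prop)
    exact (h1.smul h2).integrable_of_hasCompactSupport (φ.hasCompactSupport_normed.smul_right)
  · have h1 : Continuous (φ.normed (volume : Measure (Sp d))) := φ.continuous_normed
    have h2 : Measurable fun t => fderiv ℝ η (x - t) :=
      (measurable_fderiv ℝ η).comp (by fun_prop)
    exact (h1.measurable.smul h2).aestronglyMeasurable
  · refine Eventually.of_forall fun t => ?_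
    rw [lipschitzOnWith_univ]
    refine LipschitzWith.of_dist_le_mul fun y z => ?_
    have h0 : 0 ≤ φ.normed (volume : Measure (Sp d)) t := φ.nonneg_normed t
    have h1 := hη.dist_le_mul (y - t) (z - t)
    rw [dist_sub_right] at h1
    rw [dist_smul₀]
    simp only [Real.norm_eq_abs, abs_of_nonneg h0, Real.coe_nnabs,
      abs_of_nonneg (mul_nonneg h0 K.coe_nonneg)]
    rw [mul_assoc]
    exact mul_le_mul_of_nonneg_left h1 h0
  · have h1 := hη.ae_differentiableAt (μ := (volume : Measure (Sp d)))
    have h2 := (Measure.measurePreserving_sub_left (volume : Measure (Sp d)) x).quasiMeasurePreserving.ae h1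
    filter_upwards [h2] with t ht
    have h3 : HasFDerivAt (fun y => η (y - t)) (fderiv ℝ η (x - t)) x := by
      have h4 := ht.hasFDerivAt.comp x ((hasFDerivAt_id x).sub_const t)
      simpa [Function.comp_def] using h4
    exact h3.const_smul (φ.normed volume t)

theorem norm_bump_convolution_le {F : Type*} [NormedAddCommGroup F] [NormedSpace ℝ F]
    (φ : ContDiffBump (0 : Sp d)) {η : Sp d → F} {M : ℝ} (hM : ∀ x, ‖η x‖ ≤ M) (x : Sp d) :
    ‖(φ.normed volume ⋆[ContinuousLinearMap.lsmul ℝ ℝ, volume] η) x‖ ≤ M := by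
  have h1 : ∀ t, ‖φ.normed (volume : Measure (Sp d)) t • η (x - t)‖
      ≤ φ.normed (volume : Measure (Sp d)) t * M := fun t => by
    rw [norm_smul, Real.norm_of_nonneg (φ.nonneg_normed t)]
    exact mul_le_mul_of_nonneg_left (hM _) (φ.nonneg_normed t)
  have h2 := norm_integral_le_of_norm_le (φ.integrable_normed.mul_const M)
    (Eventually.of_forall h1) (μ := (volume : Measure (Sp d)))
  rw [integral_mul_const, φ.integral_normed, one_mul] at h2
  exact h2

/-- The defining identity of a weak gradient holds for Lipschitz test functions. -/
theorem HasWeakGrad.integral_lipschitz {U : Set (Sp d)} (hU : IsOpen U) {u : Sp d → ℝ}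
    {g : Sp d → Sp d} (hu : MemLp u 2 (volume.restrict U)) (hg : MemLp g 2 (volume.restrict U))
    (h : HasWeakGrad U u g) {η : Sp d → ℝ} {K : ℝ≥0} (hη : LipschitzWith K η)
    (hc : HasCompactSupport η) (hs : tsupport η ⊆ U) (e : Sp d) :
    ∫ x in U, u x * fderiv ℝ η x e = - ∫ x in U, inner ℝ (g x) e * η x := by
  -- The bumps have radius at most δ, so every mollified test function is supported in one compact
  -- subset of U.
  obtain ⟨δ, hδ, hδU⟩ := IsCompact.exists_cthickening_subset_open hc hU hs
  set S := Metric.cthickening δ (tsupport η) with hS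
  have hSc : IsCompact S := IsCompact.cthickening hc
  obtain ⟨φ, hφδ, hφ0, hφK⟩ := exists_contDiffBump_seq (d := d) δ hδ
  set θ : ℕ → Sp d → ℝ := fun n =>
    (φ n).normed volume ⋆[ContinuousLinearMap.lsmul ℝ ℝ, volume] η with hθ
  have hsupp : ∀ n, Function.support (θ n) ⊆ S := by
    intro n x hx
    have h1 := support_convolution_subset (ContinuousLinearMap.lsmul ℝ ℝ)
      (μ := (volume : Measure (Sp d))) hx
    obtain ⟨a, ha, b, hb, rfl⟩ := h1
    rw [(φ n).support_normed_eq] at ha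
    apply Metric.mem_cthickening_of_dist_le _ b _ _ (subset_tsupport _ hb)
    rw [dist_eq_norm]; simp only [add_sub_cancel_right]
    have := mem_ball_zero_iff.1 ha
    linarith [hφδ n]
  have htsupp : ∀ n, tsupport (θ n) ⊆ S := fun n =>
    closure_minimal (hsupp n) Metric.isClosed_cthickening
  have hcs : ∀ n, HasCompactSupport (θ n) := fun n =>
    HasCompactSupport.intro hSc fun x hx => by
      by_contra h1; exact hx (hsupp n h1)
  have hsmooth : ∀ n, ContDiff ℝ ∞ (θ n) := fun n =>
    (φ n).hasCompactSupport_normed.contDiff_convolution_left _ (φ n).contDiff_normed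
      hη.continuous.locallyIntegrable
  have hfd : ∀ n x, fderiv ℝ (θ n) x =
      ((φ n).normed volume ⋆[ContinuousLinearMap.lsmul ℝ ℝ, volume] (fderiv ℝ η)) x :=
    fun n x => (hasFDerivAt_bump_convolution (φ n) hη x).fderiv
  have hfdb : ∀ n x, ‖fderiv ℝ (θ n) x‖ ≤ K := fun n x => by
    rw [hfd]; exact norm_bump_convolution_le _ (fun y => norm_fderiv_le_of_lipschitz ℝ hη) x
  obtain ⟨M, hM⟩ := hη.continuous.bounded_above_of_compact_support hc
  have hθb : ∀ n x, ‖θ n x‖ ≤ M := fun n x => norm_bump_convolution_le _ hM x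
  have eq : ∀ n, ∫ x in U, u x * fderiv ℝ (θ n) x e = - ∫ x in U, inner ℝ (g x) e * θ n x :=
    fun n => h (θ n) (hsmooth n) (hcs n) ((htsupp n).trans hδU) e
  have hind : ∀ c : ℝ, MemLp (S.indicator fun _ => c) 2 (volume.restrict U) := fun c =>
    memLp_indicator_const 2 hSc.measurableSet c (Or.inr (ne_of_lt
      (lt_of_le_of_lt (Measure.restrict_apply_le _ _) hSc.measure_lt_top)))
  have hge : MemLp (fun x => inner ℝ (g x) e) 2 (volume.restrict U) := hg.inner_const e
  have lim1 : Tendsto (fun n => ∫ x in U, u x * fderiv ℝ (θ n) x e) atTop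
      (𝓝 (∫ x in U, u x * fderiv ℝ η x e)) := by
    refine tendsto_integral_of_dominated_convergence
      (fun x => ‖u x‖ * (S.indicator (fun _ => K * ‖e‖)) x) ?_ ?_ ?_ ?_
    · intro n
      refine hu.1.mul ?_
      have := ((hsmooth n).continuous_fderiv (by simp))
      exact (this.clm_apply continuous_const).aestronglyMeasurable
    · exact hu.norm.integrable_mul (hind _)
    · intro n
      refine Eventually.of_forall fun x => ?_
      rw [norm_mul]
      refine mul_le_mul_of_nonneg_left ?_ (norm_nonneg _)
      by_cases hx : x ∈ S
      · rw [indicator_of_mem hx]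
        exact (ContinuousLinearMap.le_opNorm _ _).trans
          (mul_le_mul_of_nonneg_right (hfdb n x) (norm_nonneg _))
      · rw [indicator_of_notMem hx]
        have : fderiv ℝ (θ n) x = 0 := by
          by_contra h1
          exact hx (htsupp n (support_fderiv_subset ℝ h1))
        rw [this]; simp
    -- The gradient of η is only bounded and measurable, so its mollifications converge merely
    -- almost everywhere; the factor 2 is the ratio of the radii.
    · have h1 := ContDiffBump.ae_convolution_tendsto_right_of_locallyIntegrable
        (μ := (volume : Measure (Sp d))) (g := fderiv ℝ η) (φ := φ) (K := 2) hφ0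
        (Eventually.of_forall hφK) ?_
      · filter_upwards [ae_restrict_of_ae h1] with x hx
        refine Tendsto.const_mul _ ?_
        simp_rw [hfd]
        exact ((ContinuousLinearMap.apply ℝ ℝ e).continuous.tendsto _).comp hx
      · refine (locallyIntegrable_const (K : ℝ)).mono
          (measurable_fderiv ℝ η).aestronglyMeasurable (Eventually.of_forall fun x => ?_)
        rw [Real.norm_of_nonneg K.coe_nonneg]
        exact norm_fderiv_le_of_lipschitz ℝ hη
  have lim2 : Tendsto (fun n => - ∫ x in U, inner ℝ (g x) e * θ n x) atTop
      (𝓝 (- ∫ x in U, inner ℝ (g x) e * η x)) := by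
    refine (tendsto_integral_of_dominated_convergence
      (fun x => ‖inner ℝ (g x) e‖ * (S.indicator (fun _ => M)) x) ?_ ?_ ?_ ?_).neg
    · intro n
      exact hge.1.mul (hsmooth n).continuous.aestronglyMeasurable
    · exact hge.norm.integrable_mul (hind _)
    · intro n
      refine Eventually.of_forall fun x => ?_
      rw [norm_mul]
      refine mul_le_mul_of_nonneg_left ?_ (norm_nonneg _)
      by_cases hx : x ∈ S
      · rw [indicator_of_mem hx]; exact hθb n x
      · rw [indicator_of_notMem hx]
        have : θ n x = 0 := by
          by_contra h1; exact hx (hsupp n h1)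
        rw [this]; simp
    · refine Eventually.of_forall fun x => Tendsto.const_mul _ ?_
      exact ContDiffBump.convolution_tendsto_right_of_continuous hφ0 hη.continuous x
  simp_rw [eq] at lim1
  exact tendsto_nhds_unique lim1 lim2

end Mollification
end CEM

/-! ### Calculus of weak gradients -/

namespace CEM
open Filter Topology

section WeakGradients

variable {d : ℕ}

/-- `u` is in `H¹(U)` with weak gradient `g`. -/
structure IsGrad (U : Set (Sp d)) (u : Sp d → ℝ) (g : Sp d → Sp d) : Prop where
  memLp : MemLp u 2 (volume.restrict U)
  memLp_grad : MemLp g 2 (volume.restrict U)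
  weak : HasWeakGrad U u g

variable {U W : Set (Sp d)} {u v : Sp d → ℝ} {g h : Sp d → Sp d}

theorem IsGrad.memH1 (hu : IsGrad U u g) : MemH1 U u := ⟨hu.memLp, g, hu.memLp_grad, hu.weak⟩

theorem MemH1.isGrad (hu : MemH1 U u) : IsGrad U u (weakGrad U u) := by
  have h1 := hu.2
  refine ⟨hu.1, ?_, ?_⟩ <;> rw [weakGrad, dif_pos h1]
  · exact (Classical.choose_spec h1).1
  · exact (Classical.choose_spec h1).2

theorem integrable_mul_of_bounded {f p : Sp d → ℝ} (hf : MemLp f 2 (volume.restrict U))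
    (hp : Continuous p) (hc : HasCompactSupport p) :
    Integrable (fun x => f x * p x) (volume.restrict U) :=
  hf.integrable_mul (q := 2) (hp.memLp_of_hasCompactSupport hc)

theorem continuous_fderiv_apply_test {θ : Sp d → ℝ} (hθ : ContDiff ℝ ∞ θ) (e : Sp d) :
    Continuous fun x => fderiv ℝ θ x e :=
  (hθ.continuous_fderiv (by simp)).clm_apply continuous_const

theorem hasCompactSupport_fderiv_apply {θ : Sp d → ℝ} (hc : HasCompactSupport θ) (e : Sp d) :
    HasCompactSupport fun x => fderiv ℝ θ x e :=
  (hc.fderiv ℝ).comp_left (g := fun L : Sp d →L[ℝ] ℝ => L e) (by simp)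

theorem IsGrad.add (hu : IsGrad U u g) (hv : IsGrad U v h) : IsGrad U (u + v) (g + h) := by
  refine ⟨hu.memLp.add hv.memLp, hu.memLp_grad.add hv.memLp_grad, fun θ hθ hc hs e => ?_⟩
  have i1 := fun {f : Sp d → ℝ} (hf : MemLp f 2 (volume.restrict U)) =>
    integrable_mul_of_bounded hf (continuous_fderiv_apply_test hθ e)
      (hasCompactSupport_fderiv_apply hc e)
  have i2 := fun {f : Sp d → Sp d} (hf : MemLp f 2 (volume.restrict U)) =>
    integrable_mul_of_bounded (hf.inner_const (𝕜 := ℝ) e) hθ.continuous hc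
  simp only [Pi.add_apply, add_mul, inner_add_left]
  rw [integral_add (i1 hu.memLp) (i1 hv.memLp), integral_add (i2 hu.memLp_grad) (i2 hv.memLp_grad),
    hu.weak θ hθ hc hs e, hv.weak θ hθ hc hs e]
  ring

theorem IsGrad.smul (c : ℝ) (hu : IsGrad U u g) : IsGrad U (c • u) (c • g) := by
  refine ⟨hu.memLp.const_smul c, hu.memLp_grad.const_smul c, fun θ hθ hc hs e => ?_⟩
  simp only [Pi.smul_apply, smul_eq_mul, mul_assoc, inner_smul_left, RCLike.conj_to_real]
  rw [integral_const_mul, integral_const_mul, hu.weak θ hθ hc hs e]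
  ring

theorem isGrad_zero : IsGrad U (0 : Sp d → ℝ) 0 :=
  ⟨MemLp.zero, MemLp.zero, fun θ _ _ _ e => by simp⟩

theorem IsGrad.congr (hu : IsGrad U u g) (h1 : u =ᵐ[volume.restrict U] v)
    (h2 : g =ᵐ[volume.restrict U] h) : IsGrad U v h := by
  refine ⟨hu.memLp.ae_eq h1, hu.memLp_grad.ae_eq h2, fun θ hθ hc hs e => ?_⟩
  have e1 : ∫ x in U, v x * fderiv ℝ θ x e = ∫ x in U, u x * fderiv ℝ θ x e :=
    integral_congr_ae (by filter_upwards [h1] with x hx; rw [hx])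
  have e2 : ∫ x in U, inner ℝ (h x) e * θ x = ∫ x in U, inner ℝ (g x) e * θ x :=
    integral_congr_ae (by filter_upwards [h2] with x hx; rw [hx])
  rw [e1, e2, hu.weak θ hθ hc hs e]

theorem IsGrad.mono (hu : IsGrad W u g) (hUW : U ⊆ W) (hW : IsOpen W) : IsGrad U u g := by
  have hm : volume.restrict U ≤ volume.restrict W := Measure.restrict_mono_set _ hUW
  refine ⟨hu.memLp.mono_measure hm, hu.memLp_grad.mono_measure hm, fun θ hθ hc hs e => ?_⟩
  have := hu.weak θ hθ hc (hs.trans hUW) e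
  have z1 : ∀ x, x ∉ U → θ x = 0 := fun x hx => by
    by_contra h1; exact hx (hs (subset_tsupport _ h1))
  have z2 : ∀ x, x ∉ U → fderiv ℝ θ x = 0 := fun x hx => by
    by_contra h1; exact hx (hs (support_fderiv_subset ℝ h1))
  have e1 : ∫ x in W, u x * fderiv ℝ θ x e = ∫ x in U, u x * fderiv ℝ θ x e :=
    setIntegral_eq_of_subset_of_forall_sdiff_eq_zero hW.measurableSet hUW
      fun x hx => by rw [z2 x hx.2]; simp
  have e2 : ∫ x in W, inner ℝ (g x) e * θ x = ∫ x in U, inner ℝ (g x) e * θ x :=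
    setIntegral_eq_of_subset_of_forall_sdiff_eq_zero hW.measurableSet hUW
      fun x hx => by rw [z1 x hx.2]; simp
  rw [← e1, ← e2, this]

/-- The fundamental lemma of the calculus of variations, applied to each component of the
difference. -/
theorem IsGrad.unique (hU : IsOpen U) (hu : IsGrad U u g) (hv : IsGrad U u h) :
    g =ᵐ[volume.restrict U] h := by
  have key : ∀ e : Sp d, ∀ᵐ x ∂(volume.restrict U), inner ℝ (g x - h x) e = (0 : ℝ) := by
    intro e
    have hmem : MemLp (fun x => (inner ℝ (g x - h x) e : ℝ)) 2 (volume.restrict U) :=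
      (hu.memLp_grad.sub hv.memLp_grad).inner_const (𝕜 := ℝ) e
    rw [ae_restrict_iff' hU.measurableSet]
    refine hU.ae_eq_zero_of_integral_contDiff_smul_eq_zero ?_ ?_
    · exact locallyIntegrableOn_of_locallyIntegrable_restrict (hmem.locallyIntegrable (by norm_num))
    · intro θ hθ hc hs
      have h1 := hu.weak θ hθ hc hs e
      have h2 := hv.weak θ hθ hc hs e
      have i2 := fun {f : Sp d → Sp d} (hf : MemLp f 2 (volume.restrict U)) =>
        integrable_mul_of_bounded (hf.inner_const (𝕜 := ℝ) e) hθ.continuous hc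
      have z : ∀ x, x ∉ U → θ x • (inner ℝ (g x - h x) e : ℝ) = 0 := fun x hx => by
        have : θ x = 0 := by
          by_contra h1; exact hx (hs (subset_tsupport _ h1))
        rw [this, zero_smul]
      rw [← setIntegral_eq_integral_of_forall_compl_eq_zero z]
      simp only [smul_eq_mul, inner_sub_left, mul_sub]
      simp_rw [mul_comm (θ _)]
      rw [integral_sub (i2 hu.memLp_grad) (i2 hv.memLp_grad)]
      linarith
  have h2 : ∀ᵐ x ∂(volume.restrict U), ∀ i : Fin d,
      inner ℝ (g x - h x) (EuclideanSpace.single i (1 : ℝ)) = (0 : ℝ) :=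
    ae_all_iff.2 fun i => key _
  filter_upwards [h2] with x hx
  ext i
  have := hx i
  simp [EuclideanSpace.inner_single_right] at this
  linarith

theorem IsGrad.weakGrad_ae (hU : IsOpen U) (hu : IsGrad U u g) :
    weakGrad U u =ᵐ[volume.restrict U] g :=
  hu.memH1.isGrad.unique hU hu

theorem norm_gradient (f : Sp d → ℝ) (x : Sp d) : ‖gradient f x‖ = ‖fderiv ℝ f x‖ := by
  rw [gradient, LinearIsometryEquiv.norm_map]

theorem measurable_gradient (f : Sp d → ℝ) : Measurable (gradient f) :=
  (LinearIsometryEquiv.continuous _).measurable.comp (measurable_fderiv ℝ f)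

theorem LipschitzWith.mul_of_bounded {η θ : Sp d → ℝ} {K L : ℝ≥0} {M N : ℝ≥0}
    (hη : LipschitzWith K η) (hθ : LipschitzWith L θ) (hM : ∀ x, |η x| ≤ M)
    (hN : ∀ x, |θ x| ≤ N) : LipschitzWith (M * L + N * K) fun x => η x * θ x := by
  refine LipschitzWith.of_dist_le_mul fun x y => ?_
  have h1 := hη.dist_le_mul x y
  have h2 := hθ.dist_le_mul x y
  rw [Real.dist_eq] at *
  push_cast
  calc |η x * θ x - η y * θ y| = |η x * (θ x - θ y) + θ y * (η x - η y)| := by ring_nf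
    _ ≤ |η x| * |θ x - θ y| + |θ y| * |η x - η y| := by
        rw [← abs_mul, ← abs_mul]; exact abs_add_le _ _
    _ ≤ M * (L * dist x y) + N * (K * dist x y) := by gcongr <;> first | exact hM _ | exact hN _
    _ = _ := by ring

/-- The positive part of `η - δ`. -/
def posCut (η : Sp d → ℝ) (δ : ℝ) (x : Sp d) : ℝ := max (η x - δ) 0

theorem posCut_lipschitz {η : Sp d → ℝ} {K : ℝ≥0} (hη : LipschitzWith K η) (δ : ℝ) :
    LipschitzWith K (posCut η δ) := by
  refine LipschitzWith.of_dist_le_mul fun x y => ?_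
  have h1 := hη.dist_le_mul x y
  rw [Real.dist_eq] at *
  refine le_trans ?_ h1
  have := abs_max_sub_max_le_abs (η x - δ) (η y - δ) 0
  simpa [posCut] using this

theorem tendsto_posCut {η : Sp d → ℝ} (h0 : ∀ x, 0 ≤ η x) (x : Sp d) :
    Tendsto (fun n : ℕ => posCut η (1 / ((n : ℝ) + 1)) x) atTop (𝓝 (η x)) := by
  have h1 : Tendsto (fun n : ℕ => max (η x - 1 / ((n : ℝ) + 1)) 0) atTop (𝓝 (max (η x - 0) 0)) :=
    (tendsto_const_nhds.sub tendsto_one_div_add_atTop_nhds_zero_nat).max tendsto_const_nhds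
  simpa [posCut, h0 x] using h1

/-- No differentiability is needed. A zero of η is a minimum, so `fderiv` vanishes there, and each
truncation is zero nearby. At a positive value the truncation eventually differs from η by a
constant near the point, so the two `fderiv` agree. -/
theorem tendsto_fderiv_posCut {η : Sp d → ℝ} (hη : Continuous η) (h0 : ∀ x, 0 ≤ η x) (x : Sp d) :
    Tendsto (fun n : ℕ => fderiv ℝ (posCut η (1 / ((n : ℝ) + 1))) x) atTop
      (𝓝 (fderiv ℝ η x)) := by
  rcases (h0 x).eq_or_lt with hx | hx
  · have e1 : fderiv ℝ η x = 0 :=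
      IsLocalMin.fderiv_eq_zero (Eventually.of_forall fun y => by rw [← hx]; exact h0 y)
    rw [e1]
    refine tendsto_const_nhds.congr fun n => ?_
    have hn : (0 : ℝ) < 1 / ((n : ℝ) + 1) := by positivity
    have h2 : ∀ᶠ y in 𝓝 x, η y < 1 / ((n : ℝ) + 1) :=
      hη.continuousAt.eventually_lt continuousAt_const (by rwa [← hx])
    have h3 : posCut η (1 / ((n : ℝ) + 1)) =ᶠ[𝓝 x] fun _ => (0 : ℝ) := by
      filter_upwards [h2] with y hy
      exact max_eq_right (by linarith)
    rw [h3.fderiv_eq]; simp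
  · have h1 : ∀ᶠ n : ℕ in atTop, 1 / ((n : ℝ) + 1) < η x :=
      (tendsto_one_div_add_atTop_nhds_zero_nat (𝕜 := ℝ)).eventually_lt tendsto_const_nhds hx
    refine tendsto_const_nhds.congr' ?_
    filter_upwards [h1] with n hn
    have h2 : ∀ᶠ y in 𝓝 x, 1 / ((n : ℝ) + 1) < η y :=
      continuousAt_const.eventually_lt hη.continuousAt hn
    have h3 : posCut η (1 / ((n : ℝ) + 1)) =ᶠ[𝓝 x] fun y => η y - 1 / ((n : ℝ) + 1) := by
      filter_upwards [h2] with y hy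
      exact max_eq_left (by linarith)
    rw [h3.fderiv_eq, fderiv_sub_const]

/-- Multiplication of an `H¹(U)` function by a Lipschitz function which is small near the part of
the boundary of `U` in `W` gives, after extension by zero, a function in `H¹(W)`. -/
theorem IsGrad.mul_extend (hU : IsOpen U) (hUW : U ⊆ W) {η : Sp d → ℝ} {K M : ℝ≥0}
    (hη : LipschitzWith K η) (h0 : ∀ x, 0 ≤ η x) (hM : ∀ x, η x ≤ M)
    (hS : ∀ S, IsCompact S → S ⊆ W → ∀ δ > 0, ∀ x ∈ S, δ ≤ η x → x ∈ U) (hu : IsGrad U u g) :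
    IsGrad W (indicator U fun x => η x * u x)
      (indicator U fun x => η x • g x + u x • gradient η x) := by
  have hηm : AEStronglyMeasurable η (volume.restrict U) := hη.continuous.aestronglyMeasurable
  have hKb : ∀ x, ‖gradient η x‖ ≤ K := fun x => by
    rw [norm_gradient]; exact norm_fderiv_le_of_lipschitz ℝ hη
  have m1 : MemLp (fun x => η x * u x) 2 (volume.restrict U) := by
    refine MemLp.of_le_mul (c := M) hu.memLp (hηm.mul hu.memLp.1) (Eventually.of_forall fun x => ?_)
    rw [norm_mul, Real.norm_of_nonneg (h0 x)]
    exact mul_le_mul_of_nonneg_right (hM x) (norm_nonneg _)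
  have m2 : MemLp (fun x => η x • g x + u x • gradient η x) 2 (volume.restrict U) := by
    refine MemLp.add ?_ ?_
    · refine MemLp.of_le_mul (c := M) hu.memLp_grad (hηm.smul hu.memLp_grad.1)
        (Eventually.of_forall fun x => ?_)
      rw [norm_smul, Real.norm_of_nonneg (h0 x)]
      exact mul_le_mul_of_nonneg_right (hM x) (norm_nonneg _)
    · refine MemLp.of_le_mul (c := K) hu.memLp
        (hu.memLp.1.smul (measurable_gradient η).aestronglyMeasurable)
        (Eventually.of_forall fun x => ?_)
      rw [norm_smul, mul_comm]
      exact mul_le_mul_of_nonneg_right (hKb x) (norm_nonneg _)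
  have hres : (volume.restrict W).restrict U = volume.restrict U := by
    rw [Measure.restrict_restrict hU.measurableSet, inter_eq_left.2 hUW]
  refine ⟨?_, ?_, fun θ hθ hc hs e => ?_⟩
  · rw [memLp_indicator_iff_restrict hU.measurableSet, hres]; exact m1
  · rw [memLp_indicator_iff_restrict hU.measurableSet, hres]; exact m2
  obtain ⟨L, hL⟩ := hθ.lipschitzWith_of_hasCompactSupport hc (by simp)
  obtain ⟨N, hN⟩ := hθ.continuous.bounded_above_of_compact_support hc
  have hN0 : 0 ≤ N := (norm_nonneg _).trans (hN 0)
  -- The product of η and θ may reach the boundary of U and need not be admissible. Cutting η off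
  -- below 1/(n+1) moves the support into the set where η ≥ 1/(n+1), which lies in U over the
  -- compact support of θ by `hS`.
  set ζ : ℕ → Sp d → ℝ := fun n x => posCut η (1 / ((n : ℝ) + 1)) x * θ x with hζ
  have hpos : ∀ (n : ℕ), (0 : ℝ) < 1 / ((n : ℝ) + 1) := fun n => by positivity
  have hcut0 : ∀ (n : ℕ) x, 0 ≤ posCut η (1 / ((n : ℝ) + 1)) x := fun n x => le_max_right _ _
  have hcutM : ∀ (n : ℕ) x, posCut η (1 / ((n : ℝ) + 1)) x ≤ M := fun n x =>
    max_le (by linarith [hM x, hpos n]) M.coe_nonneg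
  have hζL : ∀ n, LipschitzWith (M * L + N.toNNReal * K) (ζ n) := fun n =>
    LipschitzWith.mul_of_bounded (posCut_lipschitz hη _) hL
      (fun x => by rw [abs_of_nonneg (hcut0 n x)]; exact hcutM n x)
      (fun x => by rw [Real.coe_toNNReal _ hN0]; exact hN x)
  have hζc : ∀ n, HasCompactSupport (ζ n) := fun n => hc.mul_left
  have hζs : ∀ n, tsupport (ζ n) ⊆ U := by
    intro n x hx
    have h1 : x ∈ tsupport θ := (closure_mono (Function.support_mul_subset_right _ _)) hx
    have h2 : x ∈ {y | 1 / ((n : ℝ) + 1) ≤ η y} := by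
      refine closure_minimal ?_ (isClosed_le continuous_const hη.continuous) hx
      intro y hy
      by_contra h3
      replace h3 : ¬ (1 / ((n : ℝ) + 1) ≤ η y) := h3
      rw [not_le] at h3
      refine hy ?_
      show posCut η _ y * θ y = 0
      rw [posCut, max_eq_right (by linarith), zero_mul]
    exact hS _ hc hs _ (hpos n) x h1 h2
  have eq : ∀ n, ∫ x in U, u x * fderiv ℝ (ζ n) x e = - ∫ x in U, inner ℝ (g x) e * ζ n x :=
    fun n => hu.weak.integral_lipschitz hU hu.memLp hu.memLp_grad (hζL n) (hζc n) (hζs n) e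
  have hθ' := continuous_fderiv_apply_test hθ e
  have hθc' := hasCompactSupport_fderiv_apply hc e
  have hbd : MemLp (fun x => M * ‖fderiv ℝ θ x e‖ + (K * ‖e‖) * ‖θ x‖) 2 (volume.restrict U) := by
    refine Continuous.memLp_of_hasCompactSupport (by fun_prop) ?_
    refine HasCompactSupport.add ?_ ?_
    · exact (hθc'.norm).mul_left
    · exact (hc.norm).mul_left
  have hfd : ∀ n, ∀ᵐ x ∂(volume.restrict U), fderiv ℝ (ζ n) x e =
      posCut η (1 / ((n : ℝ) + 1)) x * fderiv ℝ θ x e +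
        θ x * fderiv ℝ (posCut η (1 / ((n : ℝ) + 1))) x e := by
    intro n
    filter_upwards [ae_restrict_of_ae ((posCut_lipschitz hη (1 / ((n : ℝ) + 1))).ae_differentiableAt
      (μ := (volume : Measure (Sp d))))] with x hx
    rw [hζ]; simp only
    rw [fderiv_fun_mul hx (hθ.differentiable (by simp) x)]
    simp
  have lim1 : Tendsto (fun n => ∫ x in U, u x * fderiv ℝ (ζ n) x e) atTop
      (𝓝 (∫ x in U, u x * (η x * fderiv ℝ θ x e + θ x * fderiv ℝ η x e))) := by
    refine tendsto_integral_of_dominated_convergence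
      (fun x => ‖u x‖ * (M * ‖fderiv ℝ θ x e‖ + (K * ‖e‖) * ‖θ x‖)) ?_ ?_ ?_ ?_
    · intro n
      refine hu.memLp.1.mul ?_
      exact ((measurable_fderiv_apply_const ℝ (ζ n) e)).aestronglyMeasurable
    · exact hu.memLp.norm.integrable_mul hbd
    · intro n
      filter_upwards [hfd n] with x hx
      rw [norm_mul, hx]
      refine mul_le_mul_of_nonneg_left ((norm_add_le _ _).trans (add_le_add ?_ ?_)) (norm_nonneg _)
      · rw [norm_mul, Real.norm_of_nonneg (hcut0 n x)]
        exact mul_le_mul_of_nonneg_right (hcutM n x) (norm_nonneg _)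
      · rw [norm_mul, mul_comm]
        refine mul_le_mul_of_nonneg_right ?_ (norm_nonneg _)
        refine (ContinuousLinearMap.le_opNorm _ _).trans
          (mul_le_mul_of_nonneg_right ?_ (norm_nonneg _))
        exact norm_fderiv_le_of_lipschitz ℝ (posCut_lipschitz hη _)
    · have hall : ∀ᵐ x ∂(volume.restrict U), ∀ n, fderiv ℝ (ζ n) x e =
        posCut η (1 / ((n : ℝ) + 1)) x * fderiv ℝ θ x e +
        θ x * fderiv ℝ (posCut η (1 / ((n : ℝ) + 1))) x e := ae_all_iff.2 hfd
      filter_upwards [hall] with x hx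
      simp_rw [hx]
      refine (((tendsto_posCut h0 x).mul_const _).add (Tendsto.const_mul _ ?_)).const_mul _
      exact ((ContinuousLinearMap.apply ℝ ℝ e).continuous.tendsto _).comp
        (tendsto_fderiv_posCut hη.continuous h0 x)
  have hge : MemLp (fun x => inner ℝ (g x) e) 2 (volume.restrict U) := hu.memLp_grad.inner_const e
  have lim2 : Tendsto (fun n => - ∫ x in U, inner ℝ (g x) e * ζ n x) atTop
      (𝓝 (- ∫ x in U, inner ℝ (g x) e * (η x * θ x))) := by
    refine (tendsto_integral_of_dominated_convergence
      (fun x => ‖inner ℝ (g x) e‖ * (M * ‖θ x‖)) ?_ ?_ ?_ ?_).neg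
    · intro n
      exact hge.1.mul (hζL n).continuous.aestronglyMeasurable
    · refine hge.norm.integrable_mul (q := 2)
        (Continuous.memLp_of_hasCompactSupport (by have := hθ.continuous; fun_prop) ?_)
      exact (hc.norm).mul_left
    · intro n
      refine Eventually.of_forall fun x => ?_
      rw [norm_mul, hζ, norm_mul, Real.norm_of_nonneg (hcut0 n x)]
      refine mul_le_mul_of_nonneg_left ?_ (norm_nonneg _)
      exact mul_le_mul_of_nonneg_right (hcutM n x) (norm_nonneg _)
    · refine Eventually.of_forall fun x => Tendsto.const_mul _ ?_
      exact (tendsto_posCut h0 x).mul_const _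
  simp_rw [eq] at lim1
  have fin := tendsto_nhds_unique lim1 lim2
  have hηθ : Integrable (fun x => u x * (η x * fderiv ℝ θ x e)) (volume.restrict U) := by
    refine integrable_mul_of_bounded hu.memLp (hη.continuous.mul hθ') hθc'.mul_left
  have hθη : Integrable (fun x => u x * (θ x * fderiv ℝ η x e)) (volume.restrict U) := by
    have : Integrable (fun x => u x * θ x) (volume.restrict U) :=
      integrable_mul_of_bounded hu.memLp hθ.continuous hc
    simp_rw [← mul_assoc]
    refine this.mul_bdd (c := K * ‖e‖) (measurable_fderiv_apply_const ℝ η e).aestronglyMeasurable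
      (Eventually.of_forall fun x => ?_)
    refine (ContinuousLinearMap.le_opNorm _ _).trans
          (mul_le_mul_of_nonneg_right ?_ (norm_nonneg _))
    exact norm_fderiv_le_of_lipschitz ℝ hη
  have hgθ : Integrable (fun x => inner ℝ (g x) e * (η x * θ x)) (volume.restrict U) :=
    integrable_mul_of_bounded hge (hη.continuous.mul hθ.continuous) hc.mul_left
  simp_rw [mul_add] at fin
  rw [integral_add hηθ hθη] at fin
  have l1 : ∫ x in W, indicator U (fun x => η x * u x) x * fderiv ℝ θ x e =
      ∫ x in U, u x * (η x * fderiv ℝ θ x e) := by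
    have : (fun x => indicator U (fun x => η x * u x) x * fderiv ℝ θ x e) =
        indicator U fun x => u x * (η x * fderiv ℝ θ x e) := by
      ext x; by_cases hx : x ∈ U <;> simp [hx]; ring
    rw [this, integral_indicator hU.measurableSet, hres]
  have l2 : ∫ x in W, inner ℝ (indicator U (fun x => η x • g x + u x • gradient η x) x) e * θ x =
      ∫ x in U, (inner ℝ (g x) e * (η x * θ x) + u x * (θ x * fderiv ℝ η x e)) := by
    have : (fun x => inner ℝ (indicator U (fun x => η x • g x + u x • gradient η x) x) e * θ x) =
        indicator U fun x => inner ℝ (g x) e * (η x * θ x) + u x * (θ x * fderiv ℝ η x e) := by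
      ext x; by_cases hx : x ∈ U
      · simp [hx, inner_add_left, inner_smul_left]; ring
      · simp [hx]
    rw [this, integral_indicator hU.measurableSet, hres]
  rw [l1, l2, integral_add hgθ hθη]
  linarith

end WeakGradients
end CEM

/-! ### Abstract error analysis -/

namespace CEM

section Abstract

/-- Energy and mass forms on cells, together with coefficient functionals, cutoff operators and
local subspaces: the data on which the error analysis of the multiscale method rests. -/
structure CellForms (ι V : Type*) [Fintype ι] [AddCommGroup V] [Module ℝ V] (l : ι → ℕ) where
  /-- energy on a cell -/
  a : ι → LinearMap.BilinForm ℝ V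
  /-- squared weighted norm on a cell -/
  s : ι → V → ℝ
  /-- coefficients in the auxiliary space -/
  c : (q : ι) → Fin (l q) → V →ₗ[ℝ] ℝ
  lam : (q : ι) → Fin (l q) → ℝ
  gap : ι → ℝ
  layer : ι → ℕ → Set ι
  /-- multiplication by a function which vanishes on `layer i m`, and equals one off
  `layer i (m + 1)` -/
  Y : ι → ℕ → V →ₗ[ℝ] V
  V0 : ι → ℕ → Submodule ℝ V
  κ : ℝ
  κ_nonneg : 0 ≤ κ
  gap_pos : ∀ q, 0 < gap q
  a_symm : ∀ q u v, a q u v = a q v u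
  a_nonneg : ∀ q v, 0 ≤ a q v v
  bessel : ∀ q v, ∑ j, c q j v ^ 2 ≤ s q v
  spectral : ∀ q v, s q v ≤ ∑ j, c q j v ^ 2 + (gap q)⁻¹ * a q v v
  energy : ∀ q v, ∑ j, lam q j * c q j v ^ 2 ≤ a q v v
  self_mem : ∀ i m, i ∈ layer i m
  layer_mono : ∀ i m, layer i m ⊆ layer i (m + 1)
  Y_a_inside : ∀ i m v w, ∀ q ∈ layer i m, a q (Y i m v) w = 0
  Y_c_inside : ∀ i m v, ∀ q ∈ layer i m, ∀ j, c q j (Y i m v) = 0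
  Y_a_outside : ∀ i m v w, ∀ q, q ∉ layer i (m + 1) → a q (Y i m v) w = a q v w
  Y_c_outside : ∀ i m v, ∀ q, q ∉ layer i (m + 1) → ∀ j, c q j (Y i m v) = c q j v
  -- The 2 splits the square of η∇v + v∇η. The 4 is this 2 times the constant in |∇η|² ≤ 2κ̃, and
  -- the √2 in `Y_flux` is the square root of that constant.
  Y_a_le : ∀ i m v q, a q (Y i m v) (Y i m v) ≤ 2 * a q v v + 4 * s q v
  X_a_le : ∀ i m v q, a q (v - Y i m v) (v - Y i m v) ≤ 2 * a q v v + 4 * s q v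
  Y_s_le : ∀ i m v q, s q (Y i m v) ≤ s q v
  X_s_le : ∀ i m v q, s q (v - Y i m v) ≤ s q v
  Y_flux : ∀ i m v q, - (√2 * √(a q v v) * √(s q v)) ≤ a q v (Y i m v)
  X_mem : ∀ i m v, v - Y i m v ∈ V0 i (m + 1)
  V0_a : ∀ i m, ∀ v ∈ V0 i m, ∀ q, q ∉ layer i m → ∀ w, a q v w = 0
  V0_c : ∀ i m, ∀ v ∈ V0 i m, ∀ q, q ∉ layer i m → ∀ j, c q j v = 0
  -- The weight 1 + λ_j inside the sum, rather than its maximum in front, lets this energy be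
  -- absorbed through `energy` with a constant free of the eigenvalues.
  lift : ∀ q (x : Fin (l q) → ℝ), ∃ w : V, (∀ r, r ≠ q → ∀ v, a r w v = 0) ∧
    (∀ r, r ≠ q → ∀ j, c r j w = 0) ∧ (∀ j, c q j w = x j) ∧
    a q w w ≤ κ * ∑ j, (1 + lam q j) * x j ^ 2
  definite : ∀ v, ∑ q, a q v v = 0 → ∀ q j, c q j v = 0

namespace CellForms

variable {ι V : Type*} [Fintype ι] [AddCommGroup V] [Module ℝ V] {l : ι → ℕ}
  (F : CellForms ι V l)

/-- energy plus the squared norm of the auxiliary projection, on a cell -/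
def e (q : ι) : LinearMap.BilinForm ℝ V := F.a q + ∑ j, (F.c q j).smulRight (F.c q j)

theorem e_apply (q : ι) (u v : V) : F.e q u v = F.a q u v + ∑ j, F.c q j u * F.c q j v := by
  simp [e, LinearMap.sum_apply, LinearMap.add_apply]

theorem e_self (q : ι) (u : V) : F.e q u u = F.a q u u + ∑ j, F.c q j u ^ 2 := by
  simp [e_apply, sq]

theorem e_symm (q : ι) (u v : V) : F.e q u v = F.e q v u := by
  rw [e_apply, e_apply, F.a_symm q u v]
  congr 1
  exact Finset.sum_congr rfl fun j _ => mul_comm _ _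

theorem e_nonneg (q : ι) (u : V) : 0 ≤ F.e q u u := by
  rw [e_self]; exact add_nonneg (F.a_nonneg q u) (Finset.sum_nonneg fun j _ => sq_nonneg _)

theorem a_le_e (q : ι) (u : V) : F.a q u u ≤ F.e q u u := by
  rw [e_self]; linarith [Finset.sum_nonneg fun j (_ : j ∈ Finset.univ) => sq_nonneg (F.c q j u)]

/-- the inner product of the relaxed construction -/
def ip : LinearMap.BilinForm ℝ V := ∑ q, F.e q

theorem ip_apply (u v : V) : F.ip u v = ∑ q, F.e q u v := by
  simp [ip, LinearMap.sum_apply]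

theorem ip_symm (u v : V) : F.ip u v = F.ip v u := by
  simp only [ip_apply]
  exact Finset.sum_congr rfl fun q _ => F.e_symm q u v

theorem ip_nonneg (u : V) : 0 ≤ F.ip u u := by
  rw [ip_apply]; exact Finset.sum_nonneg fun q _ => F.e_nonneg q u

theorem e_le_ip (q : ι) (u : V) : F.e q u u ≤ F.ip u u := by
  rw [ip_apply]
  exact Finset.single_le_sum (f := fun q => F.e q u u) (fun q _ => F.e_nonneg q u)
    (Finset.mem_univ q)

theorem abs_le_sqrt_mul_sqrt {B : LinearMap.BilinForm ℝ V} (hB : ∀ u v, B u v = B v u)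
    (h0 : ∀ v, 0 ≤ B v v) (u v : V) : |B u v| ≤ √(B u u) * √(B v v) := by
  rw [← Real.sqrt_mul (h0 u)]
  exact Real.abs_le_sqrt (LinearMap.BilinForm.apply_sq_le_of_symm B h0 ⟨hB⟩ u v)

theorem a_sum_le_ip (u : V) : ∑ q, F.a q u u ≤ F.ip u u := by
  rw [ip_apply]; exact Finset.sum_le_sum fun q _ => F.a_le_e q u

theorem s_le (q : ι) {L : ℝ} (hL : (F.gap q)⁻¹ ≤ L) (u : V) :
    F.s q u ≤ (1 + L) * F.e q u u := by
  have h1 := F.spectral q u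
  have h2 : 0 ≤ ∑ j, F.c q j u ^ 2 := Finset.sum_nonneg fun j _ => sq_nonneg _
  have h3 := F.a_nonneg q u
  have h4 : (F.gap q)⁻¹ * F.a q u u ≤ L * F.a q u u := mul_le_mul_of_nonneg_right hL h3
  have h5 : 0 ≤ L := (inv_pos.2 (F.gap_pos q)).le.trans hL
  rw [e_self]; nlinarith

/-- The energy of w is at most 2a + 4s and its coefficients add at most s; with s ≤ (1 + L)e this
gives 7 = 2 + 5. -/
theorem cut_e_le (q : ι) {L : ℝ} (hL : (F.gap q)⁻¹ ≤ L) {u w : V}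
    (h1 : F.a q w w ≤ 2 * F.a q u u + 4 * F.s q u) (h2 : F.s q w ≤ F.s q u) :
    F.e q w w ≤ 7 * (1 + L) * F.e q u u := by
  have h3 := F.bessel q w
  have h4 := F.s_le q hL u
  have h5 := F.a_le_e q u
  have h6 := F.e_nonneg q u
  have h7 : 0 ≤ L := (inv_pos.2 (F.gap_pos q)).le.trans hL
  rw [F.e_self q w]; nlinarith

/-- This produces the factor 2(1 + Λ^{-1/2}) of the decay rate. The root of s costs 1 + L, and (√2√a
+ √p)² ≤ 3(a + p) is rounded up to 4(a + p). -/
theorem annulus_ineq {a p s L : ℝ} (ha : 0 ≤ a) (hp : 0 ≤ p) (hL : 0 ≤ L)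
    (hs : s ≤ p + L ^ 2 * a) : √2 * √a * √s + √p * √s ≤ 2 * (1 + L) * (a + p) := by
  have h1 : √s ≤ (1 + L) * √(a + p) := by
    apply Real.sqrt_le_iff.2 ⟨by positivity, ?_⟩
    rw [mul_pow, Real.sq_sqrt (by positivity)]
    nlinarith [mul_nonneg hL ha, mul_nonneg hL hp, mul_nonneg (mul_nonneg hL hL) hp]
  have h2 : √2 * √a + √p ≤ 2 * √(a + p) := by
    apply le_of_sq_le_sq _ (by positivity)
    rw [mul_pow, Real.sq_sqrt (by positivity)]
    have e1 := Real.sq_sqrt ha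
    have e2 := Real.sq_sqrt hp
    have e3 := Real.sq_sqrt (zero_le_two (α := ℝ))
    nlinarith [sq_nonneg (√a - √2 * √p)]
  calc √2 * √a * √s + √p * √s = (√2 * √a + √p) * √s := by ring
    _ ≤ (2 * √(a + p)) * ((1 + L) * √(a + p)) := by gcongr
    _ = 2 * (1 + L) * (√(a + p) * √(a + p)) := by ring
    _ = _ := by rw [Real.mul_self_sqrt (by positivity)]

/-! ### Decay away from a cell and localization of the basis functions. -/

open Classical in
/-- energy off the first `m` layers around a cell -/
def out (i : ι) (m : ℕ) (u : V) : ℝ := ∑ q, if q ∈ F.layer i m then 0 else F.e q u u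

theorem out_le_ip (i : ι) (m : ℕ) (u : V) : F.out i m u ≤ F.ip u u := by
  rw [ip_apply]
  refine Finset.sum_le_sum fun q _ => ?_
  split_ifs
  · exact F.e_nonneg q u
  · exact le_rfl

/-- Hole filling: u is orthogonal to Yu, since Yu has no coefficients on cell i. In this vanishing
product the inner cells contribute nothing, the cells off m + 1 layers their full energy, and those
in the annulus at least -2(1 + L) times theirs. Adding 2(1 + L) times the outer energy to both sides
fills the hole. -/
theorem out_succ_le {i : ι} {m : ℕ} {u : V} {L : ℝ} (hL0 : 0 ≤ L)
    (hL : ∀ q ∈ F.layer i (m + 1), (F.gap q)⁻¹ ≤ L ^ 2)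
    (hu : ∀ v, (∀ j, F.c i j v = 0) → F.ip u v = 0) :
    (1 + 2 * (1 + L)) * F.out i (m + 1) u ≤ 2 * (1 + L) * F.out i m u := by
  classical
  have h0 : F.ip u (F.Y i m u) = 0 := hu _ (F.Y_c_inside i m u i (F.self_mem i m))
  have key : ∀ q, (1 + 2 * (1 + L)) * (if q ∈ F.layer i (m + 1) then 0 else F.e q u u) -
      2 * (1 + L) * (if q ∈ F.layer i m then 0 else F.e q u u) ≤ F.e q u (F.Y i m u) := by
    intro q
    by_cases h1 : q ∈ F.layer i m
    · have h2 := F.layer_mono i m h1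
      have h3 : F.e q u (F.Y i m u) = 0 := by
        rw [e_apply, F.a_symm q]
        simp [F.Y_a_inside i m u u q h1, F.Y_c_inside i m u q h1]
      rw [h3]; simp [h1, h2]
    · by_cases h2 : q ∈ F.layer i (m + 1)
      · simp only [h1, h2, if_true, if_false]
        set p := ∑ j, F.c q j u ^ 2 with hp
        have hp0 : 0 ≤ p := Finset.sum_nonneg fun j _ => sq_nonneg _
        have h3 : F.s q u ≤ p + L ^ 2 * F.a q u u :=
          (F.spectral q u).trans (by
            have := mul_le_mul_of_nonneg_right (hL q h2) (F.a_nonneg q u); linarith)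
        have h4 := annulus_ineq (F.a_nonneg q u) hp0 hL0 h3
        have h5 := F.Y_flux i m u q
        have h6 : |∑ j, F.c q j u * F.c q j (F.Y i m u)| ≤ √p * √(F.s q u) := by
          have h7 := Finset.sum_mul_sq_le_sq_mul_sq Finset.univ (fun j => F.c q j u)
            (fun j => F.c q j (F.Y i m u))
          rw [← Real.sqrt_mul hp0]
          apply Real.abs_le_sqrt
          refine h7.trans (mul_le_mul_of_nonneg_left ?_ hp0)
          exact (F.bessel q _).trans (F.Y_s_le i m u q)
        have h8 := neg_abs_le (∑ j, F.c q j u * F.c q j (F.Y i m u))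
        rw [e_self, ← hp, e_apply]
        linarith
      · simp only [h1, h2, if_false]
        have h3 : F.e q u (F.Y i m u) = F.e q u u := by
          rw [e_apply, F.a_symm q]
          simp [F.Y_a_outside i m u u q h2, F.Y_c_outside i m u q h2, e_apply]
        rw [h3]; linarith
  have h1 := Finset.sum_le_sum fun q (_ : q ∈ Finset.univ) => key q
  rw [Finset.sum_sub_distrib, ← Finset.mul_sum, ← Finset.mul_sum, ← ip_apply, h0] at h1
  simp only [out]; linarith

theorem out_le_pow {i : ι} {n : ℕ} {u : V} {L : ℝ} (hL0 : 0 ≤ L)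
    (hL : ∀ q ∈ F.layer i n, (F.gap q)⁻¹ ≤ L ^ 2)
    (hu : ∀ v, (∀ j, F.c i j v = 0) → F.ip u v = 0) :
    F.out i n u ≤ ((1 + (2 * (1 + L))⁻¹)⁻¹) ^ n * F.ip u u := by
  induction n with
  | zero => simpa using F.out_le_ip i 0 u
  | succ n ih =>
    have h1 := ih fun q hq => hL q (F.layer_mono i n hq)
    have h2 := F.out_succ_le hL0 hL hu
    have h3 : (0 : ℝ) < 2 * (1 + L) := by positivity
    have h4 : (1 + (2 * (1 + L))⁻¹)⁻¹ = 2 * (1 + L) / (1 + 2 * (1 + L)) := by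
      field_simp; ring
    have h5 : F.out i (n + 1) u ≤ (1 + (2 * (1 + L))⁻¹)⁻¹ * F.out i n u := by
      rw [h4, div_mul_eq_mul_div, le_div_iff₀ (by positivity)]; linarith
    rw [pow_succ']
    calc _ ≤ _ := h5
      _ ≤ _ := by rw [mul_assoc]; exact mul_le_mul_of_nonneg_left h1 (by positivity)

/-- The localization error of a basis function. -/
theorem ip_sub_le {i : ι} {n : ℕ} {u z : V} {Lo : ℝ} 
    (hLo : ∀ q, q ∉ F.layer i n → (F.gap q)⁻¹ ≤ Lo)
    (hz : z ∈ F.V0 i (n + 1)) (huz : ∀ v ∈ F.V0 i (n + 1), F.ip (u - z) v = 0) :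
    F.ip (u - z) (u - z) ≤ 7 * (1 + Lo) * F.out i n u := by
  classical
  -- Best approximation: u - Yu is an admissible competitor in the local space, so the error of z is
  -- at most the norm of Yu, which lives off the first n layers.
  have h1 : F.ip (u - z) (u - z) = F.ip (u - z) (F.Y i n u) := by
    have h2 := huz ((u - F.Y i n u) - z) (Submodule.sub_mem _ (F.X_mem i n u) hz)
    have h3 : u - z = F.Y i n u + ((u - F.Y i n u) - z) := by abel
    calc F.ip (u - z) (u - z) = F.ip (u - z) (F.Y i n u + ((u - F.Y i n u) - z)) := by rw [← h3]
      _ = _ := by rw [map_add, h2, add_zero]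
  have h4 := (le_abs_self _).trans
    (abs_le_sqrt_mul_sqrt F.ip_symm F.ip_nonneg (u - z) (F.Y i n u))
  rw [← h1] at h4
  have h5 : F.ip (u - z) (u - z) ≤ F.ip (F.Y i n u) (F.Y i n u) := by
    have h6 := Real.mul_self_sqrt (F.ip_nonneg (u - z))
    have h7 := Real.mul_self_sqrt (F.ip_nonneg (F.Y i n u))
    rcases (Real.sqrt_nonneg (F.ip (u - z) (u - z))).eq_or_lt with h8 | h8
    · rw [← h6, ← h8]; simpa using F.ip_nonneg _
    · have h9 : √(F.ip (u - z) (u - z)) ≤ √(F.ip (F.Y i n u) (F.Y i n u)) := by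
        refine le_of_mul_le_mul_left ?_ h8
        rw [h6]; exact h4
      exact (Real.sqrt_le_sqrt_iff (F.ip_nonneg _)).1 h9
  refine h5.trans ?_
  rw [ip_apply, out, Finset.mul_sum]
  refine Finset.sum_le_sum fun q _ => ?_
  split_ifs with h6
  · rw [e_self, F.Y_a_inside i n u _ q h6]
    simp [F.Y_c_inside i n u q h6]
  · exact F.cut_e_le q (hLo q h6) (F.Y_a_le i n u q) (F.Y_s_le i n u q)

/-- Almost orthogonality of the localization errors. -/
theorem ip_sum_le {k : ι → ℕ} {u z : ι → V} {L : ℝ} {N : ℕ}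
    (hL : ∀ q, (F.gap q)⁻¹ ≤ L)
    (hN : ∀ q, {i | q ∈ F.layer i (k i + 1)}.ncard ≤ N)
    (hu : ∀ i v, (∀ j, F.c i j v = 0) → F.ip (u i) v = 0) (hz : ∀ i, z i ∈ F.V0 i (k i)) :
    F.ip (∑ i, (u i - z i)) (∑ i, (u i - z i)) ≤
      7 * (1 + L) * N * ∑ i, F.ip (u i - z i) (u i - z i) := by
  classical
  rcases isEmpty_or_nonempty ι with hι | hι
  · simp
  have hL0 : 0 ≤ L := by
    obtain ⟨q⟩ := hι
    exact (inv_pos.2 (F.gap_pos q)).le.trans (hL q)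
  set E := ∑ i, (u i - z i) with hE
  set X : ι → V := fun i => E - F.Y i (k i) E with hX
  -- The far part of E is invisible to u_i - z_i: u_i is orthogonal to it because it has no
  -- coefficients on cell i, and z_i because their supports are disjoint. Only X_i remains, which
  -- lives on k_i + 1 layers, and these overlap at most N times.
  have h1 : ∀ i, F.ip (u i - z i) E = F.ip (u i - z i) (X i) := by
    intro i
    have h2 : F.ip (u i) (F.Y i (k i) E) = 0 :=
      hu i _ (F.Y_c_inside i (k i) E i (F.self_mem i _))
    have h3 : F.ip (z i) (F.Y i (k i) E) = 0 := by
      rw [ip_apply]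
      refine Finset.sum_eq_zero fun q _ => ?_
      by_cases h4 : q ∈ F.layer i (k i)
      · rw [e_apply, F.a_symm q]
        simp [F.Y_a_inside i _ E _ q h4, F.Y_c_inside i _ E q h4]
      · rw [e_apply, F.V0_a i _ _ (hz i) q h4]
        simp [F.V0_c i _ _ (hz i) q h4]
    rw [hX]; simp only
    rw [map_sub (F.ip (u i - z i)), map_sub F.ip, LinearMap.sub_apply, LinearMap.sub_apply, h2, h3]
    simp
  have h2 : ∀ i, F.ip (X i) (X i) ≤ ∑ q, if q ∈ F.layer i (k i + 1) then
      7 * (1 + L) * F.e q E E else 0 := by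
    intro i
    rw [ip_apply]
    refine Finset.sum_le_sum fun q _ => ?_
    split_ifs with h3
    · exact F.cut_e_le q (hL q) (F.X_a_le i _ E q) (F.X_s_le i _ E q)
    · have h4 : ∀ w, F.a q (X i) w = 0 := fun w => by
        rw [hX]; simp only
        rw [map_sub, LinearMap.sub_apply, F.Y_a_outside i _ E w q h3, sub_self]
      have h5 : ∀ j, F.c q j (X i) = 0 := fun j => by
        rw [hX]; simp only
        rw [map_sub, F.Y_c_outside i _ E q h3, sub_self]
      rw [e_self, h4]; simp [h5]
  have h3 : ∑ i, F.ip (X i) (X i) ≤ 7 * (1 + L) * N * F.ip E E := by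
    calc ∑ i, F.ip (X i) (X i) ≤ ∑ i, ∑ q, (if q ∈ F.layer i (k i + 1) then
          7 * (1 + L) * F.e q E E else 0) := Finset.sum_le_sum fun i _ => h2 i
      _ = ∑ q, ∑ i, (if q ∈ F.layer i (k i + 1) then
          7 * (1 + L) * F.e q E E else 0) := Finset.sum_comm
      _ ≤ ∑ q, N * (7 * (1 + L) * F.e q E E) := by
          refine Finset.sum_le_sum fun q _ => ?_
          rw [← Finset.sum_filter, Finset.sum_const, nsmul_eq_mul]
          refine mul_le_mul_of_nonneg_right ?_
            (mul_nonneg (by positivity) (F.e_nonneg q E))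
          have := hN q
          rw [Set.ncard_eq_toFinset_card'] at this
          have h4 : (Finset.univ.filter fun i => q ∈ F.layer i (k i + 1)) =
            {i | q ∈ F.layer i (k i + 1)}.toFinset := by ext; simp
          rw [h4]; exact_mod_cast this
      _ = _ := by rw [← Finset.mul_sum, ← Finset.mul_sum, ← ip_apply]; ring
  have h4 : F.ip E E = ∑ i, F.ip (u i - z i) (X i) := by
    rw [← Finset.sum_congr rfl fun i _ => h1 i, ← LinearMap.sum_apply, ← map_sum]
  have h5 : F.ip E E ≤ ∑ i, √(F.ip (u i - z i) (u i - z i)) * √(F.ip (X i) (X i)) := by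
    rw [h4]
    exact Finset.sum_le_sum fun i _ => (le_abs_self _).trans
      (abs_le_sqrt_mul_sqrt F.ip_symm F.ip_nonneg _ _)
  set S := ∑ i, F.ip (u i - z i) (u i - z i) with hS
  have h6 : F.ip E E ^ 2 ≤ S * (7 * (1 + L) * N * F.ip E E) := by
    calc F.ip E E ^ 2 ≤ (∑ i, √(F.ip (u i - z i) (u i - z i)) * √(F.ip (X i) (X i))) ^ 2 :=
          pow_le_pow_left₀ (F.ip_nonneg E) h5 2
      _ ≤ (∑ i, √(F.ip (u i - z i) (u i - z i)) ^ 2) * ∑ i, √(F.ip (X i) (X i)) ^ 2 :=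
          Finset.sum_mul_sq_le_sq_mul_sq _ _ _
      _ = S * ∑ i, F.ip (X i) (X i) := by
          simp_rw [Real.sq_sqrt (F.ip_nonneg _)]; rfl
      _ ≤ _ := mul_le_mul_of_nonneg_left h3 (Finset.sum_nonneg fun i _ => F.ip_nonneg _)
  rcases (F.ip_nonneg E).eq_or_lt with h7 | h7
  · rw [← h7]
    have : 0 ≤ S := Finset.sum_nonneg fun i _ => F.ip_nonneg _
    positivity
  · nlinarith

/-- Stability of the decomposition of a global multiscale function into its cell contributions. -/
theorem ip_component_le {u : ι → V} {g : (i : ι) → Fin (l i) → ℝ}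
    (hu : ∀ i v, F.ip (u i) v = ∑ j, g i j * F.c i j v) (i : ι) :
    F.ip (u i) (u i) ≤ (F.κ + 1) * F.e i (∑ r, u r) (∑ r, u r) := by
  set x := ∑ r, u r with hx
  -- The function w has the coefficients of u_i on cell i and vanishes on the others. Testing the
  -- whole sum with it picks out ip(u_i, u_i) on the one side and an expression on cell i alone on
  -- the other.
  obtain ⟨w, hw1, hw2, hw3, hw4⟩ := F.lift i fun j => F.c i j (u i)
  have h1 : F.ip (u i) (u i) = F.e i x w := by
    have h2 : F.ip x w = ∑ j, g i j * F.c i j w := by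
      rw [hx, map_sum, LinearMap.sum_apply, Finset.sum_eq_single i]
      · exact hu i w
      · intro r _ hr; rw [hu r w]; simp [hw2 r hr]
      · simp
    have h3 : F.ip x w = F.e i x w := by
      rw [ip_apply, Finset.sum_eq_single i]
      · intro r _ hr
        rw [e_apply, F.a_symm r]
        simp [hw1 r hr, hw2 r hr]
      · simp
    rw [← h3, h2, hu i (u i)]
    simp [hw3]
  have h2 : F.e i w w ≤ (F.κ + 1) * F.ip (u i) (u i) := by
    have h3 := F.energy i (u i)
    have h4 := F.e_le_ip i (u i)
    have h5 : ∑ j, (1 + F.lam i j) * F.c i j (u i) ^ 2 =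
        ∑ j, F.c i j (u i) ^ 2 + ∑ j, F.lam i j * F.c i j (u i) ^ 2 := by
      rw [← Finset.sum_add_distrib]; exact Finset.sum_congr rfl fun j _ => by ring
    rw [h5] at hw4
    rw [e_self] at h4 ⊢
    simp only [hw3]
    have h6 := F.a_nonneg i (u i)
    have h7 := F.κ_nonneg
    nlinarith
  have h3 := F.e_nonneg i x
  have h4 := F.ip_nonneg (u i)
  have h5 := LinearMap.BilinForm.apply_sq_le_of_symm (F.e i) (F.e_nonneg i) ⟨F.e_symm i⟩ x w
  rw [← h1] at h5
  have h7 := F.κ_nonneg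
  rcases h4.eq_or_lt with h6 | h6
  · rw [← h6]; positivity
  · have : F.ip (u i) (u i) * F.ip (u i) (u i) ≤
        ((F.κ + 1) * F.e i x x) * F.ip (u i) (u i) := by nlinarith
    exact le_of_mul_le_mul_right this h6

/-- Functions with minimal energy are controlled by their auxiliary projection. -/
theorem a_le_of_orthogonal {x : V} {Γ : ℝ} (hΓ : ∀ q j, F.lam q j ≤ Γ)
    (hx : ∀ v, (∀ q j, F.c q j v = 0) → ∑ q, F.a q x v = 0) :
    ∑ q, F.a q x x ≤ F.κ * ((1 + Γ) * ∑ q, ∑ j, F.c q j x ^ 2) := by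
  -- Among functions with the same coefficients x has the least energy; the sum of the cellwise
  -- lifts is such a function and is bounded by `lift`.
  choose w hw1 hw2 hw3 hw4 using fun q => F.lift q fun j => F.c q j x
  set v := ∑ q, w q with hv
  have hcv : ∀ q j, F.c q j (x - v) = 0 := fun q j => by
    rw [map_sub, hv, map_sum, Finset.sum_eq_single q, hw3, sub_self]
    · intro r _ hr; exact hw2 r q hr.symm j
    · simp
  have hav : ∀ q u, F.a q v u = F.a q (w q) u := fun q u => by
    rw [hv, map_sum, LinearMap.sum_apply, Finset.sum_eq_single q]
    · intro r _ hr; exact hw1 r q hr.symm u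
    · simp
  have h1 : ∑ q, F.a q x x = ∑ q, F.a q x v := by
    have := hx _ hcv
    simp only [map_sub, Finset.sum_sub_distrib] at this
    linarith
  have h2 : ∑ q, F.a q x x ≤ ∑ q, F.a q v v := by
    have h3 : 0 ≤ ∑ q, F.a q (x - v) (x - v) := Finset.sum_nonneg fun q _ => F.a_nonneg q _
    have h4 : ∑ q, F.a q (x - v) (x - v) =
        ∑ q, F.a q x x - 2 * ∑ q, F.a q x v + ∑ q, F.a q v v := by
      rw [Finset.mul_sum, ← Finset.sum_sub_distrib, ← Finset.sum_add_distrib]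
      refine Finset.sum_congr rfl fun q _ => ?_
      have := F.a_symm q x v
      simp only [map_sub, LinearMap.sub_apply, this]
      ring
    linarith
  refine h2.trans ?_
  rw [Finset.mul_sum, Finset.mul_sum]
  refine Finset.sum_le_sum fun q _ => ?_
  rw [hav, F.a_symm q, hav]
  refine (hw4 q).trans (mul_le_mul_of_nonneg_left ?_ F.κ_nonneg)
  rw [Finset.mul_sum]
  refine Finset.sum_le_sum fun j _ => mul_le_mul_of_nonneg_right ?_ (sq_nonneg _)
  linarith [hΓ q j]

/-- A function which is orthogonal to the global multiscale space has zero auxiliary projection. -/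
theorem c_eq_zero_of_orthogonal {psi : (i : ι) → Fin (l i) → V}
    (hpsi : ∀ i j v, F.ip (psi i j) v = F.c i j v) {w : V}
    (hw : ∀ i j, ∑ q, F.a q (psi i j) w = 0) (q : ι) (j : Fin (l q)) : F.c q j w = 0 := by
  let J := Σ i, Fin (l i)
  let C : V →ₗ[ℝ] (J → ℝ) := LinearMap.pi fun t => F.c t.1 t.2
  let Ψ : (J → ℝ) →ₗ[ℝ] V := Fintype.linearCombination ℝ fun t : J => psi t.1 t.2
  have hΨ : ∀ g v, F.ip (Ψ g) v = ∑ t, g t * C v t := by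
    intro g v
    simp only [Ψ, C, Fintype.linearCombination_apply, map_sum, LinearMap.sum_apply, map_smul,
      LinearMap.smul_apply, hpsi, smul_eq_mul, LinearMap.pi_apply]
  have hip : ∀ u v, F.ip u v = ∑ q, F.a q u v + ∑ t, C u t * C v t := by
    intro u v
    rw [ip_apply]
    simp only [e_apply, Finset.sum_add_distrib, C, LinearMap.pi_apply]
    rw [Fintype.sum_sigma]
  -- Here ip(Ψg, v) = g · Cv, so a(Ψg, v) = Tg · Cv. If Tg = 0, then Ψg has zero energy, its
  -- coefficients vanish by `definite`, and g = CΨg = 0. Thus T is onto; choosing g with Tg = Cw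
  -- makes a(Ψg, w) = |Cw|², which is zero by hypothesis.
  let T : (J → ℝ) →ₗ[ℝ] (J → ℝ) := LinearMap.id - C ∘ₗ Ψ
  have hinj : Function.Injective T := by
    rw [injective_iff_map_eq_zero]
    intro g hg
    have h1 : g = C (Ψ g) := by
      have : g - C (Ψ g) = 0 := hg
      exact sub_eq_zero.1 this
    have h2 : ∑ q, F.a q (Ψ g) (Ψ g) = 0 := by
      have := hΨ g (Ψ g)
      rw [hip, ← h1] at this
      linarith
    have h3 := F.definite _ h2
    rw [h1]; ext t; exact h3 t.1 t.2
  obtain ⟨g, hg⟩ := (LinearMap.injective_iff_surjective.1 hinj) (C w)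
  have h1 : ∑ q, F.a q (Ψ g) w = ∑ t, C w t * C w t := by
    have h2 := hΨ g w
    rw [hip] at h2
    have h3 : ∀ t, C w t = g t - C (Ψ g) t := fun t => by rw [← hg]; rfl
    have h4 : ∑ t, C w t * C w t = ∑ t, g t * C w t - ∑ t, C (Ψ g) t * C w t := by
      rw [← Finset.sum_sub_distrib]
      refine Finset.sum_congr rfl fun t _ => ?_
      nth_rewrite 1 [h3 t]; ring
    linarith
  have h2 : ∑ q, F.a q (Ψ g) w = 0 := by
    simp only [Ψ, Fintype.linearCombination_apply, map_sum, LinearMap.sum_apply, map_smul,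
      LinearMap.smul_apply, smul_eq_mul]
    rw [Finset.sum_comm]
    refine Finset.sum_eq_zero fun t _ => ?_
    rw [← Finset.mul_sum, hw, mul_zero]
  rw [h2] at h1
  have h3 := (Finset.sum_eq_zero_iff_of_nonneg fun t _ => mul_self_nonneg (C w t)).1 h1.symm
    ⟨q, j⟩ (Finset.mem_univ _)
  exact mul_self_eq_zero.1 h3

/-- The error between a global multiscale function and its localized counterpart. -/
theorem localization_error {k : ι → ℕ} (hk : ∀ i, 1 ≤ k i) {psi psiMs : (i : ι) → Fin (l i) → V}
    (hpsi : ∀ i j v, F.ip (psi i j) v = F.c i j v)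
    (hmem : ∀ i j, psiMs i j ∈ F.V0 i (k i))
    (hpsiMs : ∀ i j, ∀ v ∈ F.V0 i (k i), F.ip (psiMs i j) v = F.c i j v)
    {L Γ E : ℝ} {N : ℕ} {Li Lo : ι → ℝ} (hL : ∀ q, (F.gap q)⁻¹ ≤ L)
    (hΓ0 : 0 ≤ Γ) (hΓ : ∀ q j, F.lam q j ≤ Γ) (hE : 0 ≤ E) (hLi0 : ∀ i, 0 ≤ Li i) (hLo0 : ∀ i, 0 ≤ Lo i)
    (hLi : ∀ i, ∀ q ∈ F.layer i (k i - 1), (F.gap q)⁻¹ ≤ Li i ^ 2)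
    (hLo : ∀ i, ∀ q, q ∉ F.layer i (k i - 1) → (F.gap q)⁻¹ ≤ Lo i)
    (hN : ∀ q, {i | q ∈ F.layer i (k i + 1)}.ncard ≤ N)
    (hEi : ∀ i, (1 + Lo i) * ((1 + (2 * (1 + Li i))⁻¹)⁻¹) ^ (k i - 1) ≤ E)
    (g : (i : ι) → Fin (l i) → ℝ) :
    let x := ∑ i, ∑ j, g i j • psi i j
    let y := ∑ i, ∑ j, g i j • psiMs i j
    ∑ q, F.a q (x - y) (x - y) ≤ 49 * (1 + L) * N * E * (F.κ + 1) *
      ((1 + F.κ * (1 + Γ)) * ∑ q, F.s q x) := by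
  intro x y
  rcases isEmpty_or_nonempty ι with hι | hι
  · simp
  have hL0 : 0 ≤ L := by
    obtain ⟨q⟩ := hι
    exact (inv_pos.2 (F.gap_pos q)).le.trans (hL q)
  set u : ι → V := fun i => ∑ j, g i j • psi i j with hu
  set z : ι → V := fun i => ∑ j, g i j • psiMs i j with hz
  have hux : x = ∑ i, u i := rfl
  have hip : ∀ i v, F.ip (u i) v = ∑ j, g i j * F.c i j v := fun i v => by
    simp only [hu, map_sum, LinearMap.sum_apply, map_smul, LinearMap.smul_apply, hpsi, smul_eq_mul]
  have hipz : ∀ i, ∀ v ∈ F.V0 i (k i), F.ip (z i) v = ∑ j, g i j * F.c i j v := fun i v hv => by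
    simp only [hz, map_sum, LinearMap.sum_apply, map_smul, LinearMap.smul_apply, smul_eq_mul]
    exact Finset.sum_congr rfl fun j _ => by rw [hpsiMs i j v hv]
  have hzm : ∀ i, z i ∈ F.V0 i (k i) := fun i =>
    Submodule.sum_mem _ fun j _ => Submodule.smul_mem _ _ (hmem i j)
  have hu0 : ∀ i v, (∀ j, F.c i j v = 0) → F.ip (u i) v = 0 := fun i v hv => by
    rw [hip]; simp [hv]
  have h1 : x - y = ∑ i, (u i - z i) := by rw [Finset.sum_sub_distrib]
  -- Best approximation off k_i - 1 layers, then decay over as many layers, then stability. The last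
  -- bound involves the energy of x on cell i only, so the sum over i costs no further factor.
  have hb : ∀ i, F.ip (u i - z i) (u i - z i) ≤
      7 * E * ((F.κ + 1) * F.e i x x) := by
    intro i
    have e1 : k i - 1 + 1 = k i := Nat.sub_add_cancel (hk i)
    have h2 := F.ip_sub_le (i := i) (n := k i - 1) (u := u i) (z := z i) (hLo i)
      (by rw [e1]; exact hzm i)
      (by rw [e1]; intro v hv
          rw [map_sub, LinearMap.sub_apply, hip, hipz i v hv, sub_self])
    have h3 := F.out_le_pow (hLi0 i) (hLi i) (hu0 i)
    have h4 := F.ip_component_le hip i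
    have h5 := F.ip_nonneg (u i)
    have h6 := hLo0 i
    calc _ ≤ _ := h2
      _ ≤ 7 * (1 + Lo i) * (((1 + (2 * (1 + Li i))⁻¹)⁻¹) ^ (k i - 1) * F.ip (u i) (u i)) := by
          gcongr
      _ = 7 * ((1 + Lo i) * ((1 + (2 * (1 + Li i))⁻¹)⁻¹) ^ (k i - 1)) * F.ip (u i) (u i) := by ring
      _ ≤ 7 * E * F.ip (u i) (u i) := by
          have := hEi i
          gcongr
      _ ≤ _ := by gcongr
  have hκ := F.κ_nonneg
  have hsum : ∑ i, F.ip (u i - z i) (u i - z i) ≤ 7 * E * ((F.κ + 1) * F.ip x x) := by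
    rw [F.ip_apply x x, Finset.mul_sum, Finset.mul_sum]
    exact Finset.sum_le_sum fun i _ => hb i
  -- x is orthogonal to every function without auxiliary coefficients, hence of minimal energy for
  -- its own coefficients. This is the only place where Γ enters.
  have hx : F.ip x x ≤ (1 + F.κ * (1 + Γ)) * ∑ q, F.s q x := by
    have h2 : ∑ q, ∑ j, F.c q j x ^ 2 ≤ ∑ q, F.s q x :=
      Finset.sum_le_sum fun q _ => F.bessel q x
    have hpx : ∀ v, (∀ q j, F.c q j v = 0) → F.ip x v = 0 := fun v hv => by
      rw [hux, map_sum, LinearMap.sum_apply]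
      exact Finset.sum_eq_zero fun i _ => hu0 i v (hv i)
    have h3 := F.a_le_of_orthogonal (x := x) hΓ fun v hv => by
      have := hpx v hv
      rw [ip_apply] at this
      simpa [e_apply, hv] using this
    have h4 : F.ip x x = ∑ q, F.a q x x + ∑ q, ∑ j, F.c q j x ^ 2 := by
      rw [ip_apply, ← Finset.sum_add_distrib]
      exact Finset.sum_congr rfl fun q _ => F.e_self q x
    have h5 : 0 ≤ ∑ q, ∑ j, F.c q j x ^ 2 :=
      Finset.sum_nonneg fun q _ => Finset.sum_nonneg fun j _ => sq_nonneg _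
    rw [h4]
    calc _ ≤ F.κ * ((1 + Γ) * ∑ q, ∑ j, F.c q j x ^ 2) + ∑ q, ∑ j, F.c q j x ^ 2 := by linarith
      _ = (1 + F.κ * (1 + Γ)) * ∑ q, ∑ j, F.c q j x ^ 2 := by ring
      _ ≤ _ := by gcongr
  calc _ ≤ _ := F.a_sum_le_ip (x - y)
    _ ≤ 7 * (1 + L) * N * ∑ i, F.ip (u i - z i) (u i - z i) := by
        rw [h1]; exact F.ip_sum_le hL hN hu0 hzm
    _ ≤ 7 * (1 + L) * N * (7 * E * ((F.κ + 1) * ((1 + F.κ * (1 + Γ)) * ∑ q, F.s q x))) := by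
        refine mul_le_mul_of_nonneg_left ?_ (by positivity)
        refine hsum.trans (mul_le_mul_of_nonneg_left ?_ (by positivity))
        exact mul_le_mul_of_nonneg_left hx (by positivity)
    _ = _ := by ring

end CellForms

end Abstract
end CEM

/-! ### A finite-dimensional system of commutator type -/

namespace CEM

section Multiplier

variable {ι : Type*} [Fintype ι]

theorem integral_exp_sum {α : ℝ} (hα : 0 < α) :
    IntegrableOn (fun t : ℝ => Real.exp (-α * t)) (Ioi 0) ∧
      ∫ t in Ioi (0 : ℝ), Real.exp (-α * t) = α⁻¹ := by
  refine ⟨integrableOn_exp_mul_Ioi (by linarith) 0, ?_⟩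
  rw [integral_exp_mul_Ioi (by linarith)]
  simp [neg_div_neg_eq]

/-- A bilinear form which is bounded by an energy norm and an `ℓ²` norm stays bounded, with a gain
of one order, when its matrix is multiplied by the Cauchy matrix of the square roots of the
eigenvalues. -/
theorem abs_cauchy_multiplier_le {α lam : ι → ℝ} (hα : ∀ a, 0 < α a)
    (hle : ∀ a, lam a ≤ α a ^ 2) {G : ι → ι → ℝ} {c : ℝ} (hc : 0 ≤ c)
    (hG : ∀ x y : ι → ℝ, |∑ a, ∑ b, G a b * x a * y b| ≤
      c * √(∑ a, lam a * x a ^ 2) * √(∑ b, y b ^ 2)) (μ : ι → ℝ) :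
    |∑ a, ∑ b, G a b * μ a * (α b * μ b) / (α a + α b)| ≤ c / 2 * ∑ a, α a * μ a ^ 2 := by
  have hαα : ∀ a b, 0 < α a + α b := fun a b => add_pos (hα a) (hα b)
  -- The Laplace representation 1/(α_a + α_b) = ∫ e^{-α_a t} e^{-α_b t} dt separates the two
  -- indices, so `hG` applies for each t. Integrating (α_a μ_a)² e^{-2α_a t} leaves α_a μ_a²/2,
  -- which is the gain of one order.
  have h1 : ∑ a, ∑ b, G a b * μ a * (α b * μ b) / (α a + α b) =
      ∫ t in Ioi (0 : ℝ), ∑ a, ∑ b, G a b * (μ a * Real.exp (-α a * t)) *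
        (α b * μ b * Real.exp (-α b * t)) := by
    have h2 : ∀ t, ∑ a, ∑ b, G a b * (μ a * Real.exp (-α a * t)) *
        (α b * μ b * Real.exp (-α b * t)) =
        ∑ a, ∑ b, G a b * μ a * (α b * μ b) * Real.exp (-(α a + α b) * t) := by
      intro t
      refine Finset.sum_congr rfl fun a _ => Finset.sum_congr rfl fun b _ => ?_
      rw [show -(α a + α b) * t = -α a * t + -α b * t by ring, Real.exp_add]; ring
    simp_rw [h2]
    rw [integral_finsetSum _ fun a _ => integrable_finsetSum _ fun b _ =>
      ((integral_exp_sum (hαα a b)).1.const_mul _)]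
    refine Finset.sum_congr rfl fun a _ => ?_
    rw [integral_finsetSum _ fun b _ => ((integral_exp_sum (hαα a b)).1.const_mul _)]
    refine Finset.sum_congr rfl fun b _ => ?_
    rw [integral_const_mul, (integral_exp_sum (hαα a b)).2, div_eq_mul_inv]
  have h3 : ∀ t, |∑ a, ∑ b, G a b * (μ a * Real.exp (-α a * t)) *
        (α b * μ b * Real.exp (-α b * t))| ≤
        ∑ a, c * (α a * μ a) ^ 2 * Real.exp (-(2 * α a) * t) := by
    intro t
    have e1 : ∑ a, c * (α a * μ a) ^ 2 * Real.exp (-(2 * α a) * t) =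
        c * ∑ a, (α a * μ a * Real.exp (-α a * t)) ^ 2 := by
      rw [Finset.mul_sum]
      refine Finset.sum_congr rfl fun a _ => ?_
      rw [mul_pow (α a * μ a), ← Real.exp_nat_mul]
      push_cast
      rw [show (2 : ℝ) * (-α a * t) = -(2 * α a) * t by ring]; ring
    rw [e1]
    refine (hG _ _).trans ?_
    have h4 : ∑ a, lam a * (μ a * Real.exp (-α a * t)) ^ 2 ≤
        ∑ a, (α a * μ a * Real.exp (-α a * t)) ^ 2 := by
      refine Finset.sum_le_sum fun a _ => ?_
      calc _ ≤ α a ^ 2 * (μ a * Real.exp (-α a * t)) ^ 2 :=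
            mul_le_mul_of_nonneg_right (hle a) (sq_nonneg _)
        _ = _ := by ring
    have h5 : 0 ≤ ∑ a, (α a * μ a * Real.exp (-α a * t)) ^ 2 :=
      Finset.sum_nonneg fun a _ => sq_nonneg _
    calc _ ≤ c * √(∑ a, (α a * μ a * Real.exp (-α a * t)) ^ 2) *
          √(∑ a, (α a * μ a * Real.exp (-α a * t)) ^ 2) := by gcongr
      _ = _ := by rw [mul_assoc, Real.mul_self_sqrt h5]
  have h2α : ∀ a, 0 < 2 * α a := fun a => by linarith [hα a]
  rw [h1, ← Real.norm_eq_abs]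
  refine (norm_integral_le_of_norm_le (integrable_finsetSum _ fun a _ =>
    ((integral_exp_sum (h2α a)).1.const_mul _)) (Filter.Eventually.of_forall h3)).trans ?_
  rw [integral_finsetSum _ fun a _ => ((integral_exp_sum (h2α a)).1.const_mul _), Finset.mul_sum]
  refine Finset.sum_le_sum fun a _ => ?_
  rw [integral_const_mul, (integral_exp_sum (h2α a)).2]
  have := (hα a).ne'
  apply le_of_eq; field_simp

/-- Let `T` be a coercive symmetric matrix whose commutator with the diagonal matrix of
eigenvalues is of first order. Then the inverse of `T` is bounded in the energy norm. -/
theorem exists_solution_energy_le {lam : ι → ℝ} (hlam : ∀ a, 0 ≤ lam a) {T G : ι → ι → ℝ}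
    {c κ : ℝ} (hc : 0 ≤ c) (hκ : 0 < κ)
    (hT : ∀ y : ι → ℝ, ∑ a, y a ^ 2 ≤ κ * ∑ a, ∑ b, T a b * y a * y b)
    (hcomm : ∀ a b, (lam a - lam b) * T a b = G a b - G b a)
    (hG : ∀ x y : ι → ℝ, |∑ a, ∑ b, G a b * x a * y b| ≤
      c * √(∑ a, lam a * x a ^ 2) * √(∑ b, y b ^ 2)) (x : ι → ℝ) :
    ∃ μ : ι → ℝ, (∀ a, ∑ b, T a b * μ b = x a) ∧
      ∑ a, (1 + lam a) * μ a ^ 2 ≤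
        (κ * (1 + 2 * c * κ)) ^ 2 * ∑ a, (1 + lam a) * x a ^ 2 := by
  let M : (ι → ℝ) →ₗ[ℝ] (ι → ℝ) := Matrix.mulVecLin (Matrix.of T)
  have hM : ∀ y a, M y a = ∑ b, T a b * y b := fun y a => rfl
  have hinj : Function.Injective M := by
    rw [injective_iff_map_eq_zero]
    intro y hy
    have h1 : ∑ a, ∑ b, T a b * y a * y b = 0 := by
      refine Finset.sum_eq_zero fun a _ => ?_
      have : ∑ b, T a b * y a * y b = y a * M y a := by
        rw [hM, Finset.mul_sum]; exact Finset.sum_congr rfl fun b _ => by ring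
      rw [this, hy]; simp
    have h2 := hT y
    rw [h1, mul_zero] at h2
    have h3 := (Finset.sum_eq_zero_iff_of_nonneg fun a _ => sq_nonneg (y a)).1
      (le_antisymm h2 (Finset.sum_nonneg fun a _ => sq_nonneg _))
    ext a; exact pow_eq_zero_iff (two_ne_zero) |>.1 (h3 a (Finset.mem_univ a))
  obtain ⟨μ, hμ⟩ := (LinearMap.injective_iff_surjective.1 hinj) x
  have hx : ∀ a, ∑ b, T a b * μ b = x a := fun a => by rw [← hM, hμ]
  refine ⟨μ, hx, ?_⟩
  set α : ι → ℝ := fun a => √(1 + lam a) with hαdef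
  have hα2 : ∀ a, α a ^ 2 = 1 + lam a := fun a => Real.sq_sqrt (by linarith [hlam a])
  have hα1 : ∀ a, 1 ≤ α a := fun a => Real.one_le_sqrt.2 (by linarith [hlam a])
  have hα0 : ∀ a, 0 < α a := fun a => by linarith [hα1 a]
  set Nμ := ∑ a, μ a ^ 2 with hNμ
  set Nx := ∑ a, x a ^ 2 with hNx
  set Eμ := ∑ a, (1 + lam a) * μ a ^ 2 with hEμ
  set Ex := ∑ a, (1 + lam a) * x a ^ 2 with hEx
  have pNμ : 0 ≤ Nμ := Finset.sum_nonneg fun a _ => sq_nonneg _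
  have pNx : 0 ≤ Nx := Finset.sum_nonneg fun a _ => sq_nonneg _
  have hNE : Nx ≤ Ex := Finset.sum_le_sum fun a _ => by nlinarith [hlam a, sq_nonneg (x a)]
  have hNEμ : Nμ ≤ Eμ := Finset.sum_le_sum fun a _ => by nlinarith [hlam a, sq_nonneg (μ a)]
  have pEx := pNx.trans hNE
  have pEμ := pNμ.trans hNEμ
  have cs : ∀ (p q : ι → ℝ), ∑ a, p a * q a ≤ √(∑ a, p a ^ 2) * √(∑ a, q a ^ 2) := fun p q =>
    Real.sum_mul_le_sqrt_mul_sqrt _ _ _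
  have b1 : √Nμ ≤ κ * √Nx := by
    have h1 := hT μ
    have h2 : ∑ a, ∑ b, T a b * μ a * μ b = ∑ a, x a * μ a := by
      refine Finset.sum_congr rfl fun a _ => ?_
      rw [← hx a, Finset.sum_mul]; exact Finset.sum_congr rfl fun b _ => by ring
    rw [h2] at h1
    have h3 : Nμ ≤ κ * (√Nx * √Nμ) := h1.trans (mul_le_mul_of_nonneg_left (cs x μ) hκ.le)
    rcases (Real.sqrt_nonneg Nμ).eq_or_lt with h4 | h4
    · rw [← h4]; positivity
    · refine le_of_mul_le_mul_right ?_ h4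
      rw [Real.mul_self_sqrt pNμ]; linarith
  -- Coercivity is to be used for αμ with α = √(1 + λ). Writing α_aα_b = α_a² - α_a(α_a - α_b) gives
  -- the right-hand side x plus the commutator of T with α, whose entries are (G_ab - G_ba)/(α_a +
  -- α_b). Splitting α_a/(α_a + α_b) = 1 - α_b/(α_a + α_b) and exchanging the indices in the
  -- remaining term leaves G itself and twice its Cauchy multiplier.
  have b2 : ∑ a, ∑ b, T a b * (α a * μ a) * (α b * μ b) =
      ∑ a, (α a * x a) * (α a * μ a) - ∑ a, ∑ b, G a b * μ a * μ b +
        2 * ∑ a, ∑ b, G a b * μ a * (α b * μ b) / (α a + α b) := by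
    have h1 : ∑ a, (α a * x a) * (α a * μ a) = ∑ a, ∑ b, T a b * μ b * α a ^ 2 * μ a := by
      refine Finset.sum_congr rfl fun a _ => ?_
      rw [← hx a, Finset.mul_sum, Finset.sum_mul]
      exact Finset.sum_congr rfl fun b _ => by ring
    have h2 : ∑ a, ∑ b, G a b * μ a * (α b * μ b) / (α a + α b) =
        ∑ a, ∑ b, G b a * μ b * (α a * μ a) / (α b + α a) := Finset.sum_comm
    rw [two_mul]
    nth_rewrite 1 [h2]
    rw [h1, ← Finset.sum_sub_distrib, ← Finset.sum_add_distrib, ← Finset.sum_add_distrib]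
    refine Finset.sum_congr rfl fun a _ => ?_
    rw [← Finset.sum_sub_distrib, ← Finset.sum_add_distrib, ← Finset.sum_add_distrib]
    refine Finset.sum_congr rfl fun b _ => ?_
    have h3 := hcomm a b
    have h4 : lam a - lam b = (α a - α b) * (α a + α b) := by
      have := hα2 a; have := hα2 b; nlinarith
    have h5 : 0 < α a + α b := add_pos (hα0 a) (hα0 b)
    rw [h4] at h3
    have h6 : G b a = G a b - (α a - α b) * (α a + α b) * T a b := by linarith
    rw [h6, add_comm (α b) (α a)]
    field_simp
    ring
  have b3 := hT fun a => α a * μ a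
  have e1 : ∑ a, (α a * μ a) ^ 2 = Eμ :=
    Finset.sum_congr rfl fun a _ => by rw [mul_pow, hα2]
  have e2 : ∑ a, (α a * x a) ^ 2 = Ex :=
    Finset.sum_congr rfl fun a _ => by rw [mul_pow, hα2]
  have b4 := cs (fun a => α a * x a) fun a => α a * μ a
  rw [e1, e2] at b4
  have b5 := hG μ μ
  have b6 : √(∑ a, lam a * μ a ^ 2) ≤ √Eμ :=
    Real.sqrt_le_sqrt (Finset.sum_le_sum fun a _ => by nlinarith [sq_nonneg (μ a)])
  have b7 := abs_cauchy_multiplier_le hα0 (fun a => by rw [hα2]; linarith) hc hG μ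
  have b8 : ∑ a, α a * μ a ^ 2 ≤ √Eμ * √Nμ := by
    have := cs (fun a => α a * μ a) μ
    rw [e1] at this
    refine le_trans (le_of_eq ?_) this
    exact Finset.sum_congr rfl fun a _ => by ring
  rw [e1, b2] at b3
  have b9 : Eμ ≤ κ * (√Ex * √Eμ + 2 * c * (√Eμ * √Nμ)) := by
    refine b3.trans (mul_le_mul_of_nonneg_left ?_ hκ.le)
    have h1 := neg_abs_le (∑ a, ∑ b, G a b * μ a * μ b)
    have h2 := le_abs_self (∑ a, ∑ b, G a b * μ a * (α b * μ b) / (α a + α b))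
    have h3 : c * √(∑ a, lam a * μ a ^ 2) * √Nμ ≤ c * √Eμ * √Nμ := by gcongr
    have h4 : c / 2 * ∑ a, α a * μ a ^ 2 ≤ c / 2 * (√Eμ * √Nμ) := by gcongr
    linarith
  have b10 : √Nx ≤ √Ex := Real.sqrt_le_sqrt hNE
  have b11 : √Eμ ≤ κ * (1 + 2 * c * κ) * √Ex := by
    rcases (Real.sqrt_nonneg Eμ).eq_or_lt with h4 | h4
    · rw [← h4]; positivity
    · refine le_of_mul_le_mul_right ?_ h4
      rw [Real.mul_self_sqrt pEμ]
      refine b9.trans ?_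
      have h5 : √Nμ ≤ κ * √Ex := b1.trans (by gcongr)
      calc _ ≤ κ * (√Ex * √Eμ + 2 * c * (√Eμ * (κ * √Ex))) := by gcongr
        _ = _ := by ring
  calc Eμ = √Eμ ^ 2 := (Real.sq_sqrt pEμ).symm
    _ ≤ (κ * (1 + 2 * c * κ) * √Ex) ^ 2 := pow_le_pow_left₀ (Real.sqrt_nonneg _) b11 2
    _ = _ := by rw [mul_pow, Real.sq_sqrt pEx]

end Multiplier
end CEM

/-! ### Forms and cutoff functions on the coarse mesh -/

namespace CEM
open Filter Topology

section Forms

variable {d : ℕ} {U : Set (Sp d)} {u v w : Sp d → ℝ} {g h : Sp d → Sp d}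

theorem abs_integral_mul_le {α : Type*} [MeasurableSpace α] {μ : Measure α} {f h : α → ℝ}
    (hf : MemLp f 2 μ) (hh : MemLp h 2 μ) :
    ∫ x, |f x| * |h x| ∂μ ≤ √(∫ x, f x ^ 2 ∂μ) * √(∫ x, h x ^ 2 ∂μ) := by
  have h1 := integral_mul_le_Lp_mul_Lq_of_nonneg (μ := μ) (f := fun x => |f x|)
    (g := fun x => |h x|) Real.HolderConjugate.two_two (Eventually.of_forall fun x => abs_nonneg _)
    (Eventually.of_forall fun x => abs_nonneg _) (by simpa using hf.norm) (by simpa using hh.norm)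
  simpa [Real.sqrt_eq_rpow] using h1

theorem aForm_eq (hU : IsOpen U) (hu : IsGrad U u g) (hv : IsGrad U v h) :
    aForm U u v = ∫ x in U, inner ℝ (g x) (h x) := by
  refine integral_congr_ae ?_
  filter_upwards [hu.weakGrad_ae hU, hv.weakGrad_ae hU] with x h1 h2
  rw [h1, h2]

theorem integrable_inner_grad (hg : MemLp g 2 (volume.restrict U))
    (hh : MemLp h 2 (volume.restrict U)) :
    Integrable (fun x => (inner ℝ (g x) (h x) : ℝ)) (volume.restrict U) := by
  refine Integrable.mono' (hg.norm.integrable_mul hh.norm) (hg.1.inner hh.1)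
    (Eventually.of_forall fun x => ?_)
  exact norm_inner_le_norm _ _

theorem aForm_symm (U : Set (Sp d)) (u v : Sp d → ℝ) : aForm U u v = aForm U v u := by
  unfold aForm; simp_rw [real_inner_comm]

theorem aForm_self_nonneg (U : Set (Sp d)) (u : Sp d → ℝ) : 0 ≤ aForm U u u :=
  integral_nonneg fun _ => real_inner_self_nonneg

theorem MemH1.add (hu : MemH1 U u) (hv : MemH1 U v) : MemH1 U (u + v) :=
  (hu.isGrad.add hv.isGrad).memH1

theorem MemH1.smul (c : ℝ) (hu : MemH1 U u) : MemH1 U (c • u) := (hu.isGrad.smul c).memH1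

theorem memH1_zero : MemH1 U (0 : Sp d → ℝ) := isGrad_zero.memH1

theorem memH1_sum {ι : Type*} (s : Finset ι) {f : ι → Sp d → ℝ} (hf : ∀ i ∈ s, MemH1 U (f i)) :
    MemH1 U (∑ i ∈ s, f i) := by
  classical
  induction s using Finset.induction_on with
  | empty => simpa using memH1_zero
  | insert a s ha ih =>
    rw [Finset.sum_insert ha]
    exact (hf a (Finset.mem_insert_self _ _)).add
      (ih fun i hi => hf i (Finset.mem_insert_of_mem hi))

theorem aForm_add_left (hU : IsOpen U) (hu : MemH1 U u) (hv : MemH1 U v) (hw : MemH1 U w) :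
    aForm U (u + v) w = aForm U u w + aForm U v w := by
  rw [aForm_eq hU (hu.isGrad.add hv.isGrad) hw.isGrad]
  simp only [Pi.add_apply, inner_add_left]
  exact integral_add (integrable_inner_grad hu.isGrad.memLp_grad hw.isGrad.memLp_grad)
    (integrable_inner_grad hv.isGrad.memLp_grad hw.isGrad.memLp_grad)

theorem aForm_smul_left (hU : IsOpen U) (c : ℝ) (hu : MemH1 U u) (hw : MemH1 U w) :
    aForm U (c • u) w = c * aForm U u w := by
  rw [aForm_eq hU (hu.isGrad.smul c) hw.isGrad]
  simp only [Pi.smul_apply, real_inner_smul_left]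
  exact integral_const_mul _ _

theorem aForm_add_right (hU : IsOpen U) (hu : MemH1 U u) (hv : MemH1 U v) (hw : MemH1 U w) :
    aForm U w (u + v) = aForm U w u + aForm U w v := by
  simp only [aForm_symm U w]; exact aForm_add_left hU hu hv hw

theorem aForm_smul_right (hU : IsOpen U) (c : ℝ) (hu : MemH1 U u) (hw : MemH1 U w) :
    aForm U w (c • u) = c * aForm U w u := by
  simp only [aForm_symm U w]; exact aForm_smul_left hU c hu hw

theorem aForm_zero_left (hU : IsOpen U) (hw : MemH1 U w) : aForm U 0 w = 0 := by
  rw [aForm_eq hU isGrad_zero hw.isGrad]; simp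

theorem aForm_sum_left {ι : Type*} (hU : IsOpen U) (s : Finset ι) {f : ι → Sp d → ℝ}
    (hf : ∀ i ∈ s, MemH1 U (f i)) (hw : MemH1 U w) :
    aForm U (∑ i ∈ s, f i) w = ∑ i ∈ s, aForm U (f i) w := by
  classical
  induction s using Finset.induction_on with
  | empty => simpa using aForm_zero_left hU hw
  | insert a s ha ih =>
    have h1 := hf a (Finset.mem_insert_self _ _)
    have h2 := fun i (hi : i ∈ s) => hf i (Finset.mem_insert_of_mem hi)
    rw [Finset.sum_insert ha, Finset.sum_insert ha, aForm_add_left hU h1 (memH1_sum s h2) hw, ih h2]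

/-- The energy form only sees the functions up to null sets. -/
theorem aForm_congr (hU : IsOpen U) (hu : MemH1 U u) (huv : u =ᵐ[volume.restrict U] v)
    (hw : MemH1 U w) : aForm U u w = aForm U v w := by
  rw [aForm_eq hU hu.isGrad hw.isGrad,
    aForm_eq hU (hu.isGrad.congr huv (EventuallyEq.refl _ _)) hw.isGrad]

variable {ρ : Sp d → ℝ} {M : ℝ}

theorem memLp_sqrt_mul (hρm : Measurable ρ) (hρM : ∀ x, ρ x ≤ M)
    (hu : MemLp u 2 (volume.restrict U)) :
    MemLp (fun x => √(ρ x) * u x) 2 (volume.restrict U) := by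
  refine MemLp.of_le_mul (c := √M) hu (hρm.sqrt.aestronglyMeasurable.mul hu.1)
    (Eventually.of_forall fun x => ?_)
  rw [norm_mul, Real.norm_of_nonneg (Real.sqrt_nonneg _)]
  exact mul_le_mul_of_nonneg_right (Real.sqrt_le_sqrt (hρM x)) (norm_nonneg _)

theorem integrable_weighted (hρm : Measurable ρ) (hρ0 : ∀ x, 0 ≤ ρ x) (hρM : ∀ x, ρ x ≤ M)
    (hu : MemLp u 2 (volume.restrict U)) (hv : MemLp v 2 (volume.restrict U)) :
    Integrable (fun x => ρ x * u x * v x) (volume.restrict U) := by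
  have := (memLp_sqrt_mul hρm hρM hu).integrable_mul (memLp_sqrt_mul hρm hρM hv)
  refine this.congr (Eventually.of_forall fun x => ?_)
  show √(ρ x) * u x * (√(ρ x) * v x) = _
  have := Real.mul_self_sqrt (hρ0 x)
  linear_combination (u x * v x) * this

theorem wForm_symm (ρ : Sp d → ℝ) (U : Set (Sp d)) (u v : Sp d → ℝ) :
    wForm ρ U u v = wForm ρ U v u := by
  unfold wForm; congr 1; ext x; ring

theorem wForm_add_left (hρm : Measurable ρ) (hρ0 : ∀ x, 0 ≤ ρ x) (hρM : ∀ x, ρ x ≤ M)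
    (hu : MemLp u 2 (volume.restrict U)) (hv : MemLp v 2 (volume.restrict U))
    (hw : MemLp w 2 (volume.restrict U)) :
    wForm ρ U (u + v) w = wForm ρ U u w + wForm ρ U v w := by
  unfold wForm
  rw [← integral_add (integrable_weighted hρm hρ0 hρM hu hw)
    (integrable_weighted hρm hρ0 hρM hv hw)]
  congr 1; ext x; simp only [Pi.add_apply]; ring

theorem wForm_smul_left (c : ℝ) (u w : Sp d → ℝ) : wForm ρ U (c • u) w = c * wForm ρ U u w := by
  unfold wForm
  rw [← integral_const_mul]
  congr 1; ext x; simp only [Pi.smul_apply, smul_eq_mul]; ring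

theorem wForm_sum_left {ι : Type*} (hρm : Measurable ρ) (hρ0 : ∀ x, 0 ≤ ρ x) (hρM : ∀ x, ρ x ≤ M)
    (s : Finset ι) {f : ι → Sp d → ℝ} (hf : ∀ i ∈ s, MemLp (f i) 2 (volume.restrict U))
    (hw : MemLp w 2 (volume.restrict U)) :
    wForm ρ U (∑ i ∈ s, f i) w = ∑ i ∈ s, wForm ρ U (f i) w := by
  unfold wForm
  rw [← integral_finsetSum _ fun i hi => integrable_weighted hρm hρ0 hρM (hf i hi) hw]
  congr 1; ext x
  rw [Finset.sum_apply, Finset.mul_sum, Finset.sum_mul]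

theorem wForm_congr_left (h : u =ᵐ[volume.restrict U] v) (w : Sp d → ℝ) :
    wForm ρ U u w = wForm ρ U v w :=
  integral_congr_ae (by filter_upwards [h] with x hx; rw [hx])

end Forms

namespace Discretization

variable {d : ℕ} (P : Discretization d)

/-! ### The perforated cells up to null sets, the weight and the vertices. -/

theorem isClosed_holes : IsClosed P.holes :=
  isClosed_iUnion_of_finite fun _ => Metric.isClosed_closedBall

theorem isOpen_Ωε : IsOpen P.Ωε := P.isOpen_Ω.sdiff P.isClosed_holes

theorem isOpen_K (i : Fin P.Nc) : IsOpen (P.K i) := isOpen_interior.sdiff P.isClosed_holes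

theorem K_subset_Ωε (i : Fin P.Nc) : P.K i ⊆ P.Ωε := by
  rintro x ⟨h1, h2⟩
  refine ⟨?_, h2⟩
  rw [← P.regular_Ω]
  exact interior_mono (P.T_subset i) h1

theorem Ωε_subset_compl_holes : P.Ωε ⊆ P.holesᶜ := fun _ hx => hx.2

theorem K_subset_T (i : Fin P.Nc) : P.K i ⊆ P.T i := fun _ hx => interior_subset hx.1

theorem K_disjoint {i i' : Fin P.Nc} (h : i ≠ i') : Disjoint (P.K i) (P.K i') :=
  (P.T_disjoint i i' h).mono sdiff_subset sdiff_subset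

theorem ae_mem_K : ∀ᵐ x ∂(volume.restrict P.Ωε), ∃ i, x ∈ P.K i := by
  have h1 : ∀ᵐ x ∂(volume : Measure (Sp d)), ∀ i, x ∉ frontier (P.T i) :=
    ae_all_iff.2 fun i => measure_eq_zero_iff_ae_notMem.1 (P.T_frontier i)
  filter_upwards [ae_restrict_of_ae h1, ae_restrict_mem P.isOpen_Ωε.measurableSet] with x hx hm
  obtain ⟨i, hi⟩ := mem_iUnion.1 (P.T_cover hm)
  refine ⟨i, ?_, hm.2⟩
  by_contra h2
  exact hx i ⟨subset_closure hi, h2⟩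

theorem setIntegral_eq_sum {F : Type*} [NormedAddCommGroup F] [NormedSpace ℝ F] {f : Sp d → F}
    (hf : Integrable f (volume.restrict P.Ωε)) :
    ∫ x in P.Ωε, f x = ∑ i, ∫ x in P.K i, f x := by
  have h1 : ∫ x in P.Ωε, f x = ∫ x in ⋃ i, P.K i, f x := by
    refine setIntegral_congr_set ?_
    have h2 := (ae_restrict_iff' P.isOpen_Ωε.measurableSet).1 P.ae_mem_K
    filter_upwards [h2] with x hx
    apply propext
    exact ⟨fun h => mem_iUnion.2 (hx h), fun h => by
      obtain ⟨i, hi⟩ := mem_iUnion.1 h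
      exact P.K_subset_Ωε i hi⟩
  rw [h1, integral_iUnion_fintype (fun i => (P.isOpen_K i).measurableSet)
    (fun i j h => P.K_disjoint h) fun i => ?_]
  exact IntegrableOn.mono_set hf (P.K_subset_Ωε i)

theorem restrict_K_le (i : Fin P.Nc) : volume.restrict (P.K i) ≤ volume.restrict P.Ωε :=
  Measure.restrict_mono_set _ (P.K_subset_Ωε i)

theorem kt_nonneg (x : Sp d) : 0 ≤ P.kt x := Finset.sum_nonneg fun _ _ => sq_nonneg _

theorem measurable_kt : Measurable P.kt :=
  Finset.measurable_sum _ fun j _ => ((measurable_fderiv ℝ (P.χ j)).norm).pow_const 2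

theorem exists_kt_le : ∃ M, ∀ x, P.kt x ≤ M := by
  choose L hL using P.χ_lipschitz
  exact ⟨∑ j, (L j : ℝ) ^ 2, fun x => Finset.sum_le_sum fun j _ =>
    pow_le_pow_left₀ (norm_nonneg _) (norm_fderiv_le_of_lipschitz ℝ (hL j)) 2⟩

theorem ae_kt_pos (i : Fin P.Nc) : ∀ᵐ x ∂(volume.restrict (P.K i)), 0 < P.kt x :=
  ae_mono (P.restrict_K_le i) P.χ_weight

/-- The vertices of a cell. -/
def verts (i : Fin P.Nc) : Finset (Fin P.Nv) := by
  classical exact Finset.univ.filter fun j => P.node j ∈ P.T i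

theorem mem_verts {i : Fin P.Nc} {j : Fin P.Nv} : j ∈ P.verts i ↔ P.node j ∈ P.T i := by
  simp [verts]

theorem card_verts (i : Fin P.Nc) : (P.verts i).card = {j | P.node j ∈ P.T i}.ncard := by
  rw [← Set.ncard_coe_finset]; congr 1; ext j; simp [mem_verts]

theorem card_verts_le (i : Fin P.Nc) : (P.verts i).card ≤ 2 ^ d := by
  rw [card_verts]; exact P.node_card i

theorem ae_differentiableAt_χ : ∀ᵐ x ∂(volume : Measure (Sp d)), ∀ j,
    DifferentiableAt ℝ (P.χ j) x :=
  ae_all_iff.2 fun j => (P.χ_lipschitz j).choose_spec.ae_differentiableAt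

theorem interior_mem_nhds {i : Fin P.Nc} {x : Sp d} (hx : x ∈ interior (P.T i)) :
    ∀ᶠ y in 𝓝 x, y ∈ P.T i := mem_interior_iff_mem_nhds.1 hx

theorem fderiv_χ_eq_zero {i : Fin P.Nc} {x : Sp d} (hx : x ∈ interior (P.T i)) {j : Fin P.Nv}
    (hj : j ∉ P.verts i) : fderiv ℝ (P.χ j) x = 0 := by
  have h1 : P.χ j =ᶠ[𝓝 x] fun _ => (0 : ℝ) := by
    filter_upwards [P.interior_mem_nhds hx] with y hy
    exact P.χ_support j i (fun h => hj (P.mem_verts.2 h)) y hy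
  rw [h1.fderiv_eq]; simp

theorem sum_fderiv_χ {i : Fin P.Nc} {x : Sp d} (hx : x ∈ interior (P.T i))
    (hd : ∀ j, DifferentiableAt ℝ (P.χ j) x) : ∑ j, fderiv ℝ (P.χ j) x = 0 := by
  have h1 : (fun y => ∑ j, P.χ j y) =ᶠ[𝓝 x] fun _ => (1 : ℝ) := by
    filter_upwards [P.interior_mem_nhds hx] with y hy
    exact P.χ_sum i y hy
  have h2 := h1.fderiv_eq (𝕜 := ℝ)
  rw [fderiv_fun_sum (u := Finset.univ) fun j _ => hd j] at h2
  simpa using h2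

theorem sum_sq_le_kt (S : Finset (Fin P.Nv)) (x : Sp d) :
    ∑ j ∈ S, ‖fderiv ℝ (P.χ j) x‖ ^ 2 ≤ P.kt x :=
  Finset.sum_le_sum_of_subset_of_nonneg (Finset.subset_univ _) fun _ _ _ => sq_nonneg _

theorem norm_sum_sq_le {E ι : Type*} [NormedAddCommGroup E] (s : Finset ι) (f : ι → E) :
    ‖∑ j ∈ s, f j‖ ^ 2 ≤ s.card * ∑ j ∈ s, ‖f j‖ ^ 2 := by
  calc ‖∑ j ∈ s, f j‖ ^ 2 ≤ (∑ j ∈ s, ‖f j‖) ^ 2 :=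
        pow_le_pow_left₀ (norm_nonneg _) (norm_sum_le _ _) 2
    _ ≤ _ := sq_sum_le_card_mul_sum_sq

/-- Partial sums of the partition of unity: since the gradients of the partition of unity add up
to zero, the constant is a quarter of the number of vertices of a cell. -/
theorem norm_sum_fderiv_sq_le (hd3 : d ≤ 3) {i : Fin P.Nc} {x : Sp d} (hx : x ∈ interior (P.T i))
    (hd : ∀ j, DifferentiableAt ℝ (P.χ j) x) (S : Finset (Fin P.Nv)) :
    ‖∑ j ∈ S, fderiv ℝ (P.χ j) x‖ ^ 2 ≤ 2 * P.kt x := by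
  classical
  set f := fun j => fderiv ℝ (P.χ j) x with hf
  set A := P.verts i ∩ S with hA
  set B := P.verts i \ S with hB
  have hz : ∀ j ∉ P.verts i, f j = 0 := fun j hj => P.fderiv_χ_eq_zero hx hj
  have h1 : ∑ j ∈ S, f j = ∑ j ∈ A, f j := by
    symm; refine Finset.sum_subset Finset.inter_subset_right fun j hj hj' => hz j fun h => ?_
    exact hj' (Finset.mem_inter.2 ⟨h, hj⟩)
  have h2 : ∑ j ∈ A, f j + ∑ j ∈ B, f j = 0 := by
    have h3 : ∑ j ∈ P.verts i, f j = 0 := by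
      rw [Finset.sum_subset (Finset.subset_univ _) fun j _ hj => hz j hj]
      exact P.sum_fderiv_χ hx hd
    rw [← h3, ← Finset.sum_inter_add_sum_sdiff (P.verts i) S]
  have hcard : A.card + B.card ≤ 8 := by
    have h3 : A.card + B.card = (P.verts i).card := Finset.card_inter_add_card_sdiff _ _
    have h4 := P.card_verts_le i
    have h5 : 2 ^ d ≤ 2 ^ 3 := Nat.pow_le_pow_right (by norm_num) hd3
    omega
  have hk : ∑ j ∈ A, ‖f j‖ ^ 2 + ∑ j ∈ B, ‖f j‖ ^ 2 ≤ P.kt x := by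
    rw [Finset.sum_inter_add_sum_sdiff]
    exact P.sum_sq_le_kt _ x
  have e1 := norm_sum_sq_le A f
  have e2 := norm_sum_sq_le B f
  have e3 : ‖∑ j ∈ B, f j‖ = ‖∑ j ∈ A, f j‖ := by
    rw [← norm_neg]; congr 1; rw [neg_eq_iff_add_eq_zero, add_comm]; exact h2
  rw [h1]
  rw [e3] at e2
  set y := ‖∑ j ∈ A, f j‖ ^ 2
  set a := ∑ j ∈ A, ‖f j‖ ^ 2
  set b := ∑ j ∈ B, ‖f j‖ ^ 2
  have ha : 0 ≤ a := Finset.sum_nonneg fun _ _ => sq_nonneg _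
  have hb : 0 ≤ b := Finset.sum_nonneg fun _ _ => sq_nonneg _
  have hy : 0 ≤ y := sq_nonneg _
  have hc : (A.card : ℝ) + B.card ≤ 8 := by exact_mod_cast hcard
  have hn : (0 : ℝ) ≤ A.card := Nat.cast_nonneg _
  have hm : (0 : ℝ) ≤ B.card := Nat.cast_nonneg _
  set n : ℝ := (A.card : ℝ)
  set m : ℝ := (B.card : ℝ)
  -- The gradients over A and over B cancel, so y ≤ na and y ≤ mb with the same y, and a + b ≥ y(1/n
  -- + 1/m) ≥ 4y/(n + m) ≥ y/2. Summing over all vertices by Cauchy–Schwarz alone would give 8, too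
  -- much for `annulus_ineq`.
  have h5 : y ≤ 2 * (a + b) := by
    by_contra hcon
    rw [not_le] at hcon
    rcases eq_or_lt_of_le hn with h6 | h6
    · rw [← h6] at e1; nlinarith
    rcases eq_or_lt_of_le hm with h7 | h7
    · rw [← h7] at e2; nlinarith
    have h8 : y / n ≤ a := by rw [div_le_iff₀ h6]; linarith
    have h9 : y / m ≤ b := by rw [div_le_iff₀ h7]; linarith
    have h10 : 4 / (n + m) ≤ 1 / n + 1 / m := by
      rw [div_add_div _ _ h6.ne' h7.ne', div_le_div_iff₀ (by positivity) (by positivity)]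
      nlinarith [sq_nonneg (n - m)]
    have h11 : 1 / 2 ≤ 4 / (n + m) := by
      rw [div_le_div_iff₀ (by norm_num) (by positivity)]; linarith
    have h12 : y * (1 / 2) ≤ y * (1 / n + 1 / m) := mul_le_mul_of_nonneg_left (h11.trans h10) hy
    have h13 : y * (1 / n + 1 / m) = y / n + y / m := by ring
    linarith
  linarith

/-! ### Cutoff functions from the partition of unity. -/

/-- truncation to the unit interval -/
def clamp (t : ℝ) : ℝ := max 0 (min 1 t)

theorem clamp_lipschitz : LipschitzWith 1 clamp := by
  have h1 : LipschitzWith 1 fun t : ℝ => min 1 t := LipschitzWith.id.const_min 1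
  exact h1.const_max 0

theorem clamp_mem (t : ℝ) : clamp t ∈ Icc (0 : ℝ) 1 :=
  ⟨le_max_left _ _, max_le zero_le_one (min_le_left _ _)⟩

theorem clamp_of_mem {t : ℝ} (ht : t ∈ Icc (0 : ℝ) 1) : clamp t = t := by
  rw [clamp, min_eq_right ht.2, max_eq_right ht.1]

/-- sum of the partition of unity over a set of vertices -/
def cut (S : Finset (Fin P.Nv)) (x : Sp d) : ℝ := clamp (∑ j ∈ S, P.χ j x)

theorem cut_mem (S : Finset (Fin P.Nv)) (x : Sp d) : P.cut S x ∈ Icc (0 : ℝ) 1 := clamp_mem _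

theorem exists_lipschitz_sum (S : Finset (Fin P.Nv)) :
    ∃ K : ℝ≥0, LipschitzWith K fun x => ∑ j ∈ S, P.χ j x := by
  classical
  induction S using Finset.induction_on with
  | empty => exact ⟨0, by simp⟩
  | insert a s ha ih =>
    obtain ⟨K, hK⟩ := ih
    obtain ⟨L, hL⟩ := P.χ_lipschitz a
    exact ⟨L + K, by simpa [Finset.sum_insert ha] using hL.add hK⟩

theorem exists_lipschitz_cut (S : Finset (Fin P.Nv)) : ∃ K : ℝ≥0, LipschitzWith K (P.cut S) := by
  obtain ⟨K, hK⟩ := P.exists_lipschitz_sum S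
  exact ⟨1 * K, clamp_lipschitz.comp hK⟩

theorem cut_eq_sum {i : Fin P.Nc} {x : Sp d} (hx : x ∈ P.T i) (S : Finset (Fin P.Nv)) :
    P.cut S x = ∑ j ∈ S, P.χ j x := by
  refine clamp_of_mem ⟨Finset.sum_nonneg fun j _ => (P.χ_mem j i x hx).1, ?_⟩
  rw [← P.χ_sum i x hx]
  exact Finset.sum_le_sum_of_subset_of_nonneg (Finset.subset_univ _)
    fun j _ _ => (P.χ_mem j i x hx).1

theorem cut_eq_one {i : Fin P.Nc} {x : Sp d} (hx : x ∈ P.T i) {S : Finset (Fin P.Nv)}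
    (hS : P.verts i ⊆ S) : P.cut S x = 1 := by
  rw [P.cut_eq_sum hx, ← P.χ_sum i x hx]
  refine Finset.sum_subset (Finset.subset_univ _) fun j _ hj => ?_
  exact P.χ_support j i (fun h => hj (hS (P.mem_verts.2 h))) x hx

theorem cut_eq_zero {i : Fin P.Nc} {x : Sp d} (hx : x ∈ P.T i) {S : Finset (Fin P.Nv)}
    (hS : ∀ j ∈ S, P.node j ∉ P.T i) : P.cut S x = 0 := by
  rw [P.cut_eq_sum hx]
  exact Finset.sum_eq_zero fun j hj => P.χ_support j i (hS j hj) x hx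

theorem norm_gradient_cut_sq_le (hd3 : d ≤ 3) (S : Finset (Fin P.Nv)) (i : Fin P.Nc) :
    ∀ᵐ x ∂(volume.restrict (P.K i)), ‖gradient (P.cut S) x‖ ^ 2 ≤ 2 * P.kt x := by
  filter_upwards [ae_restrict_of_ae P.ae_differentiableAt_χ,
    ae_restrict_mem (P.isOpen_K i).measurableSet] with x hx hxK
  have h1 : P.cut S =ᶠ[𝓝 x] fun y => ∑ j ∈ S, P.χ j y := by
    filter_upwards [P.interior_mem_nhds hxK.1] with y hy using P.cut_eq_sum hy S
  rw [norm_gradient, h1.fderiv_eq, fderiv_fun_sum fun j _ => hx j]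
  exact P.norm_sum_fderiv_sq_le hd3 hxK.1 hx S

/-- From a point x of T to a point y outside, compare with the frontier point z nearest to x: b
vanishes at z, and z is at most as far from x as y is. -/
theorem indicator_lipschitz {T : Set (Sp d)} {b : Sp d → ℝ} {K : ℝ≥0} (hb : LipschitzWith K b)
    (hf : ∀ x ∈ frontier T, b x = 0) : LipschitzWith K (indicator T b) := by
  have key : ∀ x ∈ T, ∀ y, y ∉ T → |b x| ≤ K * dist x y := by
    intro x hx y hy
    have hne : T ≠ univ := fun h => hy (h ▸ mem_univ y)
    obtain ⟨z, hz, hd⟩ := exists_mem_frontier_infDist_compl_eq_dist hx hne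
    have h1 := hb.dist_le_mul x z
    rw [hf z hz, Real.dist_eq, sub_zero] at h1
    refine h1.trans (mul_le_mul_of_nonneg_left ?_ K.coe_nonneg)
    rw [← hd]
    exact Metric.infDist_le_dist_of_mem hy
  refine LipschitzWith.of_dist_le_mul fun x y => ?_
  by_cases hx : x ∈ T <;> by_cases hy : y ∈ T
  · simpa [hx, hy] using hb.dist_le_mul x y
  · simpa [hx, hy, Real.dist_eq] using key x hx y hy
  · rw [dist_comm x y, dist_comm]; simpa [hx, hy, Real.dist_eq] using key y hy x hx
  · simpa [hx, hy] using by positivity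

/-! ### The bubble function of a cell. -/

/-- the bubble function of a cell, extended by zero -/
def bub (i : Fin P.Nc) : Sp d → ℝ := indicator (P.T i) fun x => ∏ j ∈ P.verts i, clamp (P.χ j x)

theorem exists_lipschitz_prod (S : Finset (Fin P.Nv)) :
    ∃ K : ℝ≥0, LipschitzWith K fun x => ∏ j ∈ S, clamp (P.χ j x) := by
  classical
  induction S using Finset.induction_on with
  | empty => exact ⟨0, by simp⟩
  | insert a s ha ih =>
    obtain ⟨K, hK⟩ := ih
    obtain ⟨L, hL⟩ := P.χ_lipschitz a
    have h1 := LipschitzWith.mul_of_bounded (M := 1) (N := 1) (clamp_lipschitz.comp hL) hK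
      (fun x => by
        have := clamp_mem (P.χ a x)
        simpa [abs_of_nonneg this.1] using this.2)
      (fun x => by
        rw [abs_of_nonneg (Finset.prod_nonneg fun j _ => (clamp_mem (P.χ j x)).1)]
        exact Finset.prod_le_one (fun j _ => (clamp_mem (P.χ j x)).1)
          fun j _ => (clamp_mem (P.χ j x)).2)
    exact ⟨_, by simpa [Finset.prod_insert ha] using h1⟩

theorem exists_lipschitz_bub (i : Fin P.Nc) : ∃ K : ℝ≥0, LipschitzWith K (P.bub i) := by
  obtain ⟨K, hK⟩ := P.exists_lipschitz_prod (P.verts i)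
  refine ⟨K, indicator_lipschitz hK fun x hx => ?_⟩
  obtain ⟨j, hj, h0⟩ := P.χ_bubble i x hx
  exact Finset.prod_eq_zero (P.mem_verts.2 hj) (by rw [h0]; exact clamp_of_mem (by simp))

theorem bub_mem (i : Fin P.Nc) (x : Sp d) : P.bub i x ∈ Icc (0 : ℝ) 1 := by
  by_cases hx : x ∈ P.T i
  · rw [bub, indicator_of_mem hx]
    exact ⟨Finset.prod_nonneg fun j _ => (clamp_mem (P.χ j x)).1,
      Finset.prod_le_one (fun j _ => (clamp_mem (P.χ j x)).1) fun j _ => (clamp_mem (P.χ j x)).2⟩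
  · rw [bub, indicator_of_notMem hx]; simp

theorem bub_eq_prod {i : Fin P.Nc} {x : Sp d} (hx : x ∈ P.T i) :
    P.bub i x = ∏ j ∈ P.verts i, P.χ j x := by
  rw [bub, indicator_of_mem hx]
  exact Finset.prod_congr rfl fun j _ => clamp_of_mem (P.χ_mem j i x hx)

theorem bub_eq_bubble {i : Fin P.Nc} {x : Sp d} (hx : x ∈ P.T i) : P.bub i x = P.bubble i x := by
  rw [P.bub_eq_prod hx, bubble]
  refine Finset.prod_congr ?_ fun _ _ => rfl
  ext j; simp [mem_verts]

/-- This supplies the smallness near the cell boundary required by `IsGrad.mul_extend`. -/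
theorem mem_interior_of_bub_pos {i : Fin P.Nc} {x : Sp d} (hx : 0 < P.bub i x) :
    x ∈ interior (P.T i) := by
  have hT : x ∈ P.T i := by
    by_contra h; rw [bub, indicator_of_notMem h] at hx; exact lt_irrefl _ hx
  by_contra h
  obtain ⟨j, hj, h0⟩ := P.χ_bubble i x ⟨subset_closure hT, h⟩
  rw [P.bub_eq_prod hT, Finset.prod_eq_zero (P.mem_verts.2 hj) h0] at hx
  exact lt_irrefl _ hx

/-- In the product rule the remaining factors are at most one; Cauchy–Schwarz over at most eight
vertices gives the constant. -/
theorem norm_gradient_bub_sq_le (hd3 : d ≤ 3) (i : Fin P.Nc) :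
    ∀ᵐ x ∂(volume.restrict (P.K i)), ‖gradient (P.bub i) x‖ ^ 2 ≤ 8 * P.kt x := by
  classical
  filter_upwards [ae_restrict_of_ae P.ae_differentiableAt_χ,
    ae_restrict_mem (P.isOpen_K i).measurableSet] with x hx hxK
  have hxT := P.K_subset_T i hxK
  have h1 : P.bub i =ᶠ[𝓝 x] fun y => ∏ j ∈ P.verts i, P.χ j y := by
    filter_upwards [P.interior_mem_nhds hxK.1] with y hy using P.bub_eq_prod hy
  have h2 := HasFDerivAt.finsetProd (u := P.verts i) (fun j _ => (hx j).hasFDerivAt)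
  rw [norm_gradient, h1.fderiv_eq, h2.fderiv]
  have h3 : ‖∑ j ∈ P.verts i, (∏ k ∈ (P.verts i).erase j, P.χ k x) • fderiv ℝ (P.χ j) x‖ ^ 2 ≤
      (P.verts i).card * ∑ j ∈ P.verts i, ‖fderiv ℝ (P.χ j) x‖ ^ 2 := by
    refine (norm_sum_sq_le _ _).trans (mul_le_mul_of_nonneg_left ?_ (Nat.cast_nonneg _))
    refine Finset.sum_le_sum fun j _ => pow_le_pow_left₀ (norm_nonneg _) ?_ 2
    rw [norm_smul]
    refine mul_le_of_le_one_left (norm_nonneg _) ?_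
    rw [Real.norm_of_nonneg (Finset.prod_nonneg fun k _ => (P.χ_mem k i x hxT).1)]
    exact Finset.prod_le_one (fun k _ => (P.χ_mem k i x hxT).1) fun k _ => (P.χ_mem k i x hxT).2
  refine h3.trans ?_
  have h4 := P.card_verts_le i
  have h5 : 2 ^ d ≤ 2 ^ 3 := Nat.pow_le_pow_right (by norm_num) hd3
  have h6 : ((P.verts i).card : ℝ) ≤ 8 := by exact_mod_cast h4.trans h5
  have h7 := P.sum_sq_le_kt (P.verts i) x
  exact mul_le_mul h6 h7 (Finset.sum_nonneg fun _ _ => sq_nonneg _) (by norm_num)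

end Discretization
end CEM

/-! ### Cellwise estimates and the spectral problem -/

namespace CEM
open Filter Topology

theorem IsGrad.mul_lipschitz {d : ℕ} {U : Set (Sp d)} {u : Sp d → ℝ} {g : Sp d → Sp d}
    (hU : IsOpen U) {η : Sp d → ℝ} {K : ℝ≥0} (hη : LipschitzWith K η) (h0 : ∀ x, 0 ≤ η x)
    (h1 : ∀ x, η x ≤ 1) (hu : IsGrad U u g) :
    IsGrad U (fun x => η x * u x) (fun x => η x • g x + u x • gradient η x) := by
  have := hu.mul_extend (W := U) (M := 1) hU Subset.rfl hη h0 (by simpa using h1)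
    fun S _ hS δ _ x hx _ => hS hx
  exact this.congr (indicator_ae_eq_restrict hU.measurableSet)
    (indicator_ae_eq_restrict hU.measurableSet)

theorem isGrad_indicator_iff {d : ℕ} {U : Set (Sp d)} {u : Sp d → ℝ} {g : Sp d → Sp d}
    (hU : IsOpen U) : IsGrad U (indicator U u) g ↔ IsGrad U u g :=
  ⟨fun h => h.congr (indicator_ae_eq_restrict hU.measurableSet) (EventuallyEq.refl _ _),
    fun h => h.congr (indicator_ae_eq_restrict hU.measurableSet).symm (EventuallyEq.refl _ _)⟩

namespace Discretization

variable {d : ℕ} {P : Discretization d} {u v : Sp d → ℝ}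

theorem MemV.memH1 (hv : P.MemV v) : MemH1 P.Ωε v :=
  ((isGrad_indicator_iff P.isOpen_Ωε).1 (hv.isGrad.mono P.Ωε_subset_compl_holes
    P.isClosed_holes.isOpen_compl)).memH1

theorem memH1_K_of_memH1 (hv : MemH1 P.Ωε v) (i : Fin P.Nc) : MemH1 (P.K i) v :=
  (hv.isGrad.mono (P.K_subset_Ωε i) P.isOpen_Ωε).memH1

theorem MemV.memH1_K (hv : P.MemV v) (i : Fin P.Nc) : MemH1 (P.K i) v :=
  memH1_K_of_memH1 hv.memH1 i

theorem MemV.add (hu : P.MemV u) (hv : P.MemV v) : P.MemV (u + v) := by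
  unfold MemV at *
  rw [indicator_add']
  exact MemH1.add hu hv

theorem MemV.smul (c : ℝ) (hu : P.MemV u) : P.MemV (c • u) := by
  unfold MemV at *
  have : indicator P.Ωε (c • u) = c • indicator P.Ωε u := by
    ext x; by_cases hx : x ∈ P.Ωε <;> simp [hx]
  rw [this]; exact MemH1.smul c hu

theorem memV_zero : P.MemV (0 : Sp d → ℝ) := by
  unfold MemV
  have : indicator P.Ωε (0 : Sp d → ℝ) = 0 := by ext x; simp
  rw [this]; exact memH1_zero

theorem MemV.mul_lipschitz {η : Sp d → ℝ} {K : ℝ≥0} (hη : LipschitzWith K η) (h0 : ∀ x, 0 ≤ η x)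
    (h1 : ∀ x, η x ≤ 1) (hv : P.MemV v) : P.MemV (fun x => η x * v x) := by
  have h2 := (hv.isGrad.mul_lipschitz P.isClosed_holes.isOpen_compl hη h0 h1).memH1
  unfold MemV
  convert h2 using 1
  ext x; by_cases hx : x ∈ P.Ωε <;> simp [hx]

/-- A function in H¹(K_i) carries no condition on the cell boundary. The bubble removes its trace
there while leaving the boundary of the perforations free, so extension by zero stays in V. -/
theorem memV_bub_mul (i : Fin P.Nc) (hu : MemH1 (P.K i) u) :
    P.MemV (indicator (P.K i) fun x => P.bub i x * u x) := by
  obtain ⟨K, hK⟩ := P.exists_lipschitz_bub i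
  have h1 := hu.isGrad.mul_extend (W := P.holesᶜ) (M := 1) (P.isOpen_K i)
    ((P.K_subset_Ωε i).trans P.Ωε_subset_compl_holes) hK (fun x => (P.bub_mem i x).1)
    (fun x => by simpa using (P.bub_mem i x).2)
    fun S _ hS δ hδ x hx hb => ⟨P.mem_interior_of_bub_pos (hδ.trans_le hb), hS hx⟩
  unfold MemV
  rw [indicator_indicator, inter_eq_right.2 (P.K_subset_Ωε i)]
  exact h1.memH1

theorem aForm_eq_sum (hu : MemH1 P.Ωε u) (hv : MemH1 P.Ωε v) :
    aForm P.Ωε u v = ∑ i, aForm (P.K i) u v := by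
  unfold aForm
  rw [P.setIntegral_eq_sum (integrable_inner_grad hu.isGrad.memLp_grad hv.isGrad.memLp_grad)]
  refine Finset.sum_congr rfl fun i _ => ?_
  have h1 := hu.isGrad.mono (P.K_subset_Ωε i) P.isOpen_Ωε
  have h2 := hv.isGrad.mono (P.K_subset_Ωε i) P.isOpen_Ωε
  exact (aForm_eq (P.isOpen_K i) h1 h2).symm

theorem integrable_kt {U : Set (Sp d)} (hu : MemLp u 2 (volume.restrict U))
    (hv : MemLp v 2 (volume.restrict U)) :
    Integrable (fun x => P.kt x * u x * v x) (volume.restrict U) :=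
  integrable_weighted P.measurable_kt P.kt_nonneg P.exists_kt_le.choose_spec hu hv

theorem memLp_sqrt_kt {U : Set (Sp d)} (hu : MemLp u 2 (volume.restrict U)) :
    MemLp (fun x => √(P.kt x) * u x) 2 (volume.restrict U) :=
  memLp_sqrt_mul P.measurable_kt P.exists_kt_le.choose_spec hu

theorem s_eq_sum (hu : MemLp u 2 (volume.restrict P.Ωε)) (hv : MemLp v 2 (volume.restrict P.Ωε)) :
    P.s u v = ∑ i, P.si i u v :=
  P.setIntegral_eq_sum (integrable_kt hu hv)

theorem si_add_left (i : Fin P.Nc) {w : Sp d → ℝ} (hu : MemLp u 2 (volume.restrict (P.K i)))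
    (hv : MemLp v 2 (volume.restrict (P.K i))) (hw : MemLp w 2 (volume.restrict (P.K i))) :
    P.si i (u + v) w = P.si i u w + P.si i v w :=
  wForm_add_left P.measurable_kt P.kt_nonneg P.exists_kt_le.choose_spec hu hv hw

theorem si_smul_left (i : Fin P.Nc) (c : ℝ) (u w : Sp d → ℝ) :
    P.si i (c • u) w = c * P.si i u w := wForm_smul_left c u w

theorem si_symm (i : Fin P.Nc) (u w : Sp d → ℝ) : P.si i u w = P.si i w u := wForm_symm _ _ _ _

theorem si_sum_left (i : Fin P.Nc) {ι : Type*} (s : Finset ι) {f : ι → Sp d → ℝ} {w : Sp d → ℝ}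
    (hf : ∀ j ∈ s, MemLp (f j) 2 (volume.restrict (P.K i)))
    (hw : MemLp w 2 (volume.restrict (P.K i))) :
    P.si i (∑ j ∈ s, f j) w = ∑ j ∈ s, P.si i (f j) w :=
  wForm_sum_left P.measurable_kt P.kt_nonneg P.exists_kt_le.choose_spec s hf hw

theorem si_self_eq (i : Fin P.Nc) (u : Sp d → ℝ) :
    P.si i u u = ∫ x in P.K i, (√(P.kt x) * u x) ^ 2 := by
  unfold si wForm
  congr 1; ext x
  rw [mul_pow, Real.sq_sqrt (P.kt_nonneg x)]; ring

/-- Energy of the product with a cutoff function. -/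
theorem aForm_mul_le {i : Fin P.Nc} {η : Sp d → ℝ} {K : ℝ≥0} {C : ℝ} (hη : LipschitzWith K η)
    (h0 : ∀ x, 0 ≤ η x) (h1 : ∀ x, η x ≤ 1)
    (hC : ∀ᵐ x ∂(volume.restrict (P.K i)), ‖gradient η x‖ ^ 2 ≤ C * P.kt x)
    (hu : MemH1 (P.K i) u) :
    aForm (P.K i) (fun x => η x * u x) (fun x => η x * u x) ≤
      2 * aForm (P.K i) u u + 2 * C * P.si i u u := by
  have hg := hu.isGrad.mul_lipschitz (P.isOpen_K i) hη h0 h1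
  rw [aForm_eq (P.isOpen_K i) hg hg, aForm_eq (P.isOpen_K i) hu.isGrad hu.isGrad]
  unfold si wForm
  rw [← integral_const_mul, ← integral_const_mul, ← integral_add
    ((integrable_inner_grad hu.isGrad.memLp_grad hu.isGrad.memLp_grad).const_mul _)
    ((integrable_kt hu.1 hu.1).const_mul _)]
  refine integral_mono_ae (integrable_inner_grad hg.memLp_grad hg.memLp_grad)
    (((integrable_inner_grad hu.isGrad.memLp_grad hu.isGrad.memLp_grad).const_mul _).add
    ((integrable_kt hu.1 hu.1).const_mul _)) ?_
  filter_upwards [hC] with x hx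
  simp only [real_inner_self_eq_norm_sq]
  set G := weakGrad (P.K i) u x
  have e1 : ‖η x • G‖ ≤ ‖G‖ := by
    rw [norm_smul, Real.norm_of_nonneg (h0 x)]
    exact mul_le_of_le_one_left (norm_nonneg _) (h1 x)
  have e2 : ‖u x • gradient η x‖ ^ 2 ≤ C * P.kt x * u x ^ 2 := by
    rw [norm_smul, mul_pow, Real.norm_eq_abs, sq_abs, mul_comm]
    exact mul_le_mul_of_nonneg_right hx (sq_nonneg _)
  have e3 := norm_add_le (η x • G) (u x • gradient η x)
  have e4 : ‖η x • G + u x • gradient η x‖ ^ 2 ≤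
      2 * ‖η x • G‖ ^ 2 + 2 * ‖u x • gradient η x‖ ^ 2 := by
    have := pow_le_pow_left₀ (norm_nonneg _) e3 2
    nlinarith [sq_nonneg (‖η x • G‖ - ‖u x • gradient η x‖)]
  have e5 := pow_le_pow_left₀ (norm_nonneg _) e1 2
  nlinarith

/-- The flux across the region where a cutoff function varies. -/
theorem aForm_mul_flux {i : Fin P.Nc} {η : Sp d → ℝ} {K : ℝ≥0} {C : ℝ} (hC0 : 0 ≤ C)
    (hη : LipschitzWith K η) (h0 : ∀ x, 0 ≤ η x) (h1 : ∀ x, η x ≤ 1)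
    (hC : ∀ᵐ x ∂(volume.restrict (P.K i)), ‖gradient η x‖ ^ 2 ≤ C * P.kt x)
    (hu : MemH1 (P.K i) u) :
    -(√C * √(aForm (P.K i) u u) * √(P.si i u u)) ≤ aForm (P.K i) u (fun x => η x * u x) := by
  have hg := hu.isGrad.mul_lipschitz (P.isOpen_K i) hη h0 h1
  set G := weakGrad (P.K i) u
  have hn : MemLp (fun x => ‖G x‖) 2 (volume.restrict (P.K i)) := hu.isGrad.memLp_grad.norm
  have cs := abs_integral_mul_le hn (memLp_sqrt_kt (P := P) hu.1)
  rw [← si_self_eq] at cs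
  have e1 : ∫ x in P.K i, ‖G x‖ ^ 2 = aForm (P.K i) u u := by
    rw [aForm_eq (P.isOpen_K i) hu.isGrad hu.isGrad]
    simp only [real_inner_self_eq_norm_sq]; rfl
  rw [e1] at cs
  have h2 : - (√C * ∫ x in P.K i, |‖G x‖| * |√(P.kt x) * u x|) ≤
      aForm (P.K i) u (fun x => η x * u x) := by
    rw [aForm_eq (P.isOpen_K i) hu.isGrad hg, ← integral_const_mul, ← integral_neg]
    have hint : Integrable (fun x => |‖G x‖| * |√(P.kt x) * u x|) (volume.restrict (P.K i)) :=
      hn.norm.integrable_mul (memLp_sqrt_kt (P := P) hu.1).norm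
    refine integral_mono_ae (hint.const_mul _).neg
      (integrable_inner_grad hu.isGrad.memLp_grad hg.memLp_grad) ?_
    filter_upwards [hC] with x hx
    simp only [inner_add_right, real_inner_smul_right]
    have e2 : 0 ≤ η x * ‖G x‖ ^ 2 := mul_nonneg (h0 x) (sq_nonneg _)
    have e3 : ‖gradient η x‖ ≤ √C * √(P.kt x) := by
      rw [← Real.sqrt_mul hC0]; exact Real.le_sqrt_of_sq_le hx
    have e4 : |u x * inner ℝ (G x) (gradient η x)| ≤ √C * (|‖G x‖| * |√(P.kt x) * u x|) := by
      rw [abs_mul, abs_norm, abs_mul, abs_of_nonneg (Real.sqrt_nonneg (P.kt x))]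
      calc |u x| * |inner ℝ (G x) (gradient η x)| ≤ |u x| * (‖G x‖ * (√C * √(P.kt x))) := by
            gcongr
            exact (abs_real_inner_le_norm _ _).trans (by gcongr)
        _ = _ := by ring
    have e5 := neg_abs_le (u x * inner ℝ (G x) (gradient η x))
    have e6 : (inner ℝ (G x) (G x) : ℝ) = ‖G x‖ ^ 2 := real_inner_self_eq_norm_sq _
    show -(√C * (|‖G x‖| * |√(P.kt x) * u x|)) ≤
      η x * inner ℝ (G x) (G x) + u x * inner ℝ (G x) (gradient η x)
    rw [e6]
    linarith
  refine le_trans ?_ h2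
  rw [mul_assoc]
  exact neg_le_neg (mul_le_mul_of_nonneg_left cs (Real.sqrt_nonneg C))

theorem si_mul_le {i : Fin P.Nc} {η : Sp d → ℝ} (h0 : ∀ x, 0 ≤ η x)
    (h1 : ∀ x, η x ≤ 1) (hu : MemLp u 2 (volume.restrict (P.K i))) :
    P.si i (fun x => η x * u x) (fun x => η x * u x) ≤ P.si i u u := by
  refine integral_mono_of_nonneg (Eventually.of_forall fun x => ?_) (integrable_kt hu hu)
    (Eventually.of_forall fun x => ?_)
  · show 0 ≤ P.kt x * (η x * u x) * (η x * u x)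
    rw [mul_assoc]; exact mul_nonneg (P.kt_nonneg x) (mul_self_nonneg _)
  · show P.kt x * (η x * u x) * (η x * u x) ≤ P.kt x * u x * u x
    have h2 : η x * η x ≤ 1 := mul_le_one₀ (h1 x) (h0 x) (h1 x)
    have h3 : 0 ≤ P.kt x * (u x * u x) := mul_nonneg (P.kt_nonneg x) (mul_self_nonneg _)
    nlinarith

/-! ### Parseval's identity and the spectral gap on a cell. -/

section Spectral

variable {lam : Fin P.Nc → ℕ → ℝ} {phi : Fin P.Nc → ℕ → Sp d → ℝ}

/-- Multiplication by √κ̃ carries the weighted products to L². A vector w orthogonal to the images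
of all eigenfunctions equals √κ̃ z with z = w/√κ̃, since the weight is positive almost everywhere;
completeness then gives z = 0, and the images form a Hilbert basis. -/
theorem IsEigensystem.parseval (h : P.IsEigensystem lam phi) (i : Fin P.Nc)
    (hu : MemLp u 2 (volume.restrict (P.K i))) :
    HasSum (fun j => P.si i u (phi i j) ^ 2) (P.si i u u) := by
  have hphi : ∀ j, MemLp (fun x => √(P.kt x) * phi i j x) 2 (volume.restrict (P.K i)) :=
    fun j => memLp_sqrt_kt (h.memH1 i j).1
  have hin : ∀ {f g : Sp d → ℝ} (hf : MemLp (fun x => √(P.kt x) * f x) 2 (volume.restrict (P.K i)))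
      (hg : MemLp (fun x => √(P.kt x) * g x) 2 (volume.restrict (P.K i))),
      inner ℝ hf.toLp hg.toLp = P.si i f g := by
    intro f g hf hg
    rw [L2.inner_def]
    refine integral_congr_ae ?_
    filter_upwards [hf.coeFn_toLp, hg.coeFn_toLp] with x h1 h2
    rw [h1, h2]
    have h3 := Real.mul_self_sqrt (P.kt_nonneg x)
    show √(P.kt x) * g x * (√(P.kt x) * f x) = _
    linear_combination (f x * g x) * h3
  let e : ℕ → Lp ℝ 2 (volume.restrict (P.K i)) := fun j => (hphi j).toLp
  have hon : Orthonormal ℝ e := by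
    rw [orthonormal_iff_ite]
    intro j k
    rw [hin (hphi j) (hphi k), h.orthonormal]
  have hbot : (Submodule.span ℝ (range e))ᗮ = ⊥ := by
    rw [eq_bot_iff]
    intro w hw
    rw [Submodule.mem_bot]
    have hw' : ∀ j, inner ℝ w (e j) = (0 : ℝ) := fun j => by
      rw [real_inner_comm]
      exact Submodule.inner_right_of_mem_orthogonal (Submodule.subset_span (mem_range_self j)) hw
    set z : Sp d → ℝ := fun x => w x / √(P.kt x) with hz
    have hzw : (fun x => √(P.kt x) * z x) =ᵐ[volume.restrict (P.K i)] w := by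
      filter_upwards [P.ae_kt_pos i] with x hx
      rw [hz]; field_simp
    have hzm : MemLp (fun x => √(P.kt x) * z x) 2 (volume.restrict (P.K i)) :=
      (Lp.memLp w).ae_eq hzw.symm
    have hzL : hzm.toLp = w := by
      apply Lp.ext
      exact hzm.coeFn_toLp.trans hzw
    have h0 := h.complete i z hzm fun j => by
      rw [← hin hzm (hphi j), hzL]; exact hw' j
    apply Lp.ext
    filter_upwards [hzw, h0, Lp.coeFn_zero ℝ 2 (volume.restrict (P.K i))] with x h1 h2 h3
    rw [← h1, h2, h3]; simp
  let b := HilbertBasis.mkOfOrthogonalEqBot hon hbot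
  have hb : ∀ j, b j = e j := fun j => by
    simp [b]
  have hU : MemLp (fun x => √(P.kt x) * u x) 2 (volume.restrict (P.K i)) := memLp_sqrt_kt hu
  have key := b.hasSum_inner_mul_inner hU.toLp hU.toLp
  rw [hin hU hU] at key
  refine key.congr_fun fun j => ?_
  rw [hb, real_inner_comm hU.toLp (e j), hin hU (hphi j)]
  ring

theorem IsEigensystem.bessel (h : P.IsEigensystem lam phi) (i : Fin P.Nc)
    (hu : MemLp u 2 (volume.restrict (P.K i))) (n : ℕ) :
    ∑ j ∈ Finset.range n, P.si i u (phi i j) ^ 2 ≤ P.si i u u :=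
  sum_le_hasSum _ (fun _ _ => sq_nonneg _) (h.parseval i hu)

theorem IsEigensystem.lam_nonneg (h : P.IsEigensystem lam phi) (i : Fin P.Nc) (j : ℕ) :
    0 ≤ lam i j := by
  have h1 := h.eigen i j _ (h.memH1 i j)
  rw [h.orthonormal, if_pos rfl, mul_one] at h1
  rw [← h1]; exact aForm_self_nonneg _ _

theorem IsEigensystem.aForm_phi (h : P.IsEigensystem lam phi) (i : Fin P.Nc) (j k : ℕ) :
    aForm (P.K i) (phi i j) (phi i k) = if j = k then lam i j else 0 := by
  rw [h.eigen i j _ (h.memH1 i k), h.orthonormal]; split_ifs <;> simp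

theorem IsEigensystem.aForm_sum (h : P.IsEigensystem lam phi) (i : Fin P.Nc) (s : Finset ℕ)
    (c : ℕ → ℝ) : aForm (P.K i) (∑ j ∈ s, c j • phi i j) (∑ j ∈ s, c j • phi i j) =
      ∑ j ∈ s, lam i j * c j ^ 2 := by
  have hm : ∀ j ∈ s, MemH1 (P.K i) (c j • phi i j) := fun j _ => (h.memH1 i j).smul _
  rw [aForm_sum_left (P.isOpen_K i) s hm (memH1_sum s hm)]
  refine Finset.sum_congr rfl fun j hj => ?_
  rw [aForm_symm, aForm_sum_left (P.isOpen_K i) s hm (hm j hj), Finset.sum_eq_single j]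
  · rw [aForm_smul_left (P.isOpen_K i) _ (h.memH1 i j) (hm j hj),
      aForm_smul_right (P.isOpen_K i) _ (h.memH1 i j) (h.memH1 i j), h.aForm_phi, if_pos rfl]
    ring
  · intro k _ hk
    rw [aForm_smul_left (P.isOpen_K i) _ (h.memH1 i k) (hm j hj),
      aForm_smul_right (P.isOpen_K i) _ (h.memH1 i j) (h.memH1 i k), h.aForm_phi, if_neg hk]
    ring
  · exact fun h => absurd hj h

/-- The truncated expansion p satisfies a(p, u) = a(p, p) = ∑ λ_j c_j², and a(u - p, u - p) ≥ 0. -/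
theorem IsEigensystem.energy (h : P.IsEigensystem lam phi) (i : Fin P.Nc)
    (hu : MemH1 (P.K i) u) (n : ℕ) :
    ∑ j ∈ Finset.range n, lam i j * P.si i u (phi i j) ^ 2 ≤ aForm (P.K i) u u := by
  have hU := P.isOpen_K i
  set c := fun j => P.si i u (phi i j) with hc
  set p := ∑ j ∈ Finset.range n, c j • phi i j with hp
  have hm : ∀ j ∈ Finset.range n, MemH1 (P.K i) (c j • phi i j) := fun j _ => (h.memH1 i j).smul _
  have hpm : MemH1 (P.K i) p := memH1_sum _ hm
  have e1 : aForm (P.K i) p u = ∑ j ∈ Finset.range n, lam i j * c j ^ 2 := by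
    rw [aForm_sum_left hU _ hm hu]
    refine Finset.sum_congr rfl fun j _ => ?_
    rw [aForm_smul_left hU _ (h.memH1 i j) hu, h.eigen i j _ hu, si_symm]
    simp only [hc]; ring
  have e2 := h.aForm_sum i (Finset.range n) c
  have hq : MemH1 (P.K i) ((-1 : ℝ) • p) := hpm.smul _
  have e3 := aForm_self_nonneg (P.K i) (u + (-1 : ℝ) • p)
  rw [aForm_add_left hU hu hq (hu.add hq), aForm_add_right hU hu hq hu,
    aForm_add_right hU hu hq hq, aForm_smul_right hU _ hpm hu, aForm_smul_left hU _ hpm hu,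
    aForm_smul_left hU _ hpm hq, aForm_smul_right hU _ hpm hpm, aForm_symm _ u p, e1, e2] at e3
  linarith

/-- Beyond index n the energy dominates λ_n times the coefficients. Only finite partial sums of
Parseval's series are compared, so no completeness in H¹ is needed. -/
theorem IsEigensystem.spectral (h : P.IsEigensystem lam phi) (i : Fin P.Nc)
    (hu : MemH1 (P.K i) u) {n : ℕ} (hn : 0 < lam i n) :
    P.si i u u ≤ ∑ j ∈ Finset.range n, P.si i u (phi i j) ^ 2 +
      (lam i n)⁻¹ * aForm (P.K i) u u := by
  have h1 := h.parseval i hu.1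
  refine hasSum_le_of_sum_le h1 fun s => ?_
  obtain ⟨N, hN⟩ := s.exists_nat_subset_range
  have h2 : ∑ j ∈ s, P.si i u (phi i j) ^ 2 ≤
      ∑ j ∈ Finset.range (n + N), P.si i u (phi i j) ^ 2 :=
    Finset.sum_le_sum_of_subset_of_nonneg
      (hN.trans (Finset.range_mono (Nat.le_add_left _ _))) fun _ _ _ => sq_nonneg _
  refine h2.trans ?_
  have h3 := h.energy i hu (n + N)
  rw [Finset.sum_range_add] at h3 ⊢
  gcongr
  have h4 : 0 ≤ ∑ j ∈ Finset.range n, lam i j * P.si i u (phi i j) ^ 2 :=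
    Finset.sum_nonneg fun j _ => mul_nonneg (h.lam_nonneg i j) (sq_nonneg _)
  have h5 : lam i n * ∑ j ∈ Finset.range N, P.si i u (phi i (n + j)) ^ 2 ≤
      ∑ j ∈ Finset.range N, lam i (n + j) * P.si i u (phi i (n + j)) ^ 2 := by
    rw [Finset.mul_sum]
    exact Finset.sum_le_sum fun j _ =>
      mul_le_mul_of_nonneg_right (h.mono i (Nat.le_add_right _ _)) (sq_nonneg _)
  rw [le_inv_mul_iff₀ hn]
  linarith

end Spectral

end Discretization
end CEM

/-! ### Lifting coefficients to functions supported in a cell -/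

namespace CEM
open Filter Topology

theorem isGrad_sum {d : ℕ} {U : Set (Sp d)} {ι : Type*} (s : Finset ι) {f : ι → Sp d → ℝ}
    {g : ι → Sp d → Sp d} (h : ∀ i ∈ s, IsGrad U (f i) (g i)) :
    IsGrad U (∑ i ∈ s, f i) (∑ i ∈ s, g i) := by
  classical
  induction s using Finset.induction_on with
  | empty => simpa using isGrad_zero
  | insert a s ha ih =>
    rw [Finset.sum_insert ha, Finset.sum_insert ha]
    exact (h a (Finset.mem_insert_self a s)).add
      (ih fun i hi => h i (Finset.mem_insert_of_mem hi))

namespace Discretization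

variable {d : ℕ} {P : Discretization d} {u v : Sp d → ℝ}
  {lam : Fin P.Nc → ℕ → ℝ} {phi : Fin P.Nc → ℕ → Sp d → ℝ} {l : Fin P.Nc → ℕ}

theorem bub_measurable (i : Fin P.Nc) : Measurable (P.bub i) :=
  (P.exists_lipschitz_bub i).choose_spec.continuous.measurable

theorem memLp_bub_mul (i : Fin P.Nc) (hu : MemLp u 2 (volume.restrict (P.K i))) :
    MemLp (fun x => P.bub i x * u x) 2 (volume.restrict (P.K i)) := by
  refine hu.of_le ((bub_measurable i).aestronglyMeasurable.mul hu.1)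
    (Eventually.of_forall fun x => ?_)
  rw [norm_mul, Real.norm_of_nonneg (P.bub_mem i x).1]
  exact mul_le_of_le_one_left (norm_nonneg _) (P.bub_mem i x).2

theorem memH1_bub_mul (i : Fin P.Nc) (hu : MemH1 (P.K i) u) :
    MemH1 (P.K i) (fun x => P.bub i x * u x) := by
  obtain ⟨K, hK⟩ := P.exists_lipschitz_bub i
  exact (hu.isGrad.mul_lipschitz (P.isOpen_K i) hK (fun x => (P.bub_mem i x).1)
    fun x => (P.bub_mem i x).2).memH1

theorem abs_inner_gradient_bub_le (hd3 : d ≤ 3) (i : Fin P.Nc) (v : Sp d → ℝ)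
    (g : Sp d → Sp d) : ∀ᵐ x ∂(volume.restrict (P.K i)),
      |v x * inner ℝ (g x) (gradient (P.bub i) x)| ≤ √8 * (|‖g x‖| * |√(P.kt x) * v x|) := by
  filter_upwards [P.norm_gradient_bub_sq_le hd3 i] with x hx
  have e3 : ‖gradient (P.bub i) x‖ ≤ √8 * √(P.kt x) := by
    rw [← Real.sqrt_mul (by norm_num)]; exact Real.le_sqrt_of_sq_le hx
  rw [abs_mul, abs_norm, abs_mul, abs_of_nonneg (Real.sqrt_nonneg (P.kt x))]
  calc |v x| * |inner ℝ (g x) (gradient (P.bub i) x)| ≤ |v x| * (‖g x‖ * (√8 * √(P.kt x))) := by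
        gcongr
        exact (abs_real_inner_le_norm _ _).trans (by gcongr)
    _ = _ := by ring

theorem integrable_inner_gradient_bub (hd3 : d ≤ 3) (i : Fin P.Nc)
    (hv : MemLp v 2 (volume.restrict (P.K i))) {g : Sp d → Sp d}
    (hg : MemLp g 2 (volume.restrict (P.K i))) :
    Integrable (fun x => v x * inner ℝ (g x) (gradient (P.bub i) x)) (volume.restrict (P.K i)) := by
  refine Integrable.mono' ((hg.norm.norm.integrable_mul
    (memLp_sqrt_kt (P := P) hv).norm).const_mul √8)
    (hv.1.mul (hg.1.inner (measurable_gradient _).aestronglyMeasurable)) ?_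
  exact abs_inner_gradient_bub_le hd3 i v g

/-- The first-order part of the commutator of the energy form and multiplication by the bubble. -/
theorem aForm_bub_mul (hd3 : d ≤ 3) (i : Fin P.Nc) (hu : MemH1 (P.K i) u) (hv : MemH1 (P.K i) v) :
    aForm (P.K i) u (fun x => P.bub i x * v x) =
      (∫ x in P.K i, P.bub i x * inner ℝ (weakGrad (P.K i) u x) (weakGrad (P.K i) v x)) +
      ∫ x in P.K i, v x * inner ℝ (weakGrad (P.K i) u x) (gradient (P.bub i) x) := by
  obtain ⟨K, hK⟩ := P.exists_lipschitz_bub i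
  have hg := hv.isGrad.mul_lipschitz (P.isOpen_K i) hK (fun x => (P.bub_mem i x).1)
    fun x => (P.bub_mem i x).2
  have h1 : Integrable (fun x => P.bub i x *
      inner ℝ (weakGrad (P.K i) u x) (weakGrad (P.K i) v x)) (volume.restrict (P.K i)) :=
    (integrable_inner_grad hu.isGrad.memLp_grad hv.isGrad.memLp_grad).bdd_mul (c := 1)
      (bub_measurable i).aestronglyMeasurable (Eventually.of_forall fun x => by
        rw [Real.norm_of_nonneg (P.bub_mem i x).1]; exact (P.bub_mem i x).2)
  rw [aForm_eq (P.isOpen_K i) hu.isGrad hg, ← integral_add h1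
    (integrable_inner_gradient_bub hd3 i hv.1 hu.isGrad.memLp_grad)]
  simp only [inner_add_right, real_inner_smul_right]

theorem IsEigensystem.aForm_sum_fin (h : P.IsEigensystem lam phi) (i : Fin P.Nc) {n : ℕ}
    (y : Fin n → ℝ) : aForm (P.K i) (∑ j, y j • phi i j) (∑ j, y j • phi i j) =
      ∑ j : Fin n, lam i j * y j ^ 2 := by
  have := h.aForm_sum i (Finset.range n) fun j => if h : j < n then y ⟨j, h⟩ else 0
  simpa [Finset.sum_range] using this

theorem IsEigensystem.memH1_sum_fin (h : P.IsEigensystem lam phi) (i : Fin P.Nc) {n : ℕ}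
    (y : Fin n → ℝ) : MemH1 (P.K i) (∑ j, y j • phi i j) :=
  memH1_sum _ fun j _ => (h.memH1 i j).smul _

theorem IsEigensystem.si_sum_fin (h : P.IsEigensystem lam phi) (i : Fin P.Nc) {n : ℕ}
    (y : Fin n → ℝ) (b : Fin n) : P.si i (∑ j, y j • phi i j) (phi i b) = y b := by
  rw [si_sum_left i _ (f := fun j : Fin n => y j • phi i j)
    (fun j _ => ((h.memH1 i j).smul _).1) (h.memH1 i b).1]
  simp only [si_smul_left, h.orthonormal]
  simp [Fin.val_inj]

theorem IsEigensystem.si_sum_fin_self (h : P.IsEigensystem lam phi) (i : Fin P.Nc) {n : ℕ}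
    (y : Fin n → ℝ) : P.si i (∑ j, y j • phi i j) (∑ j, y j • phi i j) = ∑ j, y j ^ 2 := by
  rw [si_sum_left i _ (f := fun j : Fin n => y j • phi i j)
    (fun j _ => ((h.memH1 i j).smul _).1) (h.memH1_sum_fin i y).1]
  refine Finset.sum_congr rfl fun j _ => ?_
  rw [si_smul_left, si_symm, h.si_sum_fin, sq]

/-- On the auxiliary space, the bubble weighted mass controls the mass. -/
theorem IsEigensystem.sum_sq_le_bub (h : P.IsEigensystem lam phi) {cπ : ℝ} (hcπ : 0 < cπ)
    (hC : P.Cpi phi l ≤ ENNReal.ofReal cπ) (i : Fin P.Nc) (y : Fin (l i) → ℝ) :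
    ∑ j, y j ^ 2 ≤ cπ * P.si i (fun x => P.bub i x * (∑ j, y j • phi i j) x)
      (∑ j, y j • phi i j) := by
  set μ : Sp d → ℝ := ∑ j, y j • phi i j with hμ
  have hmem : μ ∈ P.Vaux phi l i := Submodule.sum_mem _ fun j _ =>
    Submodule.smul_mem _ _ (Submodule.subset_span ⟨j, j.2, rfl⟩)
  have h1 : ENNReal.ofReal (P.si i μ μ) /
      ENNReal.ofReal (∫ x in P.K i, P.bubble i x * P.kt x * μ x ^ 2) ≤ ENNReal.ofReal cπ :=
    by
    refine le_trans ?_ hC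
    exact le_iSup_of_le i (le_iSup₂_of_le (f := fun μ (_ : μ ∈ P.Vaux phi l i) =>
      ENNReal.ofReal (P.si i μ μ) /
        ENNReal.ofReal (∫ x in P.K i, P.bubble i x * P.kt x * μ x ^ 2)) μ hmem le_rfl)
  -- A zero denominator is harmless: in `ENNReal` the quotient would be infinite unless the
  -- numerator vanishes too.
  rw [ENNReal.div_le_iff_le_mul (Or.inr ENNReal.ofReal_ne_top) (Or.inl ENNReal.ofReal_ne_top),
    ← ENNReal.ofReal_mul hcπ.le] at h1
  have e : ∫ x in P.K i, P.bubble i x * P.kt x * μ x ^ 2 =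
      P.si i (fun x => P.bub i x * μ x) μ := by
    refine setIntegral_congr_fun (P.isOpen_K i).measurableSet fun x hx => ?_
    simp only [P.bub_eq_bubble (P.K_subset_T i hx)]
    ring
  have h0 : 0 ≤ P.si i (fun x => P.bub i x * μ x) μ := by
    refine integral_nonneg fun x => ?_
    have := mul_nonneg (mul_nonneg (P.kt_nonneg x) (P.bub_mem i x).1) (mul_self_nonneg (μ x))
    show 0 ≤ P.kt x * (P.bub i x * μ x) * μ x
    linarith
  rw [e] at h1
  rw [← h.si_sum_fin_self i y]
  exact (ENNReal.ofReal_le_ofReal_iff (mul_nonneg hcπ.le h0)).1 h1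

/-- The ansatz w = B ∑ μ_a φ_a turns the prescribed coefficients into Tμ = x. Coercivity of T is the
finiteness of C_π, and the commutator bound holds with √8 because |∇B|² ≤ 8κ̃. Thus the constant
depends neither on the number of eigenfunctions nor on their eigenvalues. -/
theorem IsEigensystem.exists_lift (hd3 : d ≤ 3) (h : P.IsEigensystem lam phi) {cπ : ℝ}
    (hcπ : 0 < cπ) (hC : P.Cpi phi l ≤ ENNReal.ofReal cπ) (i : Fin P.Nc) (x : Fin (l i) → ℝ) :
    ∃ w, P.MemV w ∧ (∀ z ∉ P.K i, w z = 0) ∧ (∀ j : Fin (l i), P.si i w (phi i j) = x j) ∧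
      aForm (P.K i) w w ≤ 16 * (cπ * (1 + 2 * √8 * cπ)) ^ 2 *
        ∑ j : Fin (l i), (1 + lam i j) * x j ^ 2 := by
  have hU := P.isOpen_K i
  let g : Fin (l i) → Sp d → Sp d := fun a => weakGrad (P.K i) (phi i a)
  have hg : ∀ a : Fin (l i), IsGrad (P.K i) (phi i a) (g a) := fun a => (h.memH1 i a).isGrad
  let T : Fin (l i) → Fin (l i) → ℝ := fun a b =>
    P.si i (fun x => P.bub i x * phi i a x) (phi i b)
  let G : Fin (l i) → Fin (l i) → ℝ := fun a b =>
    ∫ x in P.K i, phi i b x * inner ℝ (g a x) (gradient (P.bub i) x)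
  have hTs : ∀ a b, T a b = T b a := fun a b => by
    simp only [T, si, wForm]
    congr 1; ext x; ring
  have hbs : ∀ (y : Fin (l i) → ℝ), (fun x => P.bub i x * (∑ j, y j • phi i j) x) =
      ∑ j, y j • fun x => P.bub i x * phi i j x := fun y => by
    ext x
    simp only [Finset.sum_apply, Pi.smul_apply, smul_eq_mul, Finset.mul_sum]
    exact Finset.sum_congr rfl fun j _ => by ring
  have hm : ∀ (c : ℝ) (a : Fin (l i)),
      MemLp (c • fun x => P.bub i x * phi i a x) 2 (volume.restrict (P.K i)) := fun c a =>
    (memLp_bub_mul i (h.memH1 i a).1).const_smul c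
  have hTsum : ∀ (y : Fin (l i) → ℝ) (b : Fin (l i)),
      P.si i (fun x => P.bub i x * (∑ j, y j • phi i j) x) (phi i b) = ∑ a, T a b * y a := by
    intro y b
    rw [hbs, si_sum_left i _ (fun j _ => hm _ j) (h.memH1 i b).1]
    exact Finset.sum_congr rfl fun a _ => by rw [si_smul_left, mul_comm]
  have hT : ∀ y : Fin (l i) → ℝ, ∑ a, y a ^ 2 ≤ cπ * ∑ a, ∑ b, T a b * y a * y b := by
    intro y
    refine (h.sum_sq_le_bub hcπ hC i y).trans_eq ?_
    rw [si_symm, si_sum_left i _ (f := fun j : Fin (l i) => y j • phi i j)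
      (fun j _ => ((h.memH1 i j).smul _).1) (memLp_bub_mul i (h.memH1_sum_fin i y).1), Finset.sum_comm]
    congr 1
    refine Finset.sum_congr rfl fun b _ => ?_
    rw [si_smul_left, si_symm, hTsum, Finset.mul_sum]
    exact Finset.sum_congr rfl fun a _ => by ring
  -- Testing the eigenvalue equation of φ_a with Bφ_b gives λ_a T_ab = ∫ B ∇φ_a · ∇φ_b + G_ab. The
  -- first integral is symmetric in a and b and drops out of the difference.
  have hcomm : ∀ a b : Fin (l i), (lam i a - lam i b) * T a b = G a b - G b a := by
    have key : ∀ a b : Fin (l i), lam i a * T a b =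
        (∫ x in P.K i, P.bub i x * inner ℝ (g a x) (g b x)) + G a b := by
      intro a b
      rw [← aForm_bub_mul hd3 i (h.memH1 i a) (h.memH1 i b),
        h.eigen i a _ (memH1_bub_mul i (h.memH1 i b)), hTs a b, si_symm]
    intro a b
    have h1 := key a b
    have h2 := key b a
    have h3 : ∫ x in P.K i, P.bub i x * inner ℝ (g a x) (g b x) =
        ∫ x in P.K i, P.bub i x * inner ℝ (g b x) (g a x) := by simp only [real_inner_comm]
    rw [hTs b a] at h2
    linear_combination h1 - h2 + h3
  have hG : ∀ x y : Fin (l i) → ℝ, |∑ a, ∑ b, G a b * x a * y b| ≤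
      √8 * √(∑ a : Fin (l i), lam i a * x a ^ 2) * √(∑ b, y b ^ 2) := by
    intro x y
    set X : Sp d → ℝ := ∑ a : Fin (l i), x a • phi i a with hX
    set Y : Sp d → ℝ := ∑ a : Fin (l i), y a • phi i a with hY
    have hgX : IsGrad (P.K i) X (∑ a, x a • g a) := isGrad_sum _ fun a _ => (hg a).smul _
    have hYm := h.memH1_sum_fin i y
    have e1 : ∑ a, ∑ b, G a b * x a * y b =
        ∫ z in P.K i, Y z * inner ℝ ((∑ a, x a • g a) z) (gradient (P.bub i) z) := by
      have hint : ∀ a b : Fin (l i), Integrable (fun z => phi i b z * inner ℝ (g a z)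
          (gradient (P.bub i) z) * x a * y b) (volume.restrict (P.K i)) := fun a b =>
        ((integrable_inner_gradient_bub hd3 i (h.memH1 i b).1 (hg a).memLp_grad).mul_const
          _).mul_const _
      simp only [G, ← integral_mul_const]
      simp_rw [← integral_finsetSum Finset.univ (fun b _ => hint _ b)]
      rw [← integral_finsetSum Finset.univ fun a _ => integrable_finsetSum _ fun b _ => hint a b]
      congr 1; ext z
      simp only [hY, Finset.sum_apply, Pi.smul_apply, sum_inner, real_inner_smul_left, smul_eq_mul]
      rw [Finset.sum_mul_sum, Finset.sum_comm]
      exact Finset.sum_congr rfl fun a _ => Finset.sum_congr rfl fun b _ => by ring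
    have hn : MemLp (fun z => ‖(∑ a, x a • g a) z‖) 2 (volume.restrict (P.K i)) :=
      hgX.memLp_grad.norm
    have cs := abs_integral_mul_le hn (memLp_sqrt_kt (P := P) hYm.1)
    rw [← si_self_eq, h.si_sum_fin_self] at cs
    have e2 : ∫ z in P.K i, ‖(∑ a, x a • g a) z‖ ^ 2 = ∑ a : Fin (l i), lam i a * x a ^ 2 := by
      rw [← h.aForm_sum_fin, aForm_eq hU hgX hgX]
      simp only [real_inner_self_eq_norm_sq]
    rw [e2] at cs
    rw [e1, mul_assoc]
    refine (abs_integral_le_integral_abs.trans ?_).trans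
      (mul_le_mul_of_nonneg_left cs (Real.sqrt_nonneg 8))
    rw [← integral_const_mul]
    exact integral_mono_ae (integrable_inner_gradient_bub hd3 i hYm.1 hgX.memLp_grad).abs
      ((hn.norm.integrable_mul (memLp_sqrt_kt (P := P) hYm.1).norm).const_mul _)
      (abs_inner_gradient_bub_le hd3 i Y _)
  obtain ⟨μ, hμ, hle⟩ := exists_solution_energy_le (lam := fun a : Fin (l i) => lam i a)
    (fun a => h.lam_nonneg i a) (Real.sqrt_nonneg 8) hcπ hT hcomm hG x
  set M : Sp d → ℝ := ∑ a : Fin (l i), μ a • phi i a with hM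
  have hMm := h.memH1_sum_fin i μ
  have hae : indicator (P.K i) (fun z => P.bub i z * M z) =ᵐ[volume.restrict (P.K i)]
      fun z => P.bub i z * M z := indicator_ae_eq_restrict hU.measurableSet
  refine ⟨indicator (P.K i) fun z => P.bub i z * M z, memV_bub_mul i hMm,
    fun z hz => indicator_of_notMem hz _, fun j => ?_, ?_⟩
  · have : P.si i (indicator (P.K i) fun z => P.bub i z * M z) (phi i j) =
        P.si i (fun z => P.bub i z * M z) (phi i j) := wForm_congr_left hae _
    rw [this, hM, hTsum, ← hμ j]
    exact Finset.sum_congr rfl fun a _ => by rw [hTs]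
  · have hBm := memH1_bub_mul i hMm
    have hIm : MemH1 (P.K i) (indicator (P.K i) fun z => P.bub i z * M z) :=
      (memV_bub_mul i hMm).memH1_K i
    obtain ⟨K, hK⟩ := P.exists_lipschitz_bub i
    rw [aForm_congr hU hIm hae hIm, aForm_symm, aForm_congr hU hIm hae hBm]
    have h1 := aForm_mul_le hK (fun x => (P.bub_mem i x).1) (fun x => (P.bub_mem i x).2)
      (P.norm_gradient_bub_sq_le hd3 i) hMm
    rw [h.aForm_sum_fin, h.si_sum_fin_self] at h1
    -- The cutoff estimate with |∇B|² ≤ 8κ̃ gives 2λ_j + 16, which is at most 16(1 + λ_j).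
    have h2 : 2 * ∑ j : Fin (l i), lam i j * μ j ^ 2 + 2 * 8 * ∑ j, μ j ^ 2 ≤
        16 * ∑ a : Fin (l i), (1 + lam i a) * μ a ^ 2 := by
      rw [Finset.mul_sum, Finset.mul_sum, Finset.mul_sum, ← Finset.sum_add_distrib]
      refine Finset.sum_le_sum fun j _ => ?_
      nlinarith [mul_nonneg (h.lam_nonneg i j) (sq_nonneg (μ j))]
    calc _ ≤ _ := h1
      _ ≤ _ := h2
      _ ≤ _ := by rw [mul_assoc]; exact mul_le_mul_of_nonneg_left hle (by norm_num)

end Discretization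
end CEM

/-! ### The forms of the method as an abstract system -/

namespace CEM
open Filter Topology

theorem aForm_eq_zero {d : ℕ} {U : Set (Sp d)} {u w : Sp d → ℝ} (hU : IsOpen U)
    (hu : MemH1 U u) (h : ∀ᵐ x ∂(volume.restrict U), u x = 0) (hw : MemH1 U w) :
    aForm U u w = 0 := by
  rw [aForm_congr (v := 0) hU hu h hw, aForm_zero_left hU hw]

namespace Discretization

variable {d : ℕ} (P : Discretization d)

/-- The coarse vertices in the region obtained from cell `i` by adding `m` layers of cells. -/
def patchVerts (i : Fin P.Nc) (m : ℕ) : Finset (Fin P.Nv) := by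
  classical exact Finset.univ.filter fun j => ∃ r ∈ P.layer i m, P.node j ∈ P.T r

/-- A cutoff function, zero on `m` layers around cell `i` and one off `m + 1` layers. -/
def outer (i : Fin P.Nc) (m : ℕ) (x : Sp d) : ℝ := 1 - P.cut (P.patchVerts i m) x

theorem mem_patchVerts {i : Fin P.Nc} {m : ℕ} {j : Fin P.Nv} :
    j ∈ P.patchVerts i m ↔ ∃ r ∈ P.layer i m, P.node j ∈ P.T r := by
  simp [patchVerts]

theorem outer_mem (i : Fin P.Nc) (m : ℕ) (x : Sp d) : P.outer i m x ∈ Icc (0 : ℝ) 1 := by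
  have := P.cut_mem (P.patchVerts i m) x
  exact ⟨sub_nonneg.2 this.2, sub_le_self _ this.1⟩

theorem exists_lipschitz_outer (i : Fin P.Nc) (m : ℕ) :
    ∃ K : ℝ≥0, LipschitzWith K (P.outer i m) := by
  obtain ⟨K, hK⟩ := P.exists_lipschitz_cut (P.patchVerts i m)
  refine ⟨K, LipschitzWith.of_dist_le_mul fun x y => ?_⟩
  have := hK.dist_le_mul x y
  rwa [Real.dist_eq, abs_sub_comm, ← sub_sub_sub_cancel_left _ _ (1 : ℝ), ← Real.dist_eq] at this

theorem gradient_outer (i : Fin P.Nc) (m : ℕ) (x : Sp d) :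
    ‖gradient (P.outer i m) x‖ = ‖gradient (P.cut (P.patchVerts i m)) x‖ := by
  rw [norm_gradient, norm_gradient]
  have : fderiv ℝ (P.outer i m) x = - fderiv ℝ (P.cut (P.patchVerts i m)) x := by
    unfold outer; rw [fderiv_const_sub]
  rw [this, norm_neg]

theorem outer_eq_zero {i q : Fin P.Nc} {m : ℕ} (hq : q ∈ P.layer i m) {x : Sp d}
    (hx : x ∈ P.K q) : P.outer i m x = 0 := by
  unfold outer
  rw [P.cut_eq_one (P.K_subset_T q hx), sub_self]
  exact fun j hj => P.mem_patchVerts.2 ⟨q, hq, P.mem_verts.1 hj⟩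

/-- A vertex shared by cell q and a cell of the m-th region would make the two touch, and q would
belong to the next layer. -/
theorem outer_eq_one {i q : Fin P.Nc} {m : ℕ} (hq : q ∉ P.layer i (m + 1)) {x : Sp d}
    (hx : x ∈ P.K q) : P.outer i m x = 1 := by
  unfold outer
  rw [P.cut_eq_zero (P.K_subset_T q hx), sub_zero]
  intro j hj hjq
  obtain ⟨r, hr, hjr⟩ := P.mem_patchVerts.1 hj
  exact hq ⟨r, hr, P.node j, hjq, hjr⟩

theorem layer_subset_succ (hne : ∀ q, (P.T q).Nonempty) (i : Fin P.Nc) (m : ℕ) :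
    P.layer i m ⊆ P.layer i (m + 1) := fun q hq => ⟨q, hq, by rw [inter_self]; exact hne q⟩

theorem self_mem_layer (hne : ∀ q, (P.T q).Nonempty) (i : Fin P.Nc) (m : ℕ) :
    i ∈ P.layer i m := by
  induction m with
  | zero => exact rfl
  | succ m ih => exact P.layer_subset_succ hne i m ih

theorem K_subset_compl_patch {i q : Fin P.Nc} {m : ℕ} (hq : q ∉ P.layer i m) :
    P.K q ⊆ P.Ωε \ P.patch i m := by
  intro x hx
  refine ⟨P.K_subset_Ωε q hx, fun h => ?_⟩
  simp only [patch, mem_iUnion] at h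
  obtain ⟨r, hr, hxr⟩ := h
  rcases eq_or_ne q r with rfl | h
  · exact hq hr
  · exact (P.K_disjoint h).ne_of_mem hx hxr rfl

theorem K_inter_patch_nonempty_iff {i q : Fin P.Nc} {m : ℕ} (hne : (P.K q).Nonempty) :
    (P.K q ∩ P.patch i m).Nonempty ↔ q ∈ P.layer i m := by
  refine ⟨fun ⟨x, hx, hx'⟩ => by_contra fun h => (P.K_subset_compl_patch h hx).2 hx',
    fun h => ?_⟩
  obtain ⟨x, hx⟩ := hne
  exact ⟨x, hx, mem_iUnion₂.2 ⟨q, h, hx⟩⟩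

theorem K_inter_compl_patch_nonempty_iff {i q : Fin P.Nc} {m : ℕ} (hne : (P.K q).Nonempty) :
    (P.K q ∩ (P.Ωε \ P.patch i m)).Nonempty ↔ q ∉ P.layer i m := by
  refine ⟨fun ⟨x, hx, hx'⟩ h => hx'.2 (mem_iUnion₂.2 ⟨q, h, hx⟩), fun h => ?_⟩
  obtain ⟨x, hx⟩ := hne
  exact ⟨x, hx, P.K_subset_compl_patch h hx⟩

/-- The space `V`. -/
def spaceV : Submodule ℝ (Sp d → ℝ) where
  carrier := {v | P.MemV v}
  add_mem' := MemV.add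
  zero_mem' := memV_zero
  smul_mem' c _ hv := hv.smul c

/-- The space `V_0(K_{i,m})`, as a subspace of `V`. -/
def spaceV0 (i : Fin P.Nc) (m : ℕ) : Submodule ℝ P.spaceV where
  carrier := {v | ∀ᵐ x ∂(volume.restrict (P.Ωε \ P.patch i m)), (v : Sp d → ℝ) x = 0}
  add_mem' {u v} hu hv := by
    rw [mem_ofPred_eq] at hu hv ⊢
    filter_upwards [hu, hv] with x h1 h2
    simp [h1, h2]
  zero_mem' := by
    rw [mem_ofPred_eq]
    exact Eventually.of_forall fun _ => rfl
  smul_mem' c v hv := by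
    rw [mem_ofPred_eq] at hv ⊢
    filter_upwards [hv] with x h1
    simp [h1]

/-- The form `a_i` on `V`. -/
def formA (i : Fin P.Nc) : LinearMap.BilinForm ℝ P.spaceV :=
  LinearMap.mk₂ ℝ (fun u v => aForm (P.K i) u v)
    (fun u v w => aForm_add_left (P.isOpen_K i) (u.2.memH1_K i) (v.2.memH1_K i) (w.2.memH1_K i))
    (fun c u w => aForm_smul_left (P.isOpen_K i) c (u.2.memH1_K i) (w.2.memH1_K i))
    (fun w u v => aForm_add_right (P.isOpen_K i) (u.2.memH1_K i) (v.2.memH1_K i) (w.2.memH1_K i))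
    (fun c w u => aForm_smul_right (P.isOpen_K i) c (u.2.memH1_K i) (w.2.memH1_K i))

theorem formA_apply (i : Fin P.Nc) (u v : P.spaceV) : P.formA i u v = aForm (P.K i) u v := rfl

/-- Multiplication by the outer cutoff function. -/
def mulOuter (i : Fin P.Nc) (m : ℕ) : P.spaceV →ₗ[ℝ] P.spaceV where
  toFun v := ⟨fun x => P.outer i m x * (v : Sp d → ℝ) x,
    MemV.mul_lipschitz (P.exists_lipschitz_outer i m).choose_spec (fun x => (P.outer_mem i m x).1)
      (fun x => (P.outer_mem i m x).2) v.2⟩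
  map_add' u v := by ext x; exact mul_add _ _ _
  map_smul' c v := by ext x; exact mul_left_comm _ _ _

theorem mulOuter_apply (i : Fin P.Nc) (m : ℕ) (v : P.spaceV) :
    (P.mulOuter i m v : Sp d → ℝ) = fun x => P.outer i m x * (v : Sp d → ℝ) x := rfl

theorem sub_mulOuter (i : Fin P.Nc) (m : ℕ) (v : P.spaceV) :
    ((v - P.mulOuter i m v : P.spaceV) : Sp d → ℝ) =
      fun x => P.cut (P.patchVerts i m) x * (v : Sp d → ℝ) x := by
  ext x
  show (v : Sp d → ℝ) x - (1 - P.cut (P.patchVerts i m) x) * (v : Sp d → ℝ) x = _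
  ring

theorem mulOuter_inside {i q : Fin P.Nc} {m : ℕ} (hq : q ∈ P.layer i m) (v : P.spaceV) :
    ∀ᵐ x ∂(volume.restrict (P.K q)), (P.mulOuter i m v : Sp d → ℝ) x = 0 := by
  filter_upwards [ae_restrict_mem (P.isOpen_K q).measurableSet] with x hx
  simp only [mulOuter_apply, P.outer_eq_zero hq hx, zero_mul]

theorem mulOuter_outside {i q : Fin P.Nc} {m : ℕ} (hq : q ∉ P.layer i (m + 1)) (v : P.spaceV) :
    (P.mulOuter i m v : Sp d → ℝ) =ᵐ[volume.restrict (P.K q)] v := by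
  filter_upwards [ae_restrict_mem (P.isOpen_K q).measurableSet] with x hx
  simp only [mulOuter_apply, P.outer_eq_one hq hx, one_mul]

theorem si_eq_zero {q : Fin P.Nc} {u w : Sp d → ℝ}
    (h : ∀ᵐ x ∂(volume.restrict (P.K q)), u x = 0) : P.si q u w = 0 := by
  refine (wForm_congr_left (v := 0) h w).trans ?_
  simp [wForm]

section Forms

variable {P} {lam : Fin P.Nc → ℕ → ℝ} {phi : Fin P.Nc → ℕ → Sp d → ℝ} {l : Fin P.Nc → ℕ}

/-- A normalized eigenfunction cannot live on an empty element. Nonempty cells touch themselves, so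
the layers are increasing. -/
theorem IsEigensystem.nonempty_K (h : P.IsEigensystem lam phi) (q : Fin P.Nc) :
    (P.K q).Nonempty := by
  by_contra hq
  have h1 := h.orthonormal q 0 0
  rw [not_nonempty_iff_eq_empty.1 hq |> fun h => show P.si q (phi q 0) (phi q 0) = 0 by
    simp [si, wForm, h]] at h1
  simp at h1

theorem IsEigensystem.nonempty_T (h : P.IsEigensystem lam phi) (q : Fin P.Nc) :
    (P.T q).Nonempty := (h.nonempty_K q).mono (P.K_subset_T q)

/-- The coefficient of the eigenfunction `phi q j`. -/
def IsEigensystem.coeff (h : P.IsEigensystem lam phi) (q : Fin P.Nc) (j : ℕ) :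
    P.spaceV →ₗ[ℝ] ℝ where
  toFun v := P.si q v (phi q j)
  map_add' u v := si_add_left q (u.2.memH1_K q).1 (v.2.memH1_K q).1 (h.memH1 q j).1
  map_smul' c v := si_smul_left q c v (phi q j)

/-- The forms of the multiscale method satisfy the assumptions of the abstract error analysis. -/
def IsEigensystem.cellForms (h : P.IsEigensystem lam phi) (hd3 : d ≤ 3) {cπ cP : ℝ} (hcπ : 0 < cπ)
    (hC : P.Cpi phi l ≤ ENNReal.ofReal cπ) (hl : ∀ i, 0 < lam i (l i))
    (hP : P.IsPoincareConst cP) : CellForms (Fin P.Nc) P.spaceV l where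
  a := P.formA
  s q v := P.si q v v
  c q j := h.coeff q j
  lam q j := lam q j
  gap q := lam q (l q)
  layer := P.layer
  Y := P.mulOuter
  V0 := P.spaceV0
  κ := 16 * (cπ * (1 + 2 * √8 * cπ)) ^ 2
  κ_nonneg := by positivity
  gap_pos := hl
  a_symm q u v := aForm_symm _ _ _
  a_nonneg q v := aForm_self_nonneg _ _
  bessel q v := by
    have := h.bessel q (v.2.memH1_K q).1 (l q)
    rwa [Finset.sum_range] at this
  spectral q v := by
    have := h.spectral q (v.2.memH1_K q) (hl q)
    rwa [Finset.sum_range] at this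
  energy q v := by
    have := h.energy q (v.2.memH1_K q) (l q)
    rwa [Finset.sum_range] at this
  self_mem := P.self_mem_layer h.nonempty_T
  layer_mono := P.layer_subset_succ h.nonempty_T
  Y_a_inside i m v w q hq := aForm_eq_zero (P.isOpen_K q) ((P.mulOuter i m v).2.memH1_K q)
    (P.mulOuter_inside hq v) (w.2.memH1_K q)
  Y_c_inside i m v q hq j := P.si_eq_zero (P.mulOuter_inside hq v)
  Y_a_outside i m v w q hq := aForm_congr (P.isOpen_K q) ((P.mulOuter i m v).2.memH1_K q)
    (P.mulOuter_outside hq v) (w.2.memH1_K q)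
  Y_c_outside i m v q hq j := wForm_congr_left (P.mulOuter_outside hq v) _
  Y_a_le i m v q := by
    have := aForm_mul_le (P.exists_lipschitz_outer i m).choose_spec
      (fun x => (P.outer_mem i m x).1) (fun x => (P.outer_mem i m x).2)
      (by simpa only [P.gradient_outer] using P.norm_gradient_cut_sq_le hd3 (P.patchVerts i m) q)
      (v.2.memH1_K q)
    simp only [formA_apply, mulOuter_apply]
    linarith
  X_a_le i m v q := by
    have := aForm_mul_le (P.exists_lipschitz_cut (P.patchVerts i m)).choose_spec
      (fun x => (P.cut_mem _ x).1) (fun x => (P.cut_mem _ x).2)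
      (P.norm_gradient_cut_sq_le hd3 (P.patchVerts i m) q) (v.2.memH1_K q)
    simp only [formA_apply, sub_mulOuter]
    linarith
  Y_s_le i m v q := si_mul_le (fun x => (P.outer_mem i m x).1) (fun x => (P.outer_mem i m x).2)
    (v.2.memH1_K q).1
  X_s_le i m v q := by
    rw [sub_mulOuter]
    exact si_mul_le (fun x => (P.cut_mem _ x).1) (fun x => (P.cut_mem _ x).2) (v.2.memH1_K q).1
  Y_flux i m v q := aForm_mul_flux (by norm_num) (P.exists_lipschitz_outer i m).choose_spec
    (fun x => (P.outer_mem i m x).1) (fun x => (P.outer_mem i m x).2)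
    (by simpa only [P.gradient_outer] using P.norm_gradient_cut_sq_le hd3 (P.patchVerts i m) q)
    (v.2.memH1_K q)
  X_mem i m v := by
    show ∀ᵐ x ∂(volume.restrict (P.Ωε \ P.patch i (m + 1))),
      ((v - P.mulOuter i m v : P.spaceV) : Sp d → ℝ) x = 0
    have h1 : ∀ᵐ x ∂(volume.restrict (P.Ωε \ P.patch i (m + 1))), x ∉ P.patch i (m + 1) := by
      have hm : MeasurableSet (P.Ωε \ P.patch i (m + 1)) := P.isOpen_Ωε.measurableSet.diff
        (isOpen_biUnion fun q _ => P.isOpen_K q).measurableSet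
      filter_upwards [ae_restrict_mem hm] with x hx using hx.2
    filter_upwards [h1, ae_restrict_of_ae_restrict_of_subset sdiff_subset P.ae_mem_K] with x hx hq
    obtain ⟨q, hq⟩ := hq
    have hql : q ∉ P.layer i (m + 1) := fun hql => hx (mem_iUnion₂.2 ⟨q, hql, hq⟩)
    have := P.outer_eq_one hql hq
    simp only [outer, sub_eq_self] at this
    simp only [sub_mulOuter, this, zero_mul]
  V0_a i m v hv q hq w := aForm_eq_zero (P.isOpen_K q) (v.2.memH1_K q)
    (ae_restrict_of_ae_restrict_of_subset (P.K_subset_compl_patch hq) hv) (w.2.memH1_K q)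
  V0_c i m v hv q hq j := P.si_eq_zero
    (ae_restrict_of_ae_restrict_of_subset (P.K_subset_compl_patch hq) hv)
  lift q x := by
    obtain ⟨w, hw, h0, hx, hle⟩ := h.exists_lift hd3 hcπ hC q x
    have h1 : ∀ r, r ≠ q → ∀ᵐ x ∂(volume.restrict (P.K r)), w x = 0 := fun r hr => by
      filter_upwards [ae_restrict_mem (P.isOpen_K r).measurableSet] with x hx
      exact h0 x fun hq => (P.K_disjoint hr).ne_of_mem hx hq rfl
    exact ⟨⟨w, hw⟩, fun r hr v => aForm_eq_zero (P.isOpen_K r) (hw.memH1_K r) (h1 r hr)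
      (v.2.memH1_K r), fun r hr j => P.si_eq_zero (h1 r hr), hx, hle⟩
  -- Zero energy forces v = 0 almost everywhere by the Poincaré inequality.
  definite v hv q j := by
    have h1 := hP v v.2
    have h2 : aForm P.Ωε v v = 0 := by
      rw [aForm_eq_sum v.2.memH1 v.2.memH1]; exact hv
    have h3 : ∫ x in P.Ωε, (v : Sp d → ℝ) x ^ 2 = 0 := by
      rw [aNorm, h2, Real.sqrt_zero, mul_zero, l2Norm] at h1
      have h4 : 0 ≤ ∫ x in P.Ωε, (v : Sp d → ℝ) x ^ 2 := integral_nonneg fun x => sq_nonneg _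
      exact (Real.sqrt_eq_zero h4).1 (le_antisymm h1 (Real.sqrt_nonneg _))
    rw [integral_eq_zero_iff_of_nonneg (fun x => sq_nonneg _) v.2.memH1.1.integrable_sq] at h3
    refine P.si_eq_zero (ae_restrict_of_ae_restrict_of_subset (P.K_subset_Ωε q) ?_)
    filter_upwards [h3] with x hx
    exact pow_eq_zero_iff (two_ne_zero) |>.1 hx

end Forms

end Discretization
end CEM

/-! ### Variational characterizations -/

namespace CEM
open Filter Topology

/-- The Euler–Lagrange equation of a quadratic minimization problem. -/
theorem bilin_eq_of_isMin {V : Type*} [AddCommGroup V] [Module ℝ V] {B : LinearMap.BilinForm ℝ V}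
    (hB : ∀ u v, B u v = B v u) (h0 : ∀ v, 0 ≤ B v v) (c : V →ₗ[ℝ] ℝ) {W : Submodule ℝ V} {ψ : V}
    (hψ : ψ ∈ W) (hmin : ∀ w ∈ W, B ψ ψ - 2 * c ψ ≤ B w w - 2 * c w) {v : V} (hv : v ∈ W) :
    B ψ v = c v := by
  set b := B ψ v - c v with hb
  have key : ∀ t : ℝ, 0 ≤ t ^ 2 * B v v + 2 * t * b := fun t => by
    have := hmin (ψ + t • v) (W.add_mem hψ (W.smul_mem t hv))
    simp only [map_add, map_smul, LinearMap.add_apply, LinearMap.smul_apply, smul_eq_mul,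
      hB v ψ] at this
    rw [hb]; linarith
  have ha := h0 v
  -- This is nearly the minimizer -b / B(v, v); the added 1 avoids a separate case B(v, v) = 0.
  have h1 := key (-b / (B v v + 1))
  have h2 : (-b / (B v v + 1)) ^ 2 * B v v + 2 * (-b / (B v v + 1)) * b =
      -(b ^ 2 * (B v v + 2) / (B v v + 1) ^ 2) := by field_simp; ring
  rw [h2] at h1
  have h3 : b ^ 2 = 0 := by
    by_contra hne
    have : 0 < b ^ 2 := lt_of_le_of_ne (sq_nonneg b) (Ne.symm hne)
    have : 0 < b ^ 2 * (B v v + 2) / (B v v + 1) ^ 2 := by positivity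
    linarith
  have := pow_eq_zero_iff (two_ne_zero) |>.1 h3
  linarith

namespace Discretization

variable {d : ℕ} {P : Discretization d} {lam : Fin P.Nc → ℕ → ℝ} {phi : Fin P.Nc → ℕ → Sp d → ℝ}
  {l : Fin P.Nc → ℕ}

theorem memLp_indicator_K (i : Fin P.Nc) {f : Sp d → ℝ} (hf : MemLp f 2 (volume.restrict (P.K i))) :
    MemLp (indicator (P.K i) f) 2 (volume.restrict P.Ωε) := by
  rw [memLp_indicator_iff_restrict (P.isOpen_K i).measurableSet,
    Measure.restrict_restrict (P.isOpen_K i).measurableSet,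
    inter_eq_left.2 (P.K_subset_Ωε i)]
  exact hf

theorem indicator_K_eq_zero {i q : Fin P.Nc} (h : i ≠ q) {x : Sp d} (hx : x ∈ P.K q)
    (f : Sp d → ℝ) : indicator (P.K i) f x = 0 :=
  indicator_of_notMem (fun hi => (P.K_disjoint h).ne_of_mem hi hx rfl) f

theorem IsEigensystem.memLp_proj (h : P.IsEigensystem lam phi) (v : Sp d → ℝ) :
    MemLp (P.proj phi l v) 2 (volume.restrict P.Ωε) := by
  unfold proj
  exact memLp_finsetSum' _ fun i _ => memLp_finsetSum' _ fun j _ =>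
    (memLp_indicator_K i (h.memH1 i j).1).const_smul _

theorem IsEigensystem.proj_apply (h : P.IsEigensystem lam phi) (v : Sp d → ℝ) {q : Fin P.Nc}
    {x : Sp d} (hx : x ∈ P.K q) :
    P.proj phi l v x = ∑ b : Fin (l q), P.si q v (phi q b) * phi q b x := by
  unfold proj
  rw [Finset.sum_apply, Finset.sum_eq_single q, Finset.sum_apply, Finset.sum_range]
  · refine Finset.sum_congr rfl fun b _ => ?_
    rw [Pi.smul_apply, indicator_of_mem hx, h.orthonormal, if_pos rfl, div_one, smul_eq_mul]
  · intro i _ hi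
    rw [Finset.sum_apply]
    exact Finset.sum_eq_zero fun j _ => by
      rw [Pi.smul_apply, indicator_K_eq_zero hi hx, smul_zero]
  · exact fun h => absurd (Finset.mem_univ q) h

section Global

variable (h : P.IsEigensystem lam phi) (hd3 : d ≤ 3) {cπ cP : ℝ} (hcπ : 0 < cπ)
    (hC : P.Cpi phi l ≤ ENNReal.ofReal cπ) (hl : ∀ i, 0 < lam i (l i))
    (hP : P.IsPoincareConst cP)

/-- On each cell π v - φ_j^i has the orthonormal coefficients of v, lowered by one at position (i,
j). The cost is therefore ip(v, v) - 2 c_ij(v) + 1, whose Euler–Lagrange equation is the Riesz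
identity. -/
theorem s_proj_sub_eq (h : P.IsEigensystem lam phi) (i : Fin P.Nc) (j : Fin (l i)) (v : Sp d → ℝ) :
    P.s (P.proj phi l v - indicator (P.K i) (phi i j))
      (P.proj phi l v - indicator (P.K i) (phi i j)) =
      ∑ q, ∑ b : Fin (l q), P.si q v (phi q b) ^ 2 - 2 * P.si i v (phi i j) + 1 := by
  have hm : MemLp (P.proj phi l v - indicator (P.K i) (phi i j)) 2 (volume.restrict P.Ωε) :=
    (h.memLp_proj v).sub (memLp_indicator_K i (h.memH1 i j).1)
  rw [s_eq_sum hm hm]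
  have key : ∀ q, P.si q (P.proj phi l v - indicator (P.K i) (phi i j))
      (P.proj phi l v - indicator (P.K i) (phi i j)) =
      ∑ b : Fin (l q), P.si q v (phi q b) ^ 2 +
        if q = i then - 2 * P.si i v (phi i j) + 1 else 0 := by
    intro q
    rcases eq_or_ne q i with rfl | hq
    · have e : ∀ᵐ x ∂(volume.restrict (P.K q)),
          (P.proj phi l v - indicator (P.K q) (phi q j)) x =
          (∑ b : Fin (l q), (P.si q v (phi q b) - if b = j then 1 else 0) • phi q b) x := by
        filter_upwards [ae_restrict_mem (P.isOpen_K q).measurableSet] with x hx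
        rw [Pi.sub_apply, h.proj_apply v hx, indicator_of_mem hx, Finset.sum_apply]
        simp [sub_mul]
      unfold si
      rw [wForm_congr_left e, wForm_symm, wForm_congr_left e]
      refine (h.si_sum_fin_self q _).trans ?_
      rw [if_pos rfl]
      simp only [sub_sq, Finset.sum_add_distrib, Finset.sum_sub_distrib]
      simp [si]
      ring
    · have e : ∀ᵐ x ∂(volume.restrict (P.K q)),
          (P.proj phi l v - indicator (P.K i) (phi i j)) x =
          (∑ b : Fin (l q), (P.si q v (phi q b)) • phi q b) x := by
        filter_upwards [ae_restrict_mem (P.isOpen_K q).measurableSet] with x hx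
        rw [Pi.sub_apply, h.proj_apply v hx, indicator_K_eq_zero hq.symm hx, Finset.sum_apply]
        simp
      unfold si
      rw [wForm_congr_left e, wForm_symm, wForm_congr_left e]
      refine (h.si_sum_fin_self q _).trans ?_
      rw [if_neg hq]
      simp [si]
  simp only [key, Finset.sum_add_distrib, Finset.sum_ite_eq', Finset.mem_univ, if_true]
  ring

theorem aForm_eq_sum_cellForms (u v : P.spaceV) : aForm P.Ωε u v =
    ∑ q, (h.cellForms hd3 hcπ hC hl hP).a q u v := aForm_eq_sum u.2.memH1 v.2.memH1

theorem cost_eq (i : Fin P.Nc) (j : Fin (l i)) (v : P.spaceV) :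
    P.cost phi l i j v = (h.cellForms hd3 hcπ hC hl hP).ip v v -
      2 * (h.cellForms hd3 hcπ hC hl hP).c i j v + 1 := by
  unfold cost
  rw [s_proj_sub_eq h, aForm_eq_sum_cellForms h hd3 hcπ hC hl hP, CellForms.ip_apply]
  simp only [CellForms.e_self, Finset.sum_add_distrib]
  show _ + (_ - _ + 1) = _
  rw [← add_assoc, ← add_sub_assoc]
  rfl

theorem IsGlobalBasis.ip_eq {i : Fin P.Nc} {j : Fin (l i)} {ψ : Sp d → ℝ}
    (hψ : P.IsGlobalBasis phi l i j ψ) (v : P.spaceV) :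
    (h.cellForms hd3 hcπ hC hl hP).ip ⟨ψ, hψ.1⟩ v = (h.cellForms hd3 hcπ hC hl hP).c i j v := by
  refine bilin_eq_of_isMin (W := ⊤) (CellForms.ip_symm _) (CellForms.ip_nonneg _) _
    Submodule.mem_top (fun w _ => ?_) Submodule.mem_top
  have h1 := hψ.2 w w.2
  rw [cost_eq h hd3 hcπ hC hl hP i j w] at h1
  have h2 := cost_eq h hd3 hcπ hC hl hP i j ⟨ψ, hψ.1⟩
  simp only at h2
  linarith

theorem IsLocalBasis.ip_eq {i : Fin P.Nc} {m : ℕ} {j : Fin (l i)} {ψ : Sp d → ℝ}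
    (hψ : P.IsLocalBasis phi l i m j ψ) {v : P.spaceV} (hv : v ∈ P.spaceV0 i m) :
    (h.cellForms hd3 hcπ hC hl hP).ip ⟨ψ, hψ.1.1⟩ v = (h.cellForms hd3 hcπ hC hl hP).c i j v := by
  refine bilin_eq_of_isMin (W := P.spaceV0 i m) (CellForms.ip_symm _) (CellForms.ip_nonneg _) _
    hψ.1.2 (fun w hw => ?_) hv
  have h1 := hψ.2 w ⟨w.2, hw⟩
  rw [cost_eq h hd3 hcπ hC hl hP i j w] at h1
  have h2 := cost_eq h hd3 hcπ hC hl hP i j ⟨ψ, hψ.1.1⟩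
  simp only at h2
  linarith

end Global

theorem mem_basisSpan_iff {ψ : (i : Fin P.Nc) → Fin (l i) → Sp d → ℝ} {u : Sp d → ℝ} :
    u ∈ P.basisSpan l ψ ↔ ∃ g : (i : Fin P.Nc) → Fin (l i) → ℝ,
      ∑ i, ∑ j, g i j • ψ i j = u := by
  have : {g | ∃ i j, g = ψ i j} = range fun t : Σ i, Fin (l i) => ψ t.1 t.2 := by
    ext g
    constructor
    · rintro ⟨i, j, rfl⟩; exact ⟨⟨i, j⟩, rfl⟩
    · rintro ⟨t, rfl⟩; exact ⟨t.1, t.2, rfl⟩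
  rw [basisSpan, this, Submodule.mem_span_range_iff_exists_fun]
  constructor
  · rintro ⟨c, rfl⟩
    exact ⟨fun i j => c ⟨i, j⟩, (Fintype.sum_sigma fun t : Σ i, Fin (l i) => c t • ψ t.1 t.2).symm⟩
  · rintro ⟨g, rfl⟩
    exact ⟨fun t => g t.1 t.2, Fintype.sum_sigma _⟩

theorem basisSpan_le {ψ : (i : Fin P.Nc) → Fin (l i) → Sp d → ℝ} (h : ∀ i j, P.MemV (ψ i j)) :
    P.basisSpan l ψ ≤ P.spaceV :=
  Submodule.span_le.2 fun _ ⟨i, j, hg⟩ => hg ▸ h i j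

/-- The energy form on `V`. -/
def formV (P : Discretization d) : LinearMap.BilinForm ℝ P.spaceV := ∑ i, P.formA i

theorem formV_apply (u v : P.spaceV) : P.formV u v = aForm P.Ωε u v := by
  rw [aForm_eq_sum u.2.memH1 v.2.memH1]
  simp [formV, LinearMap.sum_apply, formA_apply]

theorem aNorm_eq (u : P.spaceV) : aNorm P.Ωε u = √(P.formV u u) := by
  rw [aNorm, formV_apply]

theorem formV_symm (u v : P.spaceV) : P.formV u v = P.formV v u := by
  rw [formV_apply, formV_apply, aForm_symm]

theorem formV_nonneg (u : P.spaceV) : 0 ≤ P.formV u u := by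
  rw [formV_apply]; exact aForm_self_nonneg _ _

theorem aNorm_add_le (u v : P.spaceV) :
    aNorm P.Ωε (u + v : P.spaceV) ≤ aNorm P.Ωε u + aNorm P.Ωε v := by
  rw [aNorm_eq, aNorm_eq, aNorm_eq]
  refine Real.sqrt_le_iff.2 ⟨by positivity, ?_⟩
  have h1 := (abs_le.1 (CellForms.abs_le_sqrt_mul_sqrt formV_symm formV_nonneg u v)).2
  rw [add_sq, Real.sq_sqrt (formV_nonneg u), Real.sq_sqrt (formV_nonneg v)]
  simp only [map_add, LinearMap.add_apply, formV_symm v u]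
  linarith

/-- Quasi-optimality of the Galerkin solution. -/
theorem IsGalerkin.aNorm_sub_le {W : Submodule ℝ (Sp d → ℝ)} (hW : W ≤ P.spaceV)
    {f u w : Sp d → ℝ} (hu : P.IsWeakSolution f u) (hw : P.IsGalerkin W f w) {v : Sp d → ℝ}
    (hv : v ∈ W) : aNorm P.Ωε (u - w) ≤ aNorm P.Ωε (u - v) := by
  let U : P.spaceV := ⟨u, hu.1⟩
  let X : P.spaceV := ⟨w, hW hw.1⟩
  let Y : P.spaceV := ⟨v, hW hv⟩
  show aNorm P.Ωε (U - X : P.spaceV) ≤ aNorm P.Ωε (U - Y : P.spaceV)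
  rw [aNorm_eq, aNorm_eq]
  apply Real.sqrt_le_sqrt
  have orth : P.formV (U - X) (X - Y) = 0 := by
    rw [map_sub P.formV, LinearMap.sub_apply, formV_apply, formV_apply]
    have hm : w - v ∈ W := W.sub_mem hw.1 hv
    have h1 := hu.2 (w - v) (hW hm)
    have h2 := hw.2 (w - v) hm
    exact sub_eq_zero.2 (h1.trans h2.symm)
  have e : U - Y = (U - X) + (X - Y) := by abel
  have h1 := formV_nonneg (X - Y)
  rw [e]
  simp only [map_add (P.formV), LinearMap.add_apply, map_add (P.formV _), orth,
    formV_symm (X - Y) (U - X)]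
  linarith

end Discretization
end CEM

/-! ### Error of the global and of the localized method -/

namespace CEM
open Filter Topology

namespace Discretization

variable {d : ℕ} {P : Discretization d} {lam : Fin P.Nc → ℕ → ℝ} {phi : Fin P.Nc → ℕ → Sp d → ℝ}
  {l : Fin P.Nc → ℕ}

theorem finite_cell_values (p : Fin P.Nc → Prop) (f : Fin P.Nc → ℝ) :
    {t | ∃ i, p i ∧ t = f i}.Finite :=
  (Set.finite_range f).subset fun _ ⟨i, _, ht⟩ => ⟨i, ht.symm⟩

theorem Lam_le {S : Set (Sp d)} {i : Fin P.Nc} (hi : (P.K i ∩ S).Nonempty) :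
    P.Lam lam l S ≤ lam i (l i) :=
  csInf_le (finite_cell_values _ _).bddBelow ⟨i, hi, rfl⟩

theorem Lam_pos (hl : ∀ i, 0 < lam i (l i)) {S : Set (Sp d)} {i : Fin P.Nc}
    (hi : (P.K i ∩ S).Nonempty) : 0 < P.Lam lam l S := by
  have hne : {t | ∃ i, (P.K i ∩ S).Nonempty ∧ t = lam i (l i)}.Nonempty := ⟨_, i, hi, rfl⟩
  obtain ⟨j, _, hj⟩ := hne.csInf_mem (finite_cell_values (fun i => (P.K i ∩ S).Nonempty)
    fun i => lam i (l i))
  unfold Lam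
  rw [hj]; exact hl j

theorem Lam_nonneg (hl : ∀ i, 0 < lam i (l i)) (S : Set (Sp d)) : 0 ≤ P.Lam lam l S :=
  Real.sInf_nonneg fun _ ⟨i, _, ht⟩ => ht ▸ (hl i).le

theorem inv_gap_le (hl : ∀ i, 0 < lam i (l i)) {S : Set (Sp d)} {i : Fin P.Nc}
    (hi : (P.K i ∩ S).Nonempty) : (lam i (l i))⁻¹ ≤ (P.Lam lam l S)⁻¹ :=
  inv_anti₀ (Lam_pos hl hi) (Lam_le hi)

/-- If no element meets S, the real infimum is 0 with inverse 0, so the statement about inverses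
survives where one about Λ itself would fail. -/
theorem Lam_anti (hl : ∀ i, 0 < lam i (l i)) {S S' : Set (Sp d)} (hS : S ⊆ S') :
    (P.Lam lam l S)⁻¹ ≤ (P.Lam lam l S')⁻¹ := by
  by_cases h : ∃ i, (P.K i ∩ S).Nonempty
  · obtain ⟨i, hi⟩ := h
    refine inv_anti₀ (Lam_pos hl (hi.mono (inter_subset_inter_right _ hS)))
      (le_csInf ⟨_, i, hi, rfl⟩ ?_)
    rintro t ⟨j, hj, rfl⟩
    exact Lam_le (hj.mono (inter_subset_inter_right _ hS))
  · have : P.Lam lam l S = 0 := by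
      have : {t | ∃ i, (P.K i ∩ S).Nonempty ∧ t = lam i (l i)} = ∅ :=
        eq_empty_of_forall_notMem fun t ⟨i, hi, _⟩ => h ⟨i, hi⟩
      rw [Lam, this, Real.sInf_empty]
    rw [this, inv_zero]
    exact inv_nonneg.2 (Lam_nonneg hl S')

theorem rpow_neg_half {x : ℝ} (hx : 0 ≤ x) : x ^ (-(1 / 2) : ℝ) = √(x⁻¹) := by
  rw [Real.rpow_neg hx, ← Real.sqrt_eq_rpow, Real.sqrt_inv]

theorem Gam_nonneg (h : P.IsEigensystem lam phi) (S : Set (Sp d)) : 0 ≤ P.Gam lam l S :=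
  Real.sSup_nonneg fun _ ⟨i, _, ht⟩ => ht ▸ h.lam_nonneg i _

theorem le_Gam {S : Set (Sp d)} {i : Fin P.Nc} (hi : (P.K i ∩ S).Nonempty) :
    lam i (l i - 1) ≤ P.Gam lam l S :=
  le_csSup (finite_cell_values _ _).bddAbove ⟨i, hi, rfl⟩

theorem IsEigensystem.K_inter_nonempty (h : P.IsEigensystem lam phi) (q : Fin P.Nc) :
    (P.K q ∩ P.Ωε).Nonempty := by
  rw [inter_eq_left.2 (P.K_subset_Ωε q)]; exact h.nonempty_K q

theorem Ei_nonneg (hl : ∀ i, 0 < lam i (l i)) (k : Fin P.Nc → ℕ) (i : Fin P.Nc) :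
    0 ≤ P.Ei lam l k i := by
  unfold Ei
  have h1 := inv_nonneg.2 (Lam_nonneg (P := P) hl (P.Ωε \ P.patch i (k i - 1)))
  have h2 := Real.rpow_nonneg (Lam_nonneg (P := P) hl (P.patch i (k i - 1))) (-(1 / 2))
  positivity

theorem Emax_nonneg (hl : ∀ i, 0 < lam i (l i)) (k : Fin P.Nc → ℕ) : 0 ≤ P.Emax lam l k :=
  Real.iSup_nonneg fun i => Ei_nonneg hl k i

theorem Ei_le_Emax (lam : Fin P.Nc → ℕ → ℝ) (l k : Fin P.Nc → ℕ) (i : Fin P.Nc) :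
    P.Ei lam l k i ≤ P.Emax lam l k :=
  le_ciSup (Set.finite_range _).bddAbove i

/-- The constant in the energy bound for lifting coefficients to cell functions. -/
def liftConst (c : ℝ) : ℝ := 16 * (c * (1 + 2 * √8 * c)) ^ 2

theorem liftConst_nonneg (c : ℝ) : 0 ≤ liftConst c := by unfold liftConst; positivity

/-- The error of the global multiscale method. -/
theorem aNorm_sub_global_le (h : P.IsEigensystem lam phi) (hd3 : d ≤ 3) {cπ cP : ℝ} (hcπ : 0 < cπ)
    (hC : P.Cpi phi l ≤ ENNReal.ofReal cπ) (hl : ∀ i, 0 < lam i (l i))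
    (hP : P.IsPoincareConst cP) {psi : (i : Fin P.Nc) → Fin (l i) → Sp d → ℝ}
    (hpsi : ∀ i (j : Fin (l i)), P.IsGlobalBasis phi l i j (psi i j)) {f u uGlo : Sp d → ℝ}
    (hf : MemLp (fun x => P.kt x ^ (-(1 / 2) : ℝ) * f x) 2 (volume.restrict P.Ωε))
    (hu : P.IsWeakSolution f u) (hg : P.IsGalerkin (P.basisSpan l psi) f uGlo) :
    aNorm P.Ωε (u - uGlo) ≤ √((P.Lam lam l P.Ωε)⁻¹) *
      l2Norm P.Ωε (fun x => P.kt x ^ (-(1 / 2) : ℝ) * f x) := by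
  have hsub := basisSpan_le fun i j => (hpsi i j).1
  let F := h.cellForms hd3 hcπ hC hl hP
  let W : P.spaceV := ⟨u - uGlo, P.spaceV.sub_mem hu.1 (hsub hg.1)⟩
  have horth : ∀ v ∈ P.basisSpan l psi, aForm P.Ωε v (u - uGlo) = 0 := by
    intro v hv
    have h1 := hu.2 v (hsub hv)
    have h2 := hg.2 v hv
    let U : P.spaceV := ⟨u, hu.1⟩
    let G : P.spaceV := ⟨uGlo, hsub hg.1⟩
    let V : P.spaceV := ⟨v, hsub hv⟩
    have : P.formV (U - G) V = P.formV U V - P.formV G V := by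
      rw [map_sub P.formV, LinearMap.sub_apply]
    rw [aForm_symm]
    refine (formV_apply (U - G) V).symm.trans (this.trans ?_)
    rw [formV_apply, formV_apply]
    exact sub_eq_zero.2 (h1.trans h2.symm)
  -- The residual has zero auxiliary projection, so on every cell only the energy term of `spectral`
  -- remains.
  have hc : ∀ q (j : Fin (l q)), F.c q j W = 0 :=
    F.c_eq_zero_of_orthogonal (psi := fun i j => ⟨psi i j, (hpsi i j).1⟩)
      (fun i j v => (hpsi i j).ip_eq h hd3 hcπ hC hl hP v) fun i j => by
        rw [← aForm_eq_sum_cellForms h hd3 hcπ hC hl hP]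
        exact horth _ (Submodule.subset_span ⟨i, j, rfl⟩)
  set L := (P.Lam lam l P.Ωε)⁻¹ with hL
  have hL0 : 0 ≤ L := inv_nonneg.2 (Lam_nonneg hl _)
  have hs : P.s W W ≤ L * aForm P.Ωε W W := by
    rw [s_eq_sum W.2.memH1.1 W.2.memH1.1, aForm_eq_sum W.2.memH1 W.2.memH1, Finset.mul_sum]
    refine Finset.sum_le_sum fun q _ => ?_
    have h1 := F.spectral q W
    simp only [hc] at h1
    refine h1.trans ?_
    have h2 := inv_gap_le (P := P) hl (h.K_inter_nonempty q)
    rw [zero_pow two_ne_zero, Finset.sum_const_zero, zero_add]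
    exact mul_le_mul_of_nonneg_right h2 (aForm_self_nonneg (P.K q) W)
  set z := fun x => P.kt x ^ (-(1 / 2) : ℝ) * f x with hz
  -- As a(u_glo, W) = 0, the energy of W equals (f, W); the weight is then split as κ̃^{-1/2}
  -- κ̃^{1/2}.
  have ha : aForm P.Ωε W W ≤ l2Norm P.Ωε z * √(P.s W W) := by
    have e1 : aForm P.Ωε W W = ∫ x in P.Ωε, f x * (W : Sp d → ℝ) x := by
      rw [← hu.2 W W.2]
      let U : P.spaceV := ⟨u, hu.1⟩
      let G : P.spaceV := ⟨uGlo, hsub hg.1⟩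
      have : P.formV (U - G) W = P.formV U W - P.formV G W := by
        rw [map_sub P.formV, LinearMap.sub_apply]
      refine (formV_apply (U - G) W).symm.trans (this.trans ?_)
      rw [formV_apply, formV_apply]
      have h0 : aForm P.Ωε G W = 0 := horth _ hg.1
      rw [h0, sub_zero]
    have hWm := memLp_sqrt_kt (P := P) W.2.memH1.1
    have e2 : ∫ x in P.Ωε, f x * (W : Sp d → ℝ) x =
        ∫ x in P.Ωε, z x * (√(P.kt x) * (W : Sp d → ℝ) x) := by
      refine integral_congr_ae ?_
      filter_upwards [P.χ_weight] with x hx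
      have hx' : 0 < P.kt x := hx
      have h3 := (Real.sqrt_pos.2 hx').ne'
      simp only [hz]
      rw [rpow_neg_half hx'.le, Real.sqrt_inv]
      field_simp
    have e3 : P.s W W = ∫ x in P.Ωε, (√(P.kt x) * (W : Sp d → ℝ) x) ^ 2 := by
      unfold s wForm
      congr 1; ext x
      rw [mul_pow, Real.sq_sqrt (P.kt_nonneg x)]; ring
    rw [e1, e2, e3]
    refine le_trans ?_ (abs_integral_mul_le hf hWm)
    refine integral_mono (hf.integrable_mul hWm) (hf.norm.integrable_mul hWm.norm) fun x => ?_
    show _ ≤ |_| * |_|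
    rw [← abs_mul]; exact le_abs_self _
  have hA0 := aForm_self_nonneg P.Ωε W
  have hz0 : 0 ≤ l2Norm P.Ωε z := Real.sqrt_nonneg _
  have h4 : aForm P.Ωε W W ≤ (√L * l2Norm P.Ωε z) * √(aForm P.Ωε W W) := by
    refine ha.trans ?_
    calc _ ≤ l2Norm P.Ωε z * √(L * aForm P.Ωε W W) := by gcongr
      _ = _ := by rw [Real.sqrt_mul hL0]; ring
  show √(aForm P.Ωε W W) ≤ _
  by_contra hcon
  push Not at hcon
  have h5 := Real.mul_self_sqrt hA0
  have h6 : 0 ≤ √L * l2Norm P.Ωε z := by positivity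
  nlinarith

/-- The error of the multiscale method in the energy norm. -/
theorem aNorm_sub_multiscale_le (h : P.IsEigensystem lam phi) (hd3 : d ≤ 3) {cπ cP : ℝ}
    (hcπ : 0 < cπ) (hC : P.Cpi phi l ≤ ENNReal.ofReal cπ) (hl : ∀ i, 0 < lam i (l i))
    (hP : P.IsPoincareConst cP) {k : Fin P.Nc → ℕ} (hk : ∀ i, 2 ≤ k i)
    {psi psiMs : (i : Fin P.Nc) → Fin (l i) → Sp d → ℝ}
    (hpsi : ∀ i (j : Fin (l i)), P.IsGlobalBasis phi l i j (psi i j))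
    (hpsiMs : ∀ i (j : Fin (l i)), P.IsLocalBasis phi l i (k i) j (psiMs i j))
    {f u uGlo uMs : Sp d → ℝ}
    (hf : MemLp (fun x => P.kt x ^ (-(1 / 2) : ℝ) * f x) 2 (volume.restrict P.Ωε))
    (hu : P.IsWeakSolution f u) (hg : P.IsGalerkin (P.basisSpan l psi) f uGlo)
    (hm : P.IsGalerkin (P.basisSpan l psiMs) f uMs) {N : ℕ}
    (hN : ∀ q, {i | q ∈ P.layer i (k i + 1)}.ncard ≤ N) :
    aNorm P.Ωε (u - uMs) ≤ √((P.Lam lam l P.Ωε)⁻¹) *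
        l2Norm P.Ωε (fun x => P.kt x ^ (-(1 / 2) : ℝ) * f x) +
      √(49 * (1 + (P.Lam lam l P.Ωε)⁻¹) * N * P.Emax lam l k * (liftConst cπ + 1) *
        (1 + liftConst cπ * (1 + P.Gam lam l P.Ωε))) * P.sNorm uGlo := by
  have hsub := basisSpan_le fun i j => (hpsi i j).1
  have hsubMs := basisSpan_le fun i j => (hpsiMs i j).1.1
  obtain ⟨g, hgx⟩ := mem_basisSpan_iff.1 hg.1
  let F := h.cellForms hd3 hcπ hC hl hP
  let pG : (i : Fin P.Nc) → Fin (l i) → P.spaceV := fun i j => ⟨psi i j, (hpsi i j).1⟩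
  let pM : (i : Fin P.Nc) → Fin (l i) → P.spaceV := fun i j => ⟨psiMs i j, (hpsiMs i j).1.1⟩
  -- The competitor in V_ms carries the coefficients of u_glo over to the localized basis.
  let y : P.spaceV := ∑ i, ∑ j, g i j • pM i j
  let U : P.spaceV := ⟨u, hu.1⟩
  let x : P.spaceV := ∑ i, ∑ j, g i j • pG i j
  have hx : (x : Sp d → ℝ) = uGlo := by
    rw [← hgx]; simp [x, pG]
  have hy : (y : Sp d → ℝ) ∈ P.basisSpan l psiMs := by
    refine mem_basisSpan_iff.2 ⟨g, ?_⟩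
    simp [y, pM]
  have h1 := hm.aNorm_sub_le hsubMs hu hy
  have h2 : aNorm P.Ωε (u - y) ≤ aNorm P.Ωε (u - uGlo) + aNorm P.Ωε (x - y : P.spaceV) := by
    have e : (u - y : Sp d → ℝ) = ((U - x) + (x - y) : P.spaceV) := by
      rw [sub_add_sub_cancel]; rfl
    have e2 : (u - uGlo : Sp d → ℝ) = (U - x : P.spaceV) := by rw [← hx]; rfl
    rw [e, e2]
    exact aNorm_add_le _ _
  have h3 := aNorm_sub_global_le h hd3 hcπ hC hl hP hpsi hf hu hg
  have hΛ : ∀ S, 0 ≤ P.Lam lam l S := Lam_nonneg hl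
  have h4 := F.localization_error (k := k) (fun i => one_le_two.trans (hk i)) (psi := pG)
    (psiMs := pM) (fun i j v => (hpsi i j).ip_eq h hd3 hcπ hC hl hP v) (fun i j => (hpsiMs i j).1.2)
    (fun i j v hv => (hpsiMs i j).ip_eq h hd3 hcπ hC hl hP hv)
    (L := (P.Lam lam l P.Ωε)⁻¹) (Γ := P.Gam lam l P.Ωε) (E := P.Emax lam l k) (N := N)
    (Li := fun i => P.Lam lam l (P.patch i (k i - 1)) ^ (-(1 / 2) : ℝ))
    (Lo := fun i => (P.Lam lam l (P.Ωε \ P.patch i (k i - 1)))⁻¹)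
    (fun q => inv_gap_le hl (h.K_inter_nonempty q)) (Gam_nonneg h _)
    (fun q j => (h.mono q (Nat.le_sub_one_of_lt j.2)).trans (le_Gam (h.K_inter_nonempty q)))
    (Emax_nonneg hl k) (fun i => Real.rpow_nonneg (hΛ _) _) (fun i => inv_nonneg.2 (hΛ _))
    (fun i q hq => by
      simp only [rpow_neg_half (hΛ _)]
      rw [Real.sq_sqrt (inv_nonneg.2 (hΛ _))]
      exact inv_gap_le hl ((P.K_inter_patch_nonempty_iff (h.nonempty_K q)).2 hq))
    (fun i q hq => inv_gap_le hl ((P.K_inter_compl_patch_nonempty_iff (h.nonempty_K q)).2 hq))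
    hN
    (fun i => by
      refine le_trans ?_ (Ei_le_Emax lam l k i)
      unfold Ei
      have e : (1 : ℤ) - (k i : ℤ) = -((k i - 1 : ℕ) : ℤ) := by
        have := hk i; push_cast [Nat.cast_sub (one_le_two.trans this)]; ring
      rw [e, zpow_neg, zpow_natCast, inv_pow]
      have h5 := inv_nonneg.2 (hΛ (P.Ωε \ P.patch i (k i - 1)))
      have h6 := Real.rpow_nonneg (hΛ (P.patch i (k i - 1))) (-(1 / 2))
      gcongr
      linarith) g
  have h5 : aNorm P.Ωε (x - y : P.spaceV) ≤
      √(49 * (1 + (P.Lam lam l P.Ωε)⁻¹) * N * P.Emax lam l k * (liftConst cπ + 1) *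
        (1 + liftConst cπ * (1 + P.Gam lam l P.Ωε))) * P.sNorm uGlo := by
    have hL := inv_nonneg.2 (hΛ P.Ωε)
    have hE := Emax_nonneg (P := P) hl k
    have hK := liftConst_nonneg cπ
    have hG := Gam_nonneg (l := l) h P.Ωε
    rw [sNorm, ← Real.sqrt_mul (by positivity), aNorm]
    apply Real.sqrt_le_sqrt
    rw [aForm_eq_sum_cellForms h hd3 hcπ hC hl hP]
    refine h4.trans_eq ?_
    have : ∑ q, F.s q x = P.s uGlo uGlo := by
      rw [← hx, s_eq_sum x.2.memH1.1 x.2.memH1.1]; rfl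
    rw [this]
    show _ * (liftConst cπ + 1) * ((1 + liftConst cπ * _) * _) = _
    ring
  linarith

end Discretization
end CEM

/-! ### Counting of cells and bounds for the weight -/

namespace CEM
open Filter Topology

namespace Discretization

variable {d : ℕ} {P : Discretization d}

theorem isBounded_T (P : Discretization d) (i : Fin P.Nc) : Bornology.IsBounded (P.T i) :=
  P.isBounded_Ω.closure.subset (P.T_subset i)

theorem dist_le_H {i : Fin P.Nc} {x y : Sp d} (hx : x ∈ P.T i) (hy : y ∈ P.T i) :
    dist x y ≤ P.H :=
  (Metric.dist_le_diam_of_mem (P.isBounded_T i) hx hy).trans (P.T_diam i)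

/-- Packing: cells inside a ball are limited in number by comparison of volumes. -/
theorem IsRegular.card_mul_pow_le {σ c : ℝ} (hσ : 0 < σ) (h : P.IsRegular σ c)
    (S : Finset (Fin P.Nc)) (z : Sp d) {ρ : ℝ} (hρ : 0 ≤ ρ)
    (hS : ∀ i ∈ S, P.T i ⊆ Metric.closedBall z ρ) :
    (S.card : ℝ) * (P.H / σ) ^ d ≤ ρ ^ d := by
  have hr : 0 < P.H / σ := div_pos P.H_pos hσ
  choose y hy using h.1
  have hint : ∀ i, Metric.ball (y i) (P.H / σ) ⊆ interior (P.T i) := fun i =>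
    interior_maximal (Metric.ball_subset_closedBall.trans (hy i)) Metric.isOpen_ball
  have h1 : ∑ i ∈ S, volume (Metric.ball (y i) (P.H / σ)) ≤ volume (Metric.closedBall z ρ) := by
    rw [← measure_biUnion_finset]
    · exact measure_mono (iUnion₂_subset fun i hi =>
        ((hint i).trans interior_subset).trans (hS i hi))
    · exact fun i _ j _ hij => (P.T_disjoint i j hij).mono (hint i) (hint j)
    · exact fun i _ => measurableSet_ball
  have hd : Module.finrank ℝ (Sp d) = d := finrank_euclideanSpace_fin
  have hb : ∀ i, volume (Metric.ball (y i) (P.H / σ)) =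
      ENNReal.ofReal ((P.H / σ) ^ d) * volume (Metric.ball (0 : Sp d) 1) := fun i => by
    rw [Measure.addHaar_ball_of_pos _ _ hr, hd]
  simp only [hb, Measure.addHaar_closedBall _ _ hρ,
    Finset.sum_const, nsmul_eq_mul, hd] at h1
  rw [← mul_assoc, ENNReal.mul_le_mul_iff_left (Metric.measure_ball_pos _ _ one_pos).ne'
    measure_ball_lt_top.ne, ← ENNReal.ofReal_natCast, ← ENNReal.ofReal_mul (Nat.cast_nonneg _),
    ENNReal.ofReal_le_ofReal_iff (by positivity)] at h1
  exact h1

theorem dist_le_of_mem_layer {i : Fin P.Nc} {m : ℕ} {q : Fin P.Nc} (hq : q ∈ P.layer i m)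
    {x y : Sp d} (hx : x ∈ P.T i) (hy : y ∈ P.T q) : dist x y ≤ (m + 1) * P.H := by
  induction m generalizing q y with
  | zero =>
    obtain rfl : q = i := hq
    simpa using dist_le_H hx hy
  | succ m ih =>
    obtain ⟨r, hr, z, hzq, hzr⟩ := hq
    have h1 := ih hr hzr
    have h2 := dist_le_H hzq hy
    have h3 := dist_triangle x z y
    push_cast
    linarith

/-- Every such cell lies within (k_i + 2)H ≤ 2(k + 1)H of a fixed point of cell q, and disjoint
balls of radius H/σ are packed into this ball. -/
theorem IsRegular.ncard_layer_le {σ c : ℝ} (hσ : 0 < σ) (h : P.IsRegular σ c)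
    (k : Fin P.Nc → ℕ) (q : Fin P.Nc) (hq : (P.T q).Nonempty) :
    ({i | q ∈ P.layer i (k i + 1)}.ncard : ℝ) ≤ (2 * σ) ^ d * ((P.kmax k : ℝ) + 1) ^ d := by
  classical
  obtain ⟨z, hz⟩ := hq
  have hH := P.H_pos
  have h1 := h.card_mul_pow_le hσ {i | q ∈ P.layer i (k i + 1)}.toFinset z
    (ρ := (2 * (P.kmax k + 1)) * P.H) (by positivity) (by
      intro i hi x hx
      rw [mem_toFinset] at hi
      have h2 := dist_le_of_mem_layer hi hx hz
      have h3 : k i ≤ P.kmax k := Finset.le_sup (Finset.mem_univ i)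
      have h4 : (k i : ℝ) ≤ P.kmax k := Nat.cast_le.2 h3
      have h5 : 0 ≤ (P.kmax k : ℝ) := Nat.cast_nonneg _
      refine h2.trans ?_
      refine mul_le_mul_of_nonneg_right ?_ hH.le
      push_cast
      linarith)
  rw [ncard_eq_toFinset_card']
  rw [div_pow, ← le_div_iff₀ (by positivity)] at h1
  refine h1.trans_eq ?_
  rw [mul_pow, mul_pow, mul_pow]
  field_simp

/-- An overlap bound independent of k. In the bilinear case only lower bounds on the k_i are
assumed, so a power of their maximum could not be absorbed by a decay governed by the smallest one.
-/
theorem IsRegular.Nc_le {σ c R : ℝ} (hσ : 0 < σ) (h : P.IsRegular σ c)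
    (hR : Metric.diam P.Ω ≤ R) : (P.Nc : ℝ) ≤ (R * σ / P.H) ^ d := by
  obtain ⟨z, hz⟩ := P.isConnected_Ω.nonempty
  have hH := P.H_pos
  have h1 := h.card_mul_pow_le hσ Finset.univ z (ρ := R) (Metric.diam_nonneg.trans hR)
    fun i _ x hx => by
      have := Metric.dist_le_diam_of_mem P.isBounded_Ω.closure (P.T_subset i hx)
        (subset_closure hz)
      rw [Metric.diam_closure] at this
      exact this.trans hR
  rw [Finset.card_univ, Fintype.card_fin, div_pow, ← le_div_iff₀ (by positivity)] at h1
  refine h1.trans_eq ?_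
  rw [div_pow, mul_pow]
  field_simp

/-- The partition of unity sums to one on a nonempty cell, which must then have a vertex. Hence 1 +
Γ ≤ D. -/
theorem one_le_CT (i : Fin P.Nc) (hi : (P.T i).Nonempty) : 1 ≤ P.CT := by
  obtain ⟨x, hx⟩ := hi
  have h1 : ∃ j, P.node j ∈ P.T i := by
    by_contra hcon
    push Not at hcon
    have h2 := P.χ_sum i x hx
    rw [Finset.sum_eq_zero fun j _ => P.χ_support j i (hcon j) x hx] at h2
    exact zero_ne_one h2
  have h2 : 1 ≤ Finset.univ.sup fun i => {j | P.node j ∈ P.T i}.ncard :=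
    le_trans ((Set.ncard_pos).2 h1) (Finset.le_sup (f := fun i => {j | P.node j ∈ P.T i}.ncard)
      (Finset.mem_univ i))
  unfold CT
  exact one_le_pow₀ (by exact_mod_cast h2)

theorem IsRegular.kt_le {σ c : ℝ} (hd3 : d ≤ 3) (h : P.IsRegular σ c) :
    ∀ᵐ x ∂(volume.restrict P.Ωε), P.kt x ≤ 8 * (c / P.H) ^ 2 := by
  filter_upwards [ae_all_iff.2 h.2, P.ae_mem_K] with x hx ⟨i, hi⟩
  have h1 : P.kt x = ∑ j ∈ P.verts i, ‖fderiv ℝ (P.χ j) x‖ ^ 2 := by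
    refine (Finset.sum_subset (Finset.subset_univ _) fun j _ hj => ?_).symm
    rw [P.fderiv_χ_eq_zero hi.1 hj, norm_zero, zero_pow two_ne_zero]
  rw [h1]
  refine (Finset.sum_le_card_nsmul _ _ _ fun j _ =>
    pow_le_pow_left₀ (norm_nonneg _) (hx j) 2).trans ?_
  rw [nsmul_eq_mul]
  have h2 : ((P.verts i).card : ℝ) ≤ 8 := by
    have := (P.card_verts_le i).trans (Nat.pow_le_pow_right two_pos hd3)
    exact_mod_cast this
  gcongr

/-- The cell map and the shape functions use the same multilinear polynomials, so the partition of
unity reproduces the coordinates. -/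
theorem IsBilinear.sum_smul_node (h : P.IsBilinear) {i : Fin P.Nc} {x : Sp d} (hx : x ∈ P.T i) :
    ∑ j, P.χ j x • P.node j = x := by
  obtain ⟨e, -, -, hT, hχ⟩ := h i
  rw [hT] at hx
  obtain ⟨t, ht, rfl⟩ := hx
  simp only [hχ _ t ht, Finset.sum_smul]
  rw [Finset.sum_comm]
  refine Finset.sum_congr rfl fun b _ => ?_
  simp [ite_smul]

/-- For a bilinear partition of unity the weight is at least of order `H⁻²`. -/
theorem IsBilinear.one_le_kt (h : P.IsBilinear) (hd : 0 < d) (hd3 : d ≤ 3) :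
    ∀ᵐ x ∂(volume.restrict P.Ωε), 1 ≤ 8 * P.H ^ 2 * P.kt x := by
  filter_upwards [ae_restrict_of_ae P.ae_differentiableAt_χ, P.ae_mem_K] with x hdx ⟨i, hi⟩
  have hxT := P.K_subset_T i hi
  let v : Sp d := EuclideanSpace.single ⟨0, hd⟩ 1
  have hv : ‖v‖ = 1 := by simp [v]
  -- Differentiating ∑ χ_j(y) node_j = y in the unit direction v, and subtracting x times the
  -- vanishing sum of gradients, gives ∑ ∂_vχ_j (node_j - x) = v. The vertices of the cell are
  -- within H of x, so Cauchy–Schwarz over at most eight terms yields 1 ≤ 8H²κ̃.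
  have h1 : HasFDerivAt (fun y => ∑ j, P.χ j y • P.node j)
      (∑ j, (fderiv ℝ (P.χ j) x).smulRight (P.node j)) x :=
    HasFDerivAt.fun_sum fun j _ => (hdx j).hasFDerivAt.smul_const _
  have h2 : (fun y => ∑ j, P.χ j y • P.node j) =ᶠ[𝓝 x] id := by
    filter_upwards [P.interior_mem_nhds hi.1] with y hy using h.sum_smul_node hy
  have h3 := (h1.congr_of_eventuallyEq h2.symm).unique (hasFDerivAt_id x)
  have h4 := P.sum_fderiv_χ hi.1 hdx
  have h5 : ∑ j, (fderiv ℝ (P.χ j) x v) • (P.node j - x) = v := by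
    have e1 := congrArg (fun A : Sp d →L[ℝ] Sp d => A v) h3
    have e2 := congrArg (fun A : Sp d →L[ℝ] ℝ => A v) h4
    simp only [_root_.sum_apply, ContinuousLinearMap.smulRight_apply,
      ContinuousLinearMap.id_apply, _root_.zero_apply] at e1 e2
    simp only [smul_sub, Finset.sum_sub_distrib, ← Finset.sum_smul, e1, e2, zero_smul, sub_zero]
  have h6 : ∑ j ∈ P.verts i, (fderiv ℝ (P.χ j) x v) • (P.node j - x) = v := by
    refine (Finset.sum_subset (Finset.subset_univ (P.verts i)) fun j _ hj => ?_).trans h5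
    rw [P.fderiv_χ_eq_zero hi.1 hj, _root_.zero_apply, zero_smul]
  have h7 := norm_sum_sq_le (P.verts i) fun j => (fderiv ℝ (P.χ j) x v) • (P.node j - x)
  rw [h6, hv, one_pow] at h7
  have h8 : ∑ j ∈ P.verts i, ‖(fderiv ℝ (P.χ j) x v) • (P.node j - x)‖ ^ 2 ≤
      P.H ^ 2 * P.kt x := by
    refine le_trans ?_ (mul_le_mul_of_nonneg_left (P.sum_sq_le_kt (P.verts i) x) (sq_nonneg _))
    rw [Finset.mul_sum]
    refine Finset.sum_le_sum fun j hj => ?_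
    rw [norm_smul, mul_pow, mul_comm]
    have e1 : ‖P.node j - x‖ ≤ P.H := by
      rw [← dist_eq_norm]; exact dist_le_H (P.mem_verts.1 hj) hxT
    have e2 : ‖fderiv ℝ (P.χ j) x v‖ ≤ ‖fderiv ℝ (P.χ j) x‖ := by
      simpa [hv] using (fderiv ℝ (P.χ j) x).le_opNorm v
    gcongr
  have h9 : ((P.verts i).card : ℝ) ≤ 8 := by
    have := (P.card_verts_le i).trans (Nat.pow_le_pow_right two_pos hd3)
    exact_mod_cast this
  calc (1 : ℝ) ≤ _ := h7
    _ ≤ 8 * (P.H ^ 2 * P.kt x) := mul_le_mul h9 h8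
      (Finset.sum_nonneg fun j _ => sq_nonneg _) (by norm_num)
    _ = _ := by ring

theorem IsBilinear.abs_rpow_mul_le (h : P.IsBilinear) (hd : 0 < d) (hd3 : d ≤ 3)
    (f : Sp d → ℝ) : ∀ᵐ x ∂(volume.restrict P.Ωε),
      |P.kt x ^ (-(1 / 2) : ℝ) * f x| ≤ √8 * P.H * |f x| := by
  filter_upwards [h.one_le_kt hd hd3] with x hx
  have hH := P.H_pos
  have h0 := P.kt_nonneg x
  have h1 : 0 < P.kt x := by
    rcases h0.eq_or_lt with h2 | h2
    · rw [← h2] at hx; norm_num at hx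
    · exact h2
  rw [abs_mul, rpow_neg_half h0, abs_of_nonneg (Real.sqrt_nonneg _)]
  gcongr
  rw [← Real.sqrt_sq hH.le, ← Real.sqrt_mul (by norm_num)]
  apply Real.sqrt_le_sqrt
  rw [inv_le_iff_one_le_mul₀ h1]
  exact hx

theorem IsBilinear.memLp (h : P.IsBilinear) (hd : 0 < d) (hd3 : d ≤ 3) {f : Sp d → ℝ}
    (hf : MemLp f 2 (volume.restrict P.Ωε)) :
    MemLp (fun x => P.kt x ^ (-(1 / 2) : ℝ) * f x) 2 (volume.restrict P.Ωε) :=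
  MemLp.of_le_mul (c := √8 * P.H) hf
    ((P.measurable_kt.pow_const _).aestronglyMeasurable.mul hf.1) (h.abs_rpow_mul_le hd hd3 f)

theorem IsBilinear.l2Norm_le (h : P.IsBilinear) (hd : 0 < d) (hd3 : d ≤ 3) {f : Sp d → ℝ}
    (hf : MemLp f 2 (volume.restrict P.Ωε)) :
    l2Norm P.Ωε (fun x => P.kt x ^ (-(1 / 2) : ℝ) * f x) ≤ √8 * P.H * l2Norm P.Ωε f := by
  have hH := P.H_pos
  unfold l2Norm
  rw [← Real.sqrt_sq (show 0 ≤ √8 * P.H by positivity), ← Real.sqrt_mul (by positivity),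
    ← integral_const_mul]
  apply Real.sqrt_le_sqrt
  refine integral_mono_ae (h.memLp hd hd3 hf).integrable_sq (hf.integrable_sq.const_mul _) ?_
  filter_upwards [h.abs_rpow_mul_le hd hd3 f] with x hx
  have := pow_le_pow_left₀ (abs_nonneg _) hx 2
  rwa [sq_abs, mul_pow _ |f x|, sq_abs] at this

/-- Galerkin stability and two uses of Poincaré bound ‖u‖, and κ̃ ≤ 8(c/H)² converts this to the
s-norm at the price of 1/H. -/
theorem sNorm_galerkin_le {σ c cP : ℝ} (hd3 : d ≤ 3) (hc : 0 < c) (hreg : P.IsRegular σ c)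
    (hcP : 0 < cP) (hP : P.IsPoincareConst cP) {W : Submodule ℝ (Sp d → ℝ)} (hW : W ≤ P.spaceV)
    {f u : Sp d → ℝ} (hf : MemLp f 2 (volume.restrict P.Ωε)) (hu : P.IsGalerkin W f u) :
    P.sNorm u ≤ √8 * c * cP ^ 2 / P.H * l2Norm P.Ωε f := by
  have hH := P.H_pos
  have hV : P.MemV u := hW hu.1
  have hum := hV.memH1.1
  have h0 : 0 ≤ l2Norm P.Ωε f := Real.sqrt_nonneg _
  have ha0 : 0 ≤ aNorm P.Ωε u := Real.sqrt_nonneg _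
  have h1 : aNorm P.Ωε u ^ 2 ≤ l2Norm P.Ωε f * l2Norm P.Ωε u := by
    rw [aNorm, Real.sq_sqrt (aForm_self_nonneg _ _), hu.2 u hu.1]
    refine le_trans ?_ (abs_integral_mul_le hf hum)
    refine integral_mono (hf.integrable_mul hum) (hf.norm.integrable_mul hum.norm) fun x => ?_
    show _ ≤ |_| * |_|
    rw [← abs_mul]; exact le_abs_self _
  have h2 := hP u hV
  have h3 : aNorm P.Ωε u ≤ cP * l2Norm P.Ωε f := by
    by_contra hcon
    push Not at hcon
    have h4 : l2Norm P.Ωε f * l2Norm P.Ωε u ≤ l2Norm P.Ωε f * (cP * aNorm P.Ωε u) :=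
      mul_le_mul_of_nonneg_left h2 h0
    have h5 : 0 < aNorm P.Ωε u := lt_of_le_of_lt (by positivity) hcon
    nlinarith
  have h4 : l2Norm P.Ωε u ≤ cP ^ 2 * l2Norm P.Ωε f := by
    refine h2.trans ?_
    rw [sq, mul_assoc]
    exact mul_le_mul_of_nonneg_left h3 hcP.le
  have h5 : P.sNorm u ≤ √8 * (c / P.H) * l2Norm P.Ωε u := by
    unfold sNorm l2Norm
    rw [← Real.sqrt_sq (show 0 ≤ c / P.H by positivity), ← Real.sqrt_mul (by norm_num),
      ← Real.sqrt_mul (by positivity)]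
    apply Real.sqrt_le_sqrt
    unfold s wForm
    rw [← integral_const_mul]
    refine integral_mono_ae (integrable_kt hum hum) (hum.integrable_sq.const_mul _) ?_
    filter_upwards [hreg.kt_le hd3] with x hx
    rw [mul_assoc, ← sq]
    exact mul_le_mul_of_nonneg_right hx (sq_nonneg _)
  calc P.sNorm u ≤ _ := h5
    _ ≤ √8 * (c / P.H) * (cP ^ 2 * l2Norm P.Ωε f) := by gcongr
    _ = _ := by ring

end Discretization
end CEM

/-! ### The error estimates -/

namespace CEM
open Filter Topology

namespace Discretization

variable {d : ℕ} {P : Discretization d} {lam : Fin P.Nc → ℕ → ℝ} {phi : Fin P.Nc → ℕ → Sp d → ℝ}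
  {l : Fin P.Nc → ℕ}

/-- Without cells the covering makes the perforated domain null. The case is treated apart because
then `CT` and `Lam` are 0. -/
theorem aNorm_eq_zero_of_isEmpty (h : IsEmpty (Fin P.Nc)) (u : Sp d → ℝ) :
    aNorm P.Ωε u = 0 := by
  have h1 : ∀ᵐ x ∂(volume.restrict P.Ωε), False := by
    filter_upwards [P.ae_mem_K] with x ⟨i, _⟩ using h.elim i
  have h2 : volume.restrict P.Ωε = 0 := by
    rwa [← ae_eq_bot, ← Filter.empty_mem_iff_bot]
  rw [aNorm, aForm, h2, integral_zero_measure, Real.sqrt_zero]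

/-- The decay rate of the basis functions, `L` being the inverse of the spectral gap. -/
def rate (L : ℝ) : ℝ := (1 + (2 * (1 + √L))⁻¹)⁻¹

theorem rate_pos (L : ℝ) : 0 < rate L := by unfold rate; positivity

theorem rate_lt_one (L : ℝ) : rate L < 1 := by
  unfold rate
  apply inv_lt_one_of_one_lt₀
  have : 0 < (2 * (1 + √L))⁻¹ := by positivity
  linarith

theorem patch_subset (P : Discretization d) (i : Fin P.Nc) (m : ℕ) : P.patch i m ⊆ P.Ωε :=
  iUnion₂_subset fun q _ => P.K_subset_Ωε q

/-- Both Λ of a patch and Λ of its complement have inverses at most that of the whole domain, and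
`rate` increases with L. Since k_i - 1 ≥ n, all E_i share one geometric bound. -/
theorem Emax_le (hl : ∀ i, 0 < lam i (l i)) {k : Fin P.Nc → ℕ} {n : ℕ} (hn : ∀ i, n + 1 ≤ k i) :
    P.Emax lam l k ≤ 3 * (1 + (P.Lam lam l P.Ωε)⁻¹) * rate (P.Lam lam l P.Ωε)⁻¹ ^ n := by
  set L := (P.Lam lam l P.Ωε)⁻¹ with hL
  have hΛ : ∀ S, 0 ≤ P.Lam lam l S := Lam_nonneg hl
  have hL0 : 0 ≤ L := inv_nonneg.2 (hΛ _)
  have hr := rate_pos L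
  refine Real.iSup_le (fun i => ?_) (by positivity)
  unfold Ei
  have e : (1 : ℤ) - (k i : ℤ) = -((k i - 1 : ℕ) : ℤ) := by
    have := hn i; push_cast [Nat.cast_sub (le_trans (Nat.le_add_left 1 n) this)]; ring
  rw [e, zpow_neg, zpow_natCast, ← inv_pow, rpow_neg_half (hΛ _)]
  have h1 : (P.Lam lam l (P.Ωε \ P.patch i (k i - 1)))⁻¹ ≤ L := Lam_anti hl sdiff_subset
  have h2 : (P.Lam lam l (P.patch i (k i - 1)))⁻¹ ≤ L := Lam_anti hl (P.patch_subset _ _)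
  have h3 := rate_pos ((P.Lam lam l (P.patch i (k i - 1)))⁻¹)
  have h4 : rate ((P.Lam lam l (P.patch i (k i - 1)))⁻¹) ≤ rate L := by
    unfold rate; gcongr
  have h5 := inv_nonneg.2 (hΛ (P.Ωε \ P.patch i (k i - 1)))
  show _ * rate ((P.Lam lam l (P.patch i (k i - 1)))⁻¹) ^ (k i - 1) ≤ _
  have h6 : rate ((P.Lam lam l (P.patch i (k i - 1)))⁻¹) ^ (k i - 1) ≤ rate L ^ n :=
    (pow_le_pow_left₀ h3.le h4 _).trans
      (pow_le_pow_of_le_one hr.le (rate_lt_one L).le (Nat.le_sub_of_add_le (hn i)))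
  gcongr

end Discretization

/-- Oversampling sizes for which the localization error is of the order of the mesh size. -/
theorem exists_oversampling (A : ℝ) {H Λ : ℝ} (hH : 0 < H) (hΛ : 0 < Λ) :
    ∃ n : ℕ, A * Discretization.rate Λ⁻¹ ^ n ≤ H ^ 4 * Λ⁻¹ := by
  have h1 : Tendsto (fun n : ℕ => A * Discretization.rate Λ⁻¹ ^ n) atTop (𝓝 (A * 0)) :=
    (tendsto_pow_atTop_nhds_zero_of_lt_one (Discretization.rate_pos _).le
      (Discretization.rate_lt_one _)).const_mul A
  rw [mul_zero] at h1
  have h2 : 0 < H ^ 4 * Λ⁻¹ := by positivity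
  exact ((h1.eventually (gt_mem_nhds h2)).exists).imp fun n hn => le_of_lt hn


namespace Discretization

variable {d : ℕ} {P : Discretization d} {lam : Fin P.Nc → ℕ → ℝ} {phi : Fin P.Nc → ℕ → Sp d → ℝ}
  {l : Fin P.Nc → ℕ}

theorem D_nonneg (h : P.IsEigensystem lam phi) (S : Set (Sp d)) : 0 ≤ P.D lam l S := by
  unfold D CT
  have := Gam_nonneg (l := l) h S
  positivity

/-- The overlap number is replaced by its packing bound of order (k + 1)^d, and 1 + Γ by 1 + D. -/
theorem aNorm_sub_multiscale_le_kmax (h : P.IsEigensystem lam phi) (hd3 : d ≤ 3)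
    {σ c cπ cP : ℝ} (hσ : 0 < σ) (hreg : P.IsRegular σ c)
    (hcπ : 0 < cπ) (hC : P.Cpi phi l ≤ ENNReal.ofReal cπ) (hl : ∀ i, 0 < lam i (l i))
    (hP : P.IsPoincareConst cP) {k : Fin P.Nc → ℕ} (hk : ∀ i, 2 ≤ k i)
    {psi psiMs : (i : Fin P.Nc) → Fin (l i) → Sp d → ℝ}
    (hpsi : ∀ i (j : Fin (l i)), P.IsGlobalBasis phi l i j (psi i j))
    (hpsiMs : ∀ i (j : Fin (l i)), P.IsLocalBasis phi l i (k i) j (psiMs i j))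
    {f u uGlo uMs : Sp d → ℝ}
    (hf : MemLp (fun x => P.kt x ^ (-(1 / 2) : ℝ) * f x) 2 (volume.restrict P.Ωε))
    (hu : P.IsWeakSolution f u) (hg : P.IsGalerkin (P.basisSpan l psi) f uGlo)
    (hm : P.IsGalerkin (P.basisSpan l psiMs) f uMs) :
    aNorm P.Ωε (u - uMs) ≤ √((P.Lam lam l P.Ωε)⁻¹) *
        l2Norm P.Ωε (fun x => P.kt x ^ (-(1 / 2) : ℝ) * f x) +
      √(49 * (2 * σ) ^ d * (liftConst cπ + 1) ^ 2) * √(((P.kmax k : ℝ) + 1) ^ d) *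
        √(1 + (P.Lam lam l P.Ωε)⁻¹) * √(1 + P.D lam l P.Ωε) * √(P.Emax lam l k) *
        P.sNorm uGlo := by
  have hL := inv_nonneg.2 (Lam_nonneg (P := P) hl P.Ωε)
  have hΓ := Gam_nonneg (l := l) h P.Ωε
  have hD := D_nonneg (l := l) h P.Ωε
  have hE := Emax_nonneg (P := P) hl k
  have hs : 0 ≤ P.sNorm uGlo := Real.sqrt_nonneg _
  have hκ := liftConst_nonneg cπ
  rcases isEmpty_or_nonempty (Fin P.Nc) with hN | ⟨⟨i₀⟩⟩
  · rw [aNorm_eq_zero_of_isEmpty hN]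
    have : 0 ≤ l2Norm P.Ωε (fun x => P.kt x ^ (-(1 / 2) : ℝ) * f x) := Real.sqrt_nonneg _
    positivity
  have hx : 0 ≤ (2 * σ) ^ d * ((P.kmax k : ℝ) + 1) ^ d := by positivity
  refine (aNorm_sub_multiscale_le h hd3 hcπ hC hl hP hk hpsi hpsiMs hf hu hg hm
    (N := ⌊(2 * σ) ^ d * ((P.kmax k : ℝ) + 1) ^ d⌋₊) fun q =>
      Nat.le_floor (hreg.ncard_layer_le hσ k q (h.nonempty_T q))).trans ?_
  have h1 := Nat.floor_le hx
  have h2 : 1 + P.Gam lam l P.Ωε ≤ 1 + P.D lam l P.Ωε := by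
    have h3 := one_le_CT i₀ (h.nonempty_T i₀)
    unfold D
    nlinarith
  have h4 : 1 + liftConst cπ * (1 + P.Gam lam l P.Ωε) ≤
      (liftConst cπ + 1) * (1 + P.D lam l P.Ωε) := by nlinarith
  gcongr
  rw [← Real.sqrt_mul (by positivity), ← Real.sqrt_mul (by positivity),
    ← Real.sqrt_mul (by positivity), ← Real.sqrt_mul (by positivity)]
  apply Real.sqrt_le_sqrt
  calc _ ≤ 49 * (1 + (P.Lam lam l P.Ωε)⁻¹) * ((2 * σ) ^ d * ((P.kmax k : ℝ) + 1) ^ d) *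
        P.Emax lam l k * (liftConst cπ + 1) * ((liftConst cπ + 1) * (1 + P.D lam l P.Ωε)) := by
        gcongr
    _ = _ := by ring

/-- First order convergence for a bilinear partition of unity and sufficient oversampling. -/
theorem IsBilinear.aNorm_sub_multiscale_le (hb : P.IsBilinear) (h : P.IsEigensystem lam phi)
    (hd0 : 0 < d) (hd3 : d ≤ 3) {σ c cπ cP R : ℝ} (hσ : 0 < σ) (hc : 0 < c)
    (hreg : P.IsRegular σ c) (hdiam : Metric.diam P.Ω ≤ R) (hcπ : 0 < cπ) (hcP : 0 < cP)
    (hC : P.Cpi phi l ≤ ENNReal.ofReal cπ) (hl : ∀ i, 0 < lam i (l i))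
    (hP : P.IsPoincareConst cP) {k : Fin P.Nc → ℕ} (hk : ∀ i, 2 ≤ k i)
    {psi psiMs : (i : Fin P.Nc) → Fin (l i) → Sp d → ℝ}
    (hpsi : ∀ i (j : Fin (l i)), P.IsGlobalBasis phi l i j (psi i j))
    (hpsiMs : ∀ i (j : Fin (l i)), P.IsLocalBasis phi l i (k i) j (psiMs i j))
    {f u uGlo uMs : Sp d → ℝ} (hf : MemLp f 2 (volume.restrict P.Ωε))
    (hu : P.IsWeakSolution f u) (hg : P.IsGalerkin (P.basisSpan l psi) f uGlo)
    (hm : P.IsGalerkin (P.basisSpan l psiMs) f uMs) {n : ℕ} (hnk : ∀ i, n + 1 ≤ k i)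
    (hn : 0 < P.Lam lam l P.Ωε →
      49 * (1 + (P.Lam lam l P.Ωε)⁻¹) * (R * σ / P.H) ^ d * (3 * (1 + (P.Lam lam l P.Ωε)⁻¹)) *
        (liftConst cπ + 1) * (1 + liftConst cπ * (1 + P.Gam lam l P.Ωε)) *
        (√8 * c * cP ^ 2) ^ 2 * rate (P.Lam lam l P.Ωε)⁻¹ ^ n ≤
      P.H ^ 4 * (P.Lam lam l P.Ωε)⁻¹) :
    aNorm P.Ωε (u - uMs) ≤
      (1 + √8) * P.H * √((P.Lam lam l P.Ωε)⁻¹) * l2Norm P.Ωε f := by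
  have hH := P.H_pos
  have hR : 0 ≤ R := Metric.diam_nonneg.trans hdiam
  have hf0 : 0 ≤ l2Norm P.Ωε f := Real.sqrt_nonneg _
  rcases isEmpty_or_nonempty (Fin P.Nc) with hN | ⟨⟨i₀⟩⟩
  · rw [aNorm_eq_zero_of_isEmpty hN]
    positivity
  specialize hn (Lam_pos hl (h.K_inter_nonempty i₀))
  have hL := inv_nonneg.2 (Lam_nonneg (P := P) hl P.Ωε)
  have hΓ := Gam_nonneg (l := l) h P.Ωε
  have hE := Emax_nonneg (P := P) hl k
  have hκ := liftConst_nonneg cπ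
  have hEn := Emax_le hl hnk
  set L := (P.Lam lam l P.Ωε)⁻¹ with hLdef
  set κ := liftConst cπ
  have hx : 0 ≤ (R * σ / P.H) ^ d := by positivity
  have h1 := Discretization.aNorm_sub_multiscale_le h hd3 hcπ hC hl hP hk hpsi hpsiMs
    (hb.memLp hd0 hd3 hf) hu hg hm (N := ⌊(R * σ / P.H) ^ d⌋₊) fun q => by
      refine le_trans ?_ (Nat.le_floor (hreg.Nc_le hσ hdiam))
      refine (Set.ncard_le_ncard (subset_univ _)).trans_eq ?_
      rw [Set.ncard_univ, Nat.card_eq_fintype_card, Fintype.card_fin]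
  have h2 := Nat.floor_le hx
  have h3 := hb.l2Norm_le hd0 hd3 hf
  have h4 := sNorm_galerkin_le hd3 hc hreg hcP hP (basisSpan_le fun i j => (hpsi i j).1) hf hg
  set X := 49 * (1 + L) * ⌊(R * σ / P.H) ^ d⌋₊ * P.Emax lam l k * (κ + 1) *
    (1 + κ * (1 + P.Gam lam l P.Ωε)) with hX
  have hX0 : 0 ≤ X := by positivity
  -- Two powers of H are required because ‖u_glo‖_s costs 1/H and a factor H must remain. This
  -- explains H⁴ in the squared condition `hn`.
  have h5 : √X * (√8 * c * cP ^ 2) ≤ P.H ^ 2 * √L := by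
    rw [← Real.sqrt_sq (show 0 ≤ √8 * c * cP ^ 2 by positivity), ← Real.sqrt_mul hX0,
      ← Real.sqrt_sq (show 0 ≤ P.H ^ 2 by positivity), ← Real.sqrt_mul (by positivity)]
    apply Real.sqrt_le_sqrt
    calc X * (√8 * c * cP ^ 2) ^ 2 ≤ 49 * (1 + L) * (R * σ / P.H) ^ d *
          (3 * (1 + L) * rate L ^ n) * (κ + 1) * (1 + κ * (1 + P.Gam lam l P.Ωε)) *
          (√8 * c * cP ^ 2) ^ 2 := by rw [hX]; gcongr
      _ ≤ P.H ^ 4 * L := by refine le_trans (le_of_eq ?_) hn; ring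
      _ = _ := by ring
  have h6 : √X * P.sNorm uGlo ≤ P.H * √L * l2Norm P.Ωε f := by
    calc √X * P.sNorm uGlo ≤ √X * (√8 * c * cP ^ 2 / P.H * l2Norm P.Ωε f) := by gcongr
      _ = √X * (√8 * c * cP ^ 2) * (l2Norm P.Ωε f / P.H) := by ring
      _ ≤ P.H ^ 2 * √L * (l2Norm P.Ωε f / P.H) := by gcongr
      _ = _ := by field_simp
  have h7 := mul_le_mul_of_nonneg_left h3 (Real.sqrt_nonneg L)
  linarith

end Discretization

end CEM

end

/-! ### Choice of the constants and conclusion. -/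

theorem mainTheorem2 (d : ℕ) (hd : d = 2 ∨ d = 3) (σ c₁ cπ cP R : ℝ)
    (hσ : 0 < σ) (hc₁ : 0 < c₁) (hcπ : 0 < cπ) (hcP : 0 < cP) (hR : 0 < R) :
    ∃ C : ℝ, 0 < C ∧ ∃ k₀ : ℝ → ℝ → ℝ → ℕ,
      ∀ P : CEM.Discretization d,
        P.IsRegular σ c₁ → Metric.diam P.Ω ≤ R → P.IsPoincareConst cP →
      ∀ (lam : Fin P.Nc → ℕ → ℝ) (phi : Fin P.Nc → ℕ → CEM.Sp d → ℝ),
        P.IsEigensystem lam phi →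
      ∀ l : Fin P.Nc → ℕ, (∀ i, 1 ≤ l i) → (∀ i, 0 < lam i (l i)) →
        P.Cpi phi l ≤ ENNReal.ofReal cπ →
      ∀ k : Fin P.Nc → ℕ, (∀ i, 2 ≤ k i) →
      ∀ psi psiMs : (i : Fin P.Nc) → Fin (l i) → CEM.Sp d → ℝ,
        (∀ i (j : Fin (l i)), P.IsGlobalBasis phi l i j (psi i j)) →
        (∀ i (j : Fin (l i)), P.IsLocalBasis phi l i (k i) j (psiMs i j)) →
      ∀ f u uGlo uMs : CEM.Sp d → ℝ,
        MemLp f 2 (volume.restrict P.Ωε) →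
        P.IsWeakSolution f u →
        P.IsGalerkin (P.basisSpan l psi) f uGlo →
        P.IsGalerkin (P.basisSpan l psiMs) f uMs →
        (MemLp (fun x => P.kt x ^ (-(1 / 2) : ℝ) * f x) 2 (volume.restrict P.Ωε) →
          max (CEM.l2Norm P.Ωε (u - uMs)) (CEM.aNorm P.Ωε (u - uMs)) ≤
            C * P.Lam lam l P.Ωε ^ (-(1 / 2) : ℝ) *
                CEM.l2Norm P.Ωε (fun x => P.kt x ^ (-(1 / 2) : ℝ) * f x) +
              C * ((P.kmax k : ℝ) + 1) ^ ((d : ℝ) / 2) *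
                (1 + (P.Lam lam l P.Ωε)⁻¹) ^ (1 / 2 : ℝ) *
                (1 + P.D lam l P.Ωε) ^ (1 / 2 : ℝ) *
                P.Emax lam l k ^ (1 / 2 : ℝ) * P.sNorm uGlo) ∧
        (P.IsBilinear →
          (∀ i, k₀ P.H (P.Lam lam l P.Ωε) (P.Gam lam l P.Ωε) ≤ k i) →
          CEM.aNorm P.Ωε (u - uMs) ≤
            C * P.H * P.Lam lam l P.Ωε ^ (-(1 / 2) : ℝ) * CEM.l2Norm P.Ωε f) := by
  have hd3 : d ≤ 3 := by omega
  have hd0 : 0 < d := by omega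
  -- The number of layers is chosen from the bounds and H, Λ, Γ alone, before any discretization is
  -- given; for nonpositive H or Λ any value will do.
  have hex : ∀ H Λ Γ : ℝ, ∃ n : ℕ, 0 < H → 0 < Λ →
      49 * (1 + Λ⁻¹) * (R * σ / H) ^ d * (3 * (1 + Λ⁻¹)) * (CEM.Discretization.liftConst cπ + 1) *
        (1 + CEM.Discretization.liftConst cπ * (1 + Γ)) * (√8 * c₁ * cP ^ 2) ^ 2 *
        CEM.Discretization.rate Λ⁻¹ ^ n ≤ H ^ 4 * Λ⁻¹ := by
    intro H Λ Γ
    by_cases h : 0 < H ∧ 0 < Λ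
    · exact (CEM.exists_oversampling _ h.1 h.2).imp fun n hn _ _ => hn
    · exact ⟨0, fun h1 h2 => absurd ⟨h1, h2⟩ h⟩
  choose n hn using hex
  set C₁ := √(49 * (2 * σ) ^ d * (CEM.Discretization.liftConst cπ + 1) ^ 2) with hC₁
  have hC₁0 : 0 ≤ C₁ := Real.sqrt_nonneg _
  have h8 : 0 ≤ √(8 : ℝ) := Real.sqrt_nonneg _
  -- The factor 1 + cP covers the L² norm as well as the energy norm, C₁ comes from localization,
  -- and 1 + √8 from the bilinear case. The threshold is n + 1 because k_i layers give the decay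
  -- exponent k_i - 1.
  refine ⟨(1 + cP) * (1 + C₁ + √8), by positivity, fun H Λ Γ => n H Λ Γ + 1, ?_⟩
  intro P hreg hdiam hP lam phi h l _ hl hC k hk psi psiMs hpsi hpsiMs f u uGlo uMs hf hu hg hm
  have hL0 := CEM.Discretization.Lam_nonneg (P := P) hl P.Ωε
  have hCP : 1 ≤ 1 + cP := by linarith
  rw [CEM.Discretization.rpow_neg_half hL0]
  refine ⟨fun hkf => ?_, fun hb hkn => ?_⟩
  · have h1 := CEM.Discretization.aNorm_sub_multiscale_le_kmax h hd3 hσ hreg hcπ hC hl hP hk hpsi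
      hpsiMs hkf hu hg hm
    have h2 : CEM.l2Norm P.Ωε (u - uMs) ≤ cP * CEM.aNorm P.Ωε (u - uMs) :=
      hP _ (P.spaceV.sub_mem hu.1
        (CEM.Discretization.basisSpan_le (fun i j => (hpsiMs i j).1.1) hm.1))
    have h3 : 0 ≤ CEM.aNorm P.Ωε (u - uMs) := Real.sqrt_nonneg _
    have hk0 : ((P.kmax k : ℝ) + 1) ^ ((d : ℝ) / 2) = √(((P.kmax k : ℝ) + 1) ^ d) := by
      rw [Real.sqrt_eq_rpow, ← Real.rpow_natCast, ← Real.rpow_mul (by positivity), mul_one_div]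
    simp only [← Real.sqrt_eq_rpow, hk0]
    rw [← hC₁] at h1
    set Z := CEM.l2Norm P.Ωε fun x => P.kt x ^ (-(1 / 2) : ℝ) * f x
    set Q := √(((P.kmax k : ℝ) + 1) ^ d) * √(1 + (P.Lam lam l P.Ωε)⁻¹) *
      √(1 + P.D lam l P.Ωε) * √(P.Emax lam l k) * P.sNorm uGlo with hQ
    have hZ : 0 ≤ √(P.Lam lam l P.Ωε)⁻¹ * Z := mul_nonneg (Real.sqrt_nonneg _) (Real.sqrt_nonneg _)
    have hQ0 : 0 ≤ Q := mul_nonneg (by positivity) (Real.sqrt_nonneg _)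
    have h4 : CEM.aNorm P.Ωε (u - uMs) ≤ (1 + C₁ + √8) * (√(P.Lam lam l P.Ωε)⁻¹ * Z + Q) := by
      have e : C₁ * √(((P.kmax k : ℝ) + 1) ^ d) * √(1 + (P.Lam lam l P.Ωε)⁻¹) *
        √(1 + P.D lam l P.Ωε) * √(P.Emax lam l k) * P.sNorm uGlo = C₁ * Q := by rw [hQ]; ring
      rw [e] at h1
      nlinarith [mul_nonneg hC₁0 hZ, mul_nonneg h8 hZ, mul_nonneg h8 hQ0]
    have h5 : max (CEM.l2Norm P.Ωε (u - uMs)) (CEM.aNorm P.Ωε (u - uMs)) ≤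
        (1 + cP) * CEM.aNorm P.Ωε (u - uMs) :=
      max_le (by linarith) (le_mul_of_one_le_left h3 hCP)
    refine h5.trans ((mul_le_mul_of_nonneg_left h4 (by linarith)).trans_eq ?_)
    rw [hQ]; ring
  · have h1 := hb.aNorm_sub_multiscale_le h hd0 hd3 hσ hc₁ hreg hdiam hcπ hcP hC hl hP hk hpsi
      hpsiMs hf hu hg hm hkn fun hΛ => hn _ _ _ P.H_pos hΛ
    have h2 : 1 + √8 ≤ (1 + cP) * (1 + C₁ + √8) := by nlinarith
    have hH := P.H_pos
    have h3 : 0 ≤ CEM.l2Norm P.Ωε f := Real.sqrt_nonneg _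
    refine h1.trans ?_
    gcongr
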